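/- A family of nonzero complex numbers $v_1,\dots,v_m$ is called generic if $\prod_i v_i^{j_i}=1$ with $j_i\in\mathbb Z$ implies $j_1=\dots=j_m=0$. Let $n\ge 0$, let $q_1,q_2,u_1,\dots,u_n\in\mathbb C^\times$ be generic, and put $q_3=(q_1q_2)^{-1}$ and $g(z,w)=(z-q_1w)(z-q_2w)(z-q_3w)$. Let $\mathcal E$ be the unital associative $\mathbb C$-algebra with generators $e_i,f_i$ ($i\in\mathbb Z$), $\psi^+_i,\psi^-_{-i}$ ($i\ge0$), $(\psi^\pm_0)^{-1}$ and relations, in terms of $e(z)=\sum_{i\in\mathbb Z} e_iz^{-i}$, $f(z)=\sum_{i\in\mathbb Z} f_iz^{-i}$, $\psi^\pm(z)=\sum_{\pm i\ge0}\psi^\pm_iz^{-i}$, $\delta(z)=\sum_{k\in\mathbb Z}z^k$: $$g(z,w)e(z)e(w)=-g(w,z)e(w)e(z),\qquad g(w,z)f(z)f(w)=-g(z,w)f(w)f(z),$$ $$g(z,w)\psi^\pm(z)e(w)=-g(w,z)e(w)\psi^\pm(z),\qquad g(w,z)\psi^\pm(z)f(w)=-g(z,w)f(w)\psi^\pm(z),$$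 $$[e(z),f(w)]=\frac{\delta(z/w)}{g(1,1)}(\psi^+(z)-\psi^-(z)),\qquad \text{all }\psi^\pm_i\text{ commute},\qquad \psi_0^\pm(\psi_0^\pm)^{-1}=(\psi_0^\pm)^{-1}\psi_0^\pm=1,$$ $$[e_0,[e_1,e_{-1}]]=0,\qquad [f_0,[f_1,f_{-1}]]=0.$$ Let $\mathcal P^+$ be the set of partitions $\lambda=(\lambda_1\ge\lambda_2\ge\dots)$ with finitely many nonzero parts, and let $\mathcal F(u)$ ($u\in\mathbb C^\times$) be the complex vector space with basis $|\lambda\rangle$, $\lambda\in\mathcal P^+$. For $s\ge1$, $\mathbf 1_s$ is the sequence with $1$ in position $s$ and $0$ elsewhere. Define the rational functions $$\psi_{\lambda,j}(z)=\frac{(1-q_1^{m}q_3v/z)(1-q_1^{m}q_2v/z)}{(1-q_1^{m}v/z)(1-q_1^{m-1}v/z)},\quad m=\lambda_j-j+1,\ v=uq_2^{-j+1};\qquad \psi_\emptyset(x)=\frac{1-q_2x}{1-x};$$ $$\Psi_{\lambda,u}(z)=\psi_\emptyset(u/z)\prod_{j\ge1}\frac{\psi_{\lambda,j}(z)}{\psi_{\emptyset,j}(z)},$$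 where all but finitely many factors of the product are $1$. When $\lambda+\mathbf 1_s\in\mathcal P^+$ put $p=q_1^{\lambda_s}q_3^{s-1}u$ and $$E_{\lambda,s,u}=\frac1{1-q_1}\prod_{j<s}\psi_{\lambda,j}(p),\qquad F_{\lambda,s,u}=\frac{q_1}{1-q_1}\,\psi_\emptyset(uq_3^{s}/p)\prod_{j>s}\frac{\psi_{\lambda,j}(p)}{\psi_{\emptyset,j}(p)}.$$ For $\boldsymbol\lambda=(\lambda^{(1)},\dots,\lambda^{(n)})\in(\mathcal P^+)^n$ write $|\boldsymbol\lambda\rangle=|\lambda^{(1)}\rangle\otimes\dots\otimes|\lambda^{(n)}\rangle$, and let $\boldsymbol\lambda+\mathbf 1_s^{(i)}$ be $\boldsymbol\lambda$ with $\lambda^{(i)}$ replaced by $\lambda^{(i)}+\mathbf 1_s$. The action of $\mathcal E$ on $\mathcal F(u_1)\otimes\dots\otimes\mathcal F(u_n)$ given by the comultiplication rule ($\triangle e(z)=e(z)\otimes1+\psi^-(z)\otimes e(z)$, $\triangle f(z)=f(z)\otimes\psi^+(z)+1\otimes f(z)$, $\triangle\psi^\pm(z)=\psi^\pm(z)\otimes\psi^\pm(z)$)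 is the action with the following matrix coefficients, where $p=q_1^{\lambda^{(i)}_s}q_3^{s-1}u_i$: $$\langle\boldsymbol\lambda+\mathbf 1_s^{(i)}|e(z)|\boldsymbol\lambda\rangle=\Big(\prod_{k<i}\Psi_{\lambda^{(k)},u_k}(p)\Big)E_{\lambda^{(i)},s,u_i}\,\delta(p/z),$$ $$\langle\boldsymbol\lambda|f(z)|\boldsymbol\lambda+\mathbf 1_s^{(i)}\rangle=F_{\lambda^{(i)},s,u_i}\Big(\prod_{k>i}\Psi_{\lambda^{(k)},u_k}(p)\Big)\delta(p/z),$$ all other matrix coefficients of $e(z)$ and $f(z)$ being zero, and $\psi^\pm(z)|\boldsymbol\lambda\rangle=\big(\prod_{k=1}^n\Psi_{\lambda^{(k)},u_k}(z)\big)|\boldsymbol\lambda\rangle$, where the rational function is expanded in $z^{-1}$ for $\psi^+$ and in $z$ for $\psi^-$. Theorem. Let $\sigma\in S_n$. The formulas above define $\mathcal E$-module structures on $\mathcal F(u_1)\otimes\dots\otimes\mathcal F(u_n)$ and on $\mathcal F(u_{\sigma(1)})\otimes\dots\otimes\mathcal F(u_{\sigma(n)})$, and there exist nonzero constants $b_{\boldsymbol\lambda}\in\mathbb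 C$, $\boldsymbol\lambda\in(\mathcal P^+)^n$, such that the linear map $$\mathcal F(u_1)\otimes\dots\otimes\mathcal F(u_n)\to\mathcal F(u_{\sigma(1)})\otimes\dots\otimes\mathcal F(u_{\sigma(n)}),\qquad |\lambda^{(1)}\rangle\otimes\dots\otimes|\lambda^{(n)}\rangle\mapsto b_{\boldsymbol\lambda}\,|\lambda^{(\sigma(1))}\rangle\otimes\dots\otimes|\lambda^{(\sigma(n))}\rangle$$ is an isomorphism of $\mathcal E$-modules. -/

import Mathlib

open scoped TensorProduct

noncomputable section

/-! ### Genericity -/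

/-- A family of nonzero complex numbers is generic if no nontrivial Laurent monomial in its members
is equal to `1`. -/
def IsGeneric {ι : Type} [Fintype ι] (v : ι → ℂ) : Prop :=
  (∀ i, v i ≠ 0) ∧ ∀ j : ι → ℤ, ∏ i, v i ^ j i = 1 → j = 0

/-- The third parameter, determined by `q₁ q₂ q₃ = 1`. -/
def qThree (q₁ q₂ : ℂ) : ℂ := (q₁ * q₂)⁻¹

/-! ### The algebra `ℰ` -/

/-- The coefficients of `g(z,w) = (z - q₁ w)(z - q₂ w)(z - q₃ w) = ∑ₖ gCoeff k * z ^ (3 - k) * w ^ k`;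
see `gCoeff_spec`. -/
def gCoeff (q₁ q₂ : ℂ) : Fin 4 → ℂ :=
  ![1, -(q₁ + q₂ + qThree q₁ q₂),
    q₁ * q₂ + q₁ * qThree q₁ q₂ + q₂ * qThree q₁ q₂, -(q₁ * q₂ * qThree q₁ q₂)]

theorem gCoeff_spec (q₁ q₂ z w : ℂ) :
    ∑ k : Fin 4, gCoeff q₁ q₂ k * z ^ (3 - (k : ℕ)) * w ^ (k : ℕ) =
      (z - q₁ * w) * (z - q₂ * w) * (z - qThree q₁ q₂ * w) := by
  simp [Fin.sum_univ_four, gCoeff]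
  ring

/-- The generators: `e i`, `f i` for `i ∈ ℤ`; `psiPlus k` is `ψ⁺_k` and `psiMinus k` is `ψ⁻_{-k}`
for `k ≥ 0`; the last two are `(ψ⁺_0)⁻¹` and `(ψ⁻_0)⁻¹`. -/
inductive EGen : Type
  | e (i : ℤ)
  | f (i : ℤ)
  | psiPlus (k : ℕ)
  | psiMinus (k : ℕ)
  | psiPlusInv
  | psiMinusInv

namespace EGen

/-- The coefficients of `e(z) = ∑ eᵢ z⁻ⁱ` in the free algebra. -/
def eSer (i : ℤ) : FreeAlgebra ℂ EGen := FreeAlgebra.ι ℂ (e i)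

/-- The coefficients of `f(z) = ∑ fᵢ z⁻ⁱ` in the free algebra. -/
def fSer (i : ℤ) : FreeAlgebra ℂ EGen := FreeAlgebra.ι ℂ (f i)

/-- The coefficients of `ψ⁺(z) = ∑_{i ≥ 0} ψ⁺ᵢ z⁻ⁱ` in the free algebra. -/
def psiPlusSer (i : ℤ) : FreeAlgebra ℂ EGen :=
  if 0 ≤ i then FreeAlgebra.ι ℂ (psiPlus i.toNat) else 0

/-- The coefficients of `ψ⁻(z) = ∑_{i ≤ 0} ψ⁻ᵢ z⁻ⁱ` in the free algebra. -/
def psiMinusSer (i : ℤ) : FreeAlgebra ℂ EGen :=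
  if i ≤ 0 then FreeAlgebra.ι ℂ (psiMinus (-i).toNat) else 0

end EGen

/-- For formal series `A(z) = ∑ Aᵢ z⁻ⁱ` and `B(z) = ∑ Bᵢ z⁻ⁱ` with coefficients in an algebra, the
coefficient of `z⁻ⁱ w⁻ʲ` in `g(z,w) A(z) B(w)`. -/
def gMul {R : Type} [Ring R] [Algebra ℂ R] (q₁ q₂ : ℂ) (A B : ℤ → R) (i j : ℤ) : R :=
  ∑ k : Fin 4, gCoeff q₁ q₂ k • (A (i + 3 - (k : ℤ)) * B (j + (k : ℤ)))

/-- For formal series `A(z) = ∑ Aᵢ z⁻ⁱ` and `B(z) = ∑ Bᵢ z⁻ⁱ` with coefficients in an algebra, the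
coefficient of `z⁻ⁱ w⁻ʲ` in `g(w,z) A(z) B(w)`. -/
def gMulSwap {R : Type} [Ring R] [Algebra ℂ R] (q₁ q₂ : ℂ) (A B : ℤ → R) (i j : ℤ) : R :=
  ∑ k : Fin 4, gCoeff q₁ q₂ k • (A (i + (k : ℤ)) * B (j + 3 - (k : ℤ)))

open EGen in
/-- The defining relations of the quantum continuous `𝔤𝔩_∞`, coefficient by coefficient. The
coefficient of `z⁻ⁱ w⁻ʲ` in `g(w,z) B(w) A(z)` is `gMul q₁ q₂ B A j i`, and in `g(z,w) B(w) A(z)` it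
is `gMulSwap q₁ q₂ B A j i`. -/
inductive ERel (q₁ q₂ : ℂ) : FreeAlgebra ℂ EGen → FreeAlgebra ℂ EGen → Prop
  /-- `g(z,w) e(z) e(w) = - g(w,z) e(w) e(z)` -/
  | ee (i j : ℤ) : ERel q₁ q₂ (gMul q₁ q₂ eSer eSer i j) (-gMul q₁ q₂ eSer eSer j i)
  /-- `g(w,z) f(z) f(w) = - g(z,w) f(w) f(z)` -/
  | ff (i j : ℤ) : ERel q₁ q₂ (gMulSwap q₁ q₂ fSer fSer i j) (-gMulSwap q₁ q₂ fSer fSer j i)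
  /-- `g(z,w) ψ⁺(z) e(w) = - g(w,z) e(w) ψ⁺(z)` -/
  | psiPlus_e (i j : ℤ) :
      ERel q₁ q₂ (gMul q₁ q₂ psiPlusSer eSer i j) (-gMul q₁ q₂ eSer psiPlusSer j i)
  /-- `g(z,w) ψ⁻(z) e(w) = - g(w,z) e(w) ψ⁻(z)` -/
  | psiMinus_e (i j : ℤ) :
      ERel q₁ q₂ (gMul q₁ q₂ psiMinusSer eSer i j) (-gMul q₁ q₂ eSer psiMinusSer j i)
  /-- `g(w,z) ψ⁺(z) f(w) = - g(z,w) f(w) ψ⁺(z)` -/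
  | psiPlus_f (i j : ℤ) :
      ERel q₁ q₂ (gMulSwap q₁ q₂ psiPlusSer fSer i j) (-gMulSwap q₁ q₂ fSer psiPlusSer j i)
  /-- `g(w,z) ψ⁻(z) f(w) = - g(z,w) f(w) ψ⁻(z)` -/
  | psiMinus_f (i j : ℤ) :
      ERel q₁ q₂ (gMulSwap q₁ q₂ psiMinusSer fSer i j) (-gMulSwap q₁ q₂ fSer psiMinusSer j i)
  /-- `[e(z), f(w)] = δ(z/w) / g(1,1) * (ψ⁺(z) - ψ⁻(z))` -/
  | ef (i j : ℤ) :
      ERel q₁ q₂ (eSer i * fSer j - fSer j * eSer i)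
        (((1 - q₁) * (1 - q₂) * (1 - qThree q₁ q₂))⁻¹ •
          (psiPlusSer (i + j) - psiMinusSer (i + j)))
  | psiPlus_comm (i j : ℤ) : ERel q₁ q₂ (psiPlusSer i * psiPlusSer j) (psiPlusSer j * psiPlusSer i)
  | psiMinus_comm (i j : ℤ) :
      ERel q₁ q₂ (psiMinusSer i * psiMinusSer j) (psiMinusSer j * psiMinusSer i)
  | psiPlus_psiMinus_comm (i j : ℤ) :
      ERel q₁ q₂ (psiPlusSer i * psiMinusSer j) (psiMinusSer j * psiPlusSer i)
  | psiPlus_mul_inv : ERel q₁ q₂ (psiPlusSer 0 * FreeAlgebra.ι ℂ psiPlusInv) 1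
  | psiPlus_inv_mul : ERel q₁ q₂ (FreeAlgebra.ι ℂ psiPlusInv * psiPlusSer 0) 1
  | psiMinus_mul_inv : ERel q₁ q₂ (psiMinusSer 0 * FreeAlgebra.ι ℂ psiMinusInv) 1
  | psiMinus_inv_mul : ERel q₁ q₂ (FreeAlgebra.ι ℂ psiMinusInv * psiMinusSer 0) 1
  /-- `[e₀, [e₁, e₋₁]] = 0` -/
  | serre_e :
      ERel q₁ q₂
        (eSer 0 * (eSer 1 * eSer (-1) - eSer (-1) * eSer 1) -
          (eSer 1 * eSer (-1) - eSer (-1) * eSer 1) * eSer 0) 0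
  /-- `[f₀, [f₁, f₋₁]] = 0` -/
  | serre_f :
      ERel q₁ q₂
        (fSer 0 * (fSer 1 * fSer (-1) - fSer (-1) * fSer 1) -
          (fSer 1 * fSer (-1) - fSer (-1) * fSer 1) * fSer 0) 0

/-- The quantum continuous `𝔤𝔩_∞` algebra `ℰ`. -/
abbrev EAlg (q₁ q₂ : ℂ) : Type := RingQuot (ERel q₁ q₂)

/-- The class of a generator in `ℰ`. -/
def EAlg.gen (q₁ q₂ : ℂ) (x : EGen) : EAlg q₁ q₂ :=
  RingQuot.mkAlgHom ℂ (ERel q₁ q₂) (FreeAlgebra.ι ℂ x)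

/-! ### Partitions -/

/-- Finite partitions `λ₁ ≥ λ₂ ≥ …` with finitely many nonzero parts. Parts are indexed from `0`, so
`l.part j` is `λ_{j+1}`. -/
def FinPartition : Type := {l : ℕ →₀ ℕ // Antitone l}

namespace FinPartition

/-- The part of index `j` (counted from `0`). -/
def part (l : FinPartition) (j : ℕ) : ℕ := l.1 j

/-- The empty partition. -/
def empty : FinPartition := ⟨0, fun _ _ _ => le_rfl⟩

end FinPartition

/-- `m = l + 𝟏_s^{(i)}`: the tuple of partitions `m` is obtained from `l` by adding `1` to the part of
index `s` (counted from `0`) of the `i`-th partition. -/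
def IsAddBox {n : ℕ} (l m : Fin n → FinPartition) (i : Fin n) (s : ℕ) : Prop :=
  (m i).1 = (l i).1 + Finsupp.single s 1 ∧ ∀ k, k ≠ i → m k = l k

/-! ### Eigenvalues

The formulas for the eigenvalues of `ψ⁺(z)` are written in the variable `x = z⁻¹` and those of
`ψ⁻(z)` in the variable `y = z`, with values in any commutative `ℂ`-algebra `R` with an inversion.
For `R = ℂ` they give the value of the rational function at a point, for `R = ℂ⟦X⟧` (where `x` or `y`
is the variable `X`) they give its expansion as a power series. -/

section Eigenvalues

variable {R : Type} [CommRing R] [Algebra ℂ R] [Inv R]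

/-- Eigenvalue of `ψ⁺(z)` on the vector `|m⟩` of the vector representation `V(v)`:
`(1 - q₁^m q₃ v/z)(1 - q₁^m q₂ v/z) / ((1 - q₁^m v/z)(1 - q₁^(m-1) v/z))`, with `x = 1/z`. -/
def vecPsiPlus (q₁ q₂ v : ℂ) (m : ℤ) (x : R) : R :=
  (1 - (q₁ ^ m * qThree q₁ q₂ * v) • x) * (1 - (q₁ ^ m * q₂ * v) • x) *
    ((1 - (q₁ ^ m * v) • x) * (1 - (q₁ ^ (m - 1) * v) • x))⁻¹

/-- Eigenvalue of `ψ⁻(z)` on the vector `|m⟩` of the vector representation `V(v)`: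
`(1 - q₁^(-m) q₃⁻¹ z/v)(1 - q₁^(-m) q₂⁻¹ z/v) / ((1 - q₁^(-m) z/v)(1 - q₁^(-m+1) z/v))`,
with `y = z`. -/
def vecPsiMinus (q₁ q₂ v : ℂ) (m : ℤ) (y : R) : R :=
  (1 - (q₁ ^ (-m) * (qThree q₁ q₂)⁻¹ * v⁻¹) • y) * (1 - (q₁ ^ (-m) * q₂⁻¹ * v⁻¹) • y) *
    ((1 - (q₁ ^ (-m) * v⁻¹) • y) * (1 - (q₁ ^ (-m + 1) * v⁻¹) • y))⁻¹

/-- `⟨λ|ψ⁺(z)_{j+1}|λ⟩`: the eigenvalue of `ψ⁺(z)` on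
`|λ_{j+1} - j⟩` in `V(u q₂^(-j))`, with `x = 1/z`. -/
def rowPsiPlus (q₁ q₂ u : ℂ) (l : FinPartition) (j : ℕ) (x : R) : R :=
  vecPsiPlus q₁ q₂ (u * q₂ ^ (-(j : ℤ))) ((l.part j : ℤ) - j) x

/-- `⟨λ|ψ⁻(z)_{j+1}|λ⟩`: the eigenvalue of `ψ⁻(z)` on
`|λ_{j+1} - j⟩` in `V(u q₂^(-j))`, with `y = z`. -/
def rowPsiMinus (q₁ q₂ u : ℂ) (l : FinPartition) (j : ℕ) (y : R) : R :=
  vecPsiMinus q₁ q₂ (u * q₂ ^ (-(j : ℤ))) ((l.part j : ℤ) - j) y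

/-- `ψ⁺_∅(u/z) = (1 - q₂ u/z) / (1 - u/z)`, with `x = 1/z`. -/
def vacPsiPlus (q₂ u : ℂ) (x : R) : R :=
  (1 - (q₂ * u) • x) * (1 - u • x)⁻¹

/-- `ψ⁻_∅(u/z) = q₂ (1 - q₂⁻¹ z/u) / (1 - z/u)`, with `y = z`. -/
def vacPsiMinus (q₂ u : ℂ) (y : R) : R :=
  q₂ • ((1 - (q₂⁻¹ * u⁻¹) • y) * (1 - u⁻¹ • y)⁻¹)

/-- Eigenvalue of `ψ⁺(z)` on `|λ⟩` in the Fock module `F(u)`, with `x = 1/z`. All but finitely many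
factors of the product are `1`. -/
def fockPsiPlus (q₁ q₂ u : ℂ) (l : FinPartition) (x : R) : R :=
  vacPsiPlus q₂ u x *
    ∏ᶠ j : ℕ, rowPsiPlus q₁ q₂ u l j x * (rowPsiPlus q₁ q₂ u FinPartition.empty j x)⁻¹

/-- Eigenvalue of `ψ⁻(z)` on `|λ⟩` in the Fock module `F(u)`, with `y = z`. All but finitely many
factors of the product are `1`. -/
def fockPsiMinus (q₁ q₂ u : ℂ) (l : FinPartition) (y : R) : R :=
  vacPsiMinus q₂ u y *
    ∏ᶠ j : ℕ, rowPsiMinus q₁ q₂ u l j y * (rowPsiMinus q₁ q₂ u FinPartition.empty j y)⁻¹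

end Eigenvalues

/-! ### Matrix coefficients of `e(z)` and `f(z)` -/

/-- The support `z = q₁^{λ_{s+1}} q₃^s u` of the delta functions in
`⟨λ + 𝟏_{s+1}|e(z)|λ⟩` and `⟨λ|f(z)|λ + 𝟏_{s+1}⟩`. -/
def boxPoint (q₁ q₂ u : ℂ) (l : FinPartition) (s : ℕ) : ℂ :=
  q₁ ^ l.part s * qThree q₁ q₂ ^ s * u

/-- In the Fock module `F(u)`, `⟨λ + 𝟏_{s+1}|e(z)|λ⟩` equals this constant times `δ(p/z)`, where `p`
is the support `boxPoint q₁ q₂ u l s`. -/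
def fockE (q₁ q₂ u : ℂ) (l : FinPartition) (s : ℕ) : ℂ :=
  (1 - q₁)⁻¹ * ∏ j ∈ Finset.range s, rowPsiPlus q₁ q₂ u l j (boxPoint q₁ q₂ u l s)⁻¹

/-- In the Fock module `F(u)`, `⟨λ|f(z)|λ + 𝟏_{s+1}⟩` equals this constant times `δ(p/z)`, where `p`
is the support `boxPoint q₁ q₂ u l s`. -/
def fockF (q₁ q₂ u : ℂ) (l : FinPartition) (s : ℕ) : ℂ :=
  q₁ * (1 - q₁)⁻¹ * vacPsiPlus q₂ (u * qThree q₁ q₂ ^ (s + 1)) (boxPoint q₁ q₂ u l s)⁻¹ *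
    ∏ᶠ (j : ℕ) (_ : s < j), rowPsiPlus q₁ q₂ u l j (boxPoint q₁ q₂ u l s)⁻¹ *
      (rowPsiPlus q₁ q₂ u FinPartition.empty j (boxPoint q₁ q₂ u l s)⁻¹)⁻¹

/-- The constant in `⟨λ + 𝟏_{s+1}^{(i)}|e(z)|λ⟩` for the tensor product of Fock modules. By the
comultiplication rule `Δe(z) = e(z) ⊗ 1 + ψ⁻(z) ⊗ e(z)`, iterated, it comes from
`ψ⁻(z) ⊗ ⋯ ⊗ ψ⁻(z) ⊗ e(z) ⊗ 1 ⊗ ⋯ ⊗ 1` with `e(z)` in the `i`-th place. -/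
def tensorE {n : ℕ} (q₁ q₂ : ℂ) (u : Fin n → ℂ) (l : Fin n → FinPartition) (i : Fin n) (s : ℕ) : ℂ :=
  (∏ k ∈ Finset.Iio i, fockPsiMinus q₁ q₂ (u k) (l k) (boxPoint q₁ q₂ (u i) (l i) s)) *
    fockE q₁ q₂ (u i) (l i) s

/-- The constant in `⟨λ|f(z)|λ + 𝟏_{s+1}^{(i)}⟩` for the tensor product of Fock modules. By the
comultiplication rule `Δf(z) = f(z) ⊗ ψ⁺(z) + 1 ⊗ f(z)`, iterated, it comes from
`1 ⊗ ⋯ ⊗ 1 ⊗ f(z) ⊗ ψ⁺(z) ⊗ ⋯ ⊗ ψ⁺(z)` with `f(z)` in the `i`-th place. -/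
def tensorF {n : ℕ} (q₁ q₂ : ℂ) (u : Fin n → ℂ) (l : Fin n → FinPartition) (i : Fin n) (s : ℕ) : ℂ :=
  fockF q₁ q₂ (u i) (l i) s *
    ∏ k ∈ Finset.Ioi i, fockPsiPlus q₁ q₂ (u k) (l k) (boxPoint q₁ q₂ (u i) (l i) s)⁻¹

/-! ### Tensor products of Fock modules -/

/-- The underlying vector space of the Fock module `F(u)`, with basis `|λ⟩`. It does not depend on
`u`; the action does. -/
abbrev Fock (_u : ℂ) : Type := FinPartition →₀ ℂ

/-- The vector space `F(u₁) ⊗ ⋯ ⊗ F(uₙ)`. -/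
abbrev FockTensor {n : ℕ} (u : Fin n → ℂ) : Type := ⨂[ℂ] i : Fin n, Fock (u i)

/-- The vector `|λ⁽¹⁾⟩ ⊗ ⋯ ⊗ |λ⁽ⁿ⁾⟩`. -/
def ket {n : ℕ} (u : Fin n → ℂ) (l : Fin n → FinPartition) : FockTensor u :=
  PiTensorProduct.tprod ℂ fun i => (Finsupp.single (l i) 1 : Fock (u i))

/-- The basis of `F(u₁) ⊗ ⋯ ⊗ F(uₙ)` formed by the vectors `|λ⁽¹⁾⟩ ⊗ ⋯ ⊗ |λ⁽ⁿ⁾⟩`. -/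
def ketBasis {n : ℕ} (u : Fin n → ℂ) : Module.Basis (Fin n → FinPartition) ℂ (FockTensor u) :=
  Basis.piTensorProduct fun _ => Finsupp.basisSingleOne

theorem ketBasis_apply {n : ℕ} (u : Fin n → ℂ) (l : Fin n → FinPartition) :
    ketBasis u l = ket u l := by
  simp [ketBasis, ket, Basis.piTensorProduct_apply]

/-- The matrix coefficient `⟨μ|T|λ⟩`. -/
def matCoeff {n : ℕ} (u : Fin n → ℂ) (T : Module.End ℂ (FockTensor u))
    (m l : Fin n → FinPartition) : ℂ :=
  (ketBasis u).repr (T (ket u l)) m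

/-- `ρ` is the action of `ℰ` on `F(u₁) ⊗ ⋯ ⊗ F(uₙ)` given by the comultiplication rule. All matrix
coefficients of the generators are prescribed. The series `δ(p/z) = ∑ pᵃ z⁻ᵃ` has coefficient `pᵃ` at
`z⁻ᵃ`. -/
structure IsFockTensorAction {n : ℕ} (q₁ q₂ : ℂ) (u : Fin n → ℂ)
    (ρ : EAlg q₁ q₂ →ₐ[ℂ] Module.End ℂ (FockTensor u)) : Prop where
  e_box : ∀ (a : ℤ) (l m : Fin n → FinPartition) (i : Fin n) (s : ℕ), IsAddBox l m i s →
    matCoeff u (ρ (EAlg.gen q₁ q₂ (EGen.e a))) m l =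
      tensorE q₁ q₂ u l i s * boxPoint q₁ q₂ (u i) (l i) s ^ a
  e_zero : ∀ (a : ℤ) (l m : Fin n → FinPartition), (∀ i s, ¬ IsAddBox l m i s) →
    matCoeff u (ρ (EAlg.gen q₁ q₂ (EGen.e a))) m l = 0
  f_box : ∀ (a : ℤ) (l m : Fin n → FinPartition) (i : Fin n) (s : ℕ), IsAddBox l m i s →
    matCoeff u (ρ (EAlg.gen q₁ q₂ (EGen.f a))) l m =
      tensorF q₁ q₂ u l i s * boxPoint q₁ q₂ (u i) (l i) s ^ a
  f_zero : ∀ (a : ℤ) (l m : Fin n → FinPartition), (∀ i s, ¬ IsAddBox l m i s) →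
    matCoeff u (ρ (EAlg.gen q₁ q₂ (EGen.f a))) l m = 0
  psiPlus : ∀ (k : ℕ) (l : Fin n → FinPartition),
    ρ (EAlg.gen q₁ q₂ (EGen.psiPlus k)) (ket u l) =
      PowerSeries.coeff k (∏ i, fockPsiPlus q₁ q₂ (u i) (l i) (PowerSeries.X : PowerSeries ℂ)) •
        ket u l
  psiMinus : ∀ (k : ℕ) (l : Fin n → FinPartition),
    ρ (EAlg.gen q₁ q₂ (EGen.psiMinus k)) (ket u l) =
      PowerSeries.coeff k (∏ i, fockPsiMinus q₁ q₂ (u i) (l i) (PowerSeries.X : PowerSeries ℂ)) •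
        ket u l

end

/-! A tuple of partitions is a set of boxes, and the box in row s, column a of the i-th partition
carries the weight q₁ᵃ q₃ˢ uᵢ. Genericity enters only through `GenericWt`: positions in distinct
components, rows or columns, negative indices included, have distinct weights. Telescoping along
rows turns the eigenvalue Ψ of ψ(z) into a vacuum factor times a product over boxes, in which a box
of weight p contributes -g(p,z)/g(z,p) (`psiBox_add`, `gPoly_wt`, `gPoly_wt'`). This is exactly what
the relations of ψ with e and f require.

The amplitudes of e and f are products of the same row factors, over the rows preceding the new box
for e and over those following it for f, in the lexicographic order on pairs (component, row). Hence
adding a box at d affects the e-amplitude only at later positions d', and there by the factor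
-g(p_d,p_d')/g(p_d',p_d); f is the mirror image. This gives the quadratic relations
(`tupleE_exchange`, `tupleF_exchange`). An amplitude vanishes when its step would join a partition
to a non-partition, so the computations can be made for arbitrary sequences of rows and restricted
afterwards. For the cubic relations, the exchange rule expresses the six orders of adding three
boxes through one of them, and a rational identity remains (`serre_aux`).

In [e,f] the off-diagonal terms cancel, and the diagonal is a sum of products EF over removable
boxes minus one over addable boxes. These are, up to the factor g(1,1), the residues of the
eigenvalue on the whole tuple, and the difference of its two expansions is the sum of its residues
(`residue_true`, `residue_false`, `coeff_sub_coeff_eq_sum_residue`).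

Reordering the tensor factors only changes which Ψ's multiply an amplitude, so the constants b have
to satisfy b(λ+1)/b(λ) = E_σ/E. They are products of `pairFactor`⁻¹ over the inversions of σ. Box
factors satisfy φ_p(p')φ_{p'}(p) = 1, so for an inverted pair k < i the factor `pairFactor` is
multiplied by Ψ_k(p) when a box of weight p is added to component i and by Ψ_i(p)⁻¹ when it is added
to component k. The same b serves f. The action transported along the resulting map therefore has
the matrix coefficients prescribed for the reordered parameters. -/

noncomputable section

/-! ### The polynomial g, its inversion symmetry, and the cubic identity. -/

/-- The structure polynomial `g(z, w)`. -/
def gPoly (q₁ q₂ z w : ℂ) : ℂ := (z - q₁ * w) * (z - q₂ * w) * (z - qThree q₁ q₂ * w)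

theorem qThree_inv (q₁ q₂ : ℂ) : qThree q₁⁻¹ q₂⁻¹ = (qThree q₁ q₂)⁻¹ := by
  simp [qThree, mul_comm]

theorem mul_qThree {q₁ q₂ : ℂ} (h₁ : q₁ ≠ 0) (h₂ : q₂ ≠ 0) : q₁ * q₂ * qThree q₁ q₂ = 1 := by
  simp [qThree]; field_simp

theorem gCoeff_inv {q₁ q₂ : ℂ} (h₁ : q₁ ≠ 0) (h₂ : q₂ ≠ 0) (k : Fin 4) :
    gCoeff q₁⁻¹ q₂⁻¹ k = -gCoeff q₁ q₂ (3 - k) := by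
  have h := mul_qThree h₁ h₂
  have h3 : qThree q₁ q₂ ≠ 0 := by intro h0; simp [h0] at h
  fin_cases k
  · simp [gCoeff, h]
  · simp [gCoeff, qThree_inv]
    simp [qThree]; field_simp; ring
  · simp [gCoeff, qThree_inv]
    simp [qThree]; field_simp; ring
  · simp [gCoeff, qThree_inv]
    rw [← mul_inv, ← mul_inv, h]; simp

/-- Because q₁q₂q₃ = 1, inverting the parameters exchanges the arguments of g up to sign. Every
relation for f thereby takes the shape of a relation for e at the inverse parameters, and one
argument covers both. -/
theorem gMulSwap_eq {R : Type} [Ring R] [Algebra ℂ R] {q₁ q₂ : ℂ} (h₁ : q₁ ≠ 0) (h₂ : q₂ ≠ 0)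
    (A B : ℤ → R) (i j : ℤ) : gMulSwap q₁ q₂ A B i j = -gMul q₁⁻¹ q₂⁻¹ A B i j := by
  simp only [gMulSwap, gMul, gCoeff_inv h₁ h₂, Fin.sum_univ_four]
  simp only [show (3 - 0 : Fin 4) = 3 from rfl, show (3 - 1 : Fin 4) = 2 from rfl,
    show (3 - 2 : Fin 4) = 1 from rfl, show (3 - 3 : Fin 4) = 0 from rfl]
  simp
  simp only [show i + 3 - 1 = i + 2 by ring, show j + 3 - 1 = j + 2 by ring,
    show i + 3 - 2 = i + 1 by ring, show j + 3 - 2 = j + 1 by ring]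
  abel

theorem gPoly_inv {q₁ q₂ : ℂ} (h₁ : q₁ ≠ 0) (h₂ : q₂ ≠ 0) (z w : ℂ) :
    gPoly q₁⁻¹ q₂⁻¹ z w = -gPoly q₁ q₂ w z := by
  have h := mul_qThree h₁ h₂
  have h3 : qThree q₁ q₂ ≠ 0 := by intro h0; simp [h0] at h
  simp only [gPoly, qThree_inv]
  have e : ∀ q : ℂ, q ≠ 0 → z - q⁻¹ * w = -q⁻¹ * (w - q * z) := by
    intro q hq; field_simp; ring
  rw [e _ h₁, e _ h₂, e _ h3]
  have : q₁⁻¹ * q₂⁻¹ * (qThree q₁ q₂)⁻¹ = 1 := by rw [← mul_inv, ← mul_inv, h]; simp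
  linear_combination (-(w - q₁ * z) * (w - q₂ * z) * (w - qThree q₁ q₂ * z)) * this

/-- W₁, …, W₆ are the amplitudes of adding three boxes of weights x, y, z in the orders xyz, yxz,
xzy, yzx, zxy, zyx. The polynomial coefficients are those of the iterated commutator, multiplied by
xyz. Five adjacent exchanges reach every order from the first, which leaves an identity of rational
functions in x, y, z. -/
theorem serre_aux (e₁ e₂ x y z : ℂ) (g : ℂ → ℂ → ℂ)
    (hg : ∀ a b, g a b = a ^ 3 - e₁ * (a ^ 2 * b) + e₂ * (a * b ^ 2) - b ^ 3)
    {W₁ W₂ W₃ W₄ W₅ W₆ : ℂ}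
    (h12 : g y x * W₁ = -(g x y * W₂)) (h13 : g z y * W₁ = -(g y z * W₃))
    (h24 : g z x * W₂ = -(g x z * W₄)) (h35 : g z x * W₃ = -(g x z * W₅))
    (h46 : g z y * W₄ = -(g y z * W₆))
    (hxy : g x y ≠ 0) (hxz : g x z ≠ 0) (hyz : g y z ≠ 0) :
    (y ^ 2 * z - x ^ 2 * z - x * z ^ 2 + x * y ^ 2) * W₁ +
    (x ^ 2 * z - y ^ 2 * z - y * z ^ 2 + y * x ^ 2) * W₂ +
    (z ^ 2 * y - x ^ 2 * y - x * y ^ 2 + x * z ^ 2) * W₃ +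
    (z ^ 2 * x - y ^ 2 * x - y * x ^ 2 + y * z ^ 2) * W₄ +
    (x ^ 2 * y - z ^ 2 * y - z * y ^ 2 + z * x ^ 2) * W₅ +
    (y ^ 2 * x - z ^ 2 * x - z * x ^ 2 + z * y ^ 2) * W₆ = 0 := by
  have e2 : W₂ = -(g y x * W₁) / g x y := by field_simp; linear_combination h12
  have e3 : W₃ = -(g z y * W₁) / g y z := by field_simp; linear_combination h13
  have e4 : W₄ = -(g z x * W₂) / g x z := by field_simp; linear_combination h24
  have e5 : W₅ = -(g z x * W₃) / g x z := by field_simp; linear_combination h35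
  have e6 : W₆ = -(g z y * W₄) / g y z := by field_simp; linear_combination h46
  rw [e6, e5, e4, e3, e2]
  field_simp
  simp only [hg]
  ring

/-- Symmetrising over the six permutations multiplies the sum over a cube by 6. -/
theorem sum_triple_eq_zero {B V : Type} [AddCommGroup V] [Module ℂ V] (U : Finset B)
    (f : B → B → B → V)
    (hf : ∀ x y z, f x y z + f y x z + f x z y + f y z x + f z x y + f z y x = 0) :
    ∑ x ∈ U, ∑ y ∈ U, ∑ z ∈ U, f x y z = 0 := by
  have h := Finset.sum_congr (rfl : U = U) fun x _ => Finset.sum_congr (rfl : U = U) fun y _ =>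
    Finset.sum_congr (rfl : U = U) fun z _ => hf x y z
  simp only [Finset.sum_add_distrib, Finset.sum_const_zero] at h
  have e2 : ∑ x ∈ U, ∑ y ∈ U, ∑ z ∈ U, f y x z = ∑ x ∈ U, ∑ y ∈ U, ∑ z ∈ U, f x y z :=
    Finset.sum_comm
  have sw (g : B → B → B → V) :
      ∑ x ∈ U, ∑ y ∈ U, ∑ z ∈ U, g x z y = ∑ x ∈ U, ∑ y ∈ U, ∑ z ∈ U, g x y z :=
    Finset.sum_congr rfl fun x _ => Finset.sum_comm
  have e4 : ∑ x ∈ U, ∑ y ∈ U, ∑ z ∈ U, f y z x = ∑ x ∈ U, ∑ y ∈ U, ∑ z ∈ U, f x y z :=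
    Finset.sum_comm.trans (sw f)
  rw [e2, sw f, e4, sw fun x y z => f y x z, e2, sw fun x y z => f y z x, e4] at h
  have h6 : (6 : ℂ) • ∑ x ∈ U, ∑ y ∈ U, ∑ z ∈ U, f x y z = 0 := by
    rw [← h]; module
  simpa using h6

/-! ### Abstract families of operators that add or remove boxes. -/

section BoxOperators

variable {St B V : Type} [AddCommGroup V] [Module ℂ V]

/-- The family `T` acts on the vectors `k S` by taking steps `S ↦ step S b` with coefficients
`C S b * p b ^ a`. -/
structure IsBoxFamily (k : St → V) (step : St → B → St) (C : St → B → ℂ) (p : B → ℂ)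
    (T : ℤ → Module.End ℂ V) : Prop where
  apply : ∀ (a : ℤ) (S : St) (U : Finset B), (∀ b ∉ U, C S b = 0) →
    T a (k S) = ∑ b ∈ U, (C S b * p b ^ a) • k (step S b)
  finite : ∀ S, ∃ U : Finset B, ∀ b ∉ U, C S b = 0
  comm : ∀ S x y, step (step S x) y = step (step S y) x
  ne_zero : ∀ b, p b ≠ 0

namespace IsBoxFamily

variable {k : St → V} {step : St → B → St} {C : St → B → ℂ} {p : B → ℂ}
  {T : ℤ → Module.End ℂ V}

/-- A single finite set covers the first and the second step, so that a product of two operators is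
a sum over U × U, whose two summations may be interchanged. -/
theorem exists_cover_two (h : IsBoxFamily k step C p T) (S : St) :
    ∃ U : Finset B, (∀ b ∉ U, C S b = 0) ∧ ∀ x, C S x ≠ 0 → ∀ b ∉ U, C (step S x) b = 0 := by
  classical
  choose U hU using h.finite
  refine ⟨U S ∪ (U S).biUnion fun x => U (step S x), fun b hb => hU _ _ ?_,
    fun x hx b hb => hU _ _ ?_⟩
  · simp at hb; exact hb.1
  · simp at hb
    exact hb.2 x (by_contra fun hx' => hx (hU _ _ hx'))

theorem exists_cover_three (h : IsBoxFamily k step C p T) (S : St) :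
    ∃ U : Finset B, (∀ b ∉ U, C S b = 0) ∧ (∀ x, C S x ≠ 0 → ∀ b ∉ U, C (step S x) b = 0) ∧
      ∀ x y, C S x ≠ 0 → C (step S x) y ≠ 0 → ∀ b ∉ U, C (step (step S x) y) b = 0 := by
  classical
  choose U hU hU' using h.exists_cover_two
  refine ⟨U S ∪ (U S).biUnion fun x => U (step S x), fun b hb => hU _ _ ?_,
    fun x hx b hb => hU' _ x hx _ ?_, fun x y hx hy b hb => ?_⟩
  · simp at hb; exact hb.1
  · simp at hb; exact hb.1
  · simp at hb
    exact hU' _ y hy _ (hb.2 x (by_contra fun hx' => hx (hU _ _ hx')))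

theorem mul_apply (h : IsBoxFamily k step C p T) (a b : ℤ) (S : St) (U : Finset B)
    (hU : ∀ b ∉ U, C S b = 0) (hU' : ∀ x, C S x ≠ 0 → ∀ b ∉ U, C (step S x) b = 0) :
    (T a * T b) (k S) = ∑ x ∈ U, ∑ y ∈ U,
      (C S x * C (step S x) y * (p x ^ b * p y ^ a)) • k (step (step S x) y) := by
  rw [Module.End.mul_apply, h.apply b S U hU, map_sum]
  refine Finset.sum_congr rfl fun x _ => ?_
  rw [map_smul]
  by_cases hx : C S x = 0
  · simp [hx]
  · rw [h.apply a _ U (hU' x hx), Finset.smul_sum]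
    refine Finset.sum_congr rfl fun y _ => ?_
    rw [smul_smul]; congr 1; ring

theorem mul_mul_apply (h : IsBoxFamily k step C p T) (a b c : ℤ) (S : St) (U : Finset B)
    (hU : ∀ b ∉ U, C S b = 0) (hU' : ∀ x, C S x ≠ 0 → ∀ b ∉ U, C (step S x) b = 0)
    (hU'' : ∀ x y, C S x ≠ 0 → C (step S x) y ≠ 0 →
      ∀ b ∉ U, C (step (step S x) y) b = 0) :
    (T a * T b * T c) (k S) = ∑ x ∈ U, ∑ y ∈ U, ∑ z ∈ U,
      (C S x * C (step S x) y * C (step (step S x) y) z * (p x ^ c * p y ^ b * p z ^ a)) •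
        k (step (step (step S x) y) z) := by
  rw [mul_assoc, Module.End.mul_apply, h.mul_apply b c S U hU hU', map_sum]
  refine Finset.sum_congr rfl fun x _ => ?_
  rw [map_sum]
  refine Finset.sum_congr rfl fun y _ => ?_
  rw [map_smul]
  by_cases hx : C S x = 0
  · simp [hx]
  by_cases hy : C (step S x) y = 0
  · simp [hy]
  rw [h.apply a _ U (hU'' x y hx hy), Finset.smul_sum]
  refine Finset.sum_congr rfl fun z _ => ?_
  rw [smul_smul]; congr 1; ring

/-- The delta functions put z at the weight of the box added second and w at that of the box added
first, so multiplication by g(z,w) becomes multiplication by the number g(p y, p x). -/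
theorem gMul_apply (h : IsBoxFamily k step C p T) (q₁ q₂ : ℂ) (i j : ℤ) (S : St) (U : Finset B)
    (hU : ∀ b ∉ U, C S b = 0) (hU' : ∀ x, C S x ≠ 0 → ∀ b ∉ U, C (step S x) b = 0) :
    gMul q₁ q₂ T T i j (k S) = ∑ x ∈ U, ∑ y ∈ U,
      (gPoly q₁ q₂ (p y) (p x) * (C S x * C (step S x) y) * (p x ^ j * p y ^ i)) •
        k (step (step S x) y) := by
  simp only [gMul, LinearMap.sum_apply, LinearMap.smul_apply, h.mul_apply _ _ S U hU hU',
    Finset.smul_sum]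
  rw [Finset.sum_comm]
  refine Finset.sum_congr rfl fun x _ => ?_
  rw [Finset.sum_comm]
  refine Finset.sum_congr rfl fun y _ => ?_
  simp only [smul_smul]
  rw [← Finset.sum_smul]
  congr 1
  rw [gPoly, ← gCoeff_spec, Finset.sum_mul, Finset.sum_mul]
  refine Finset.sum_congr rfl fun t _ => ?_
  have e1 : p x ^ (j + (t : ℤ)) = p x ^ j * p x ^ (t : ℕ) := by
    rw [zpow_add₀ (h.ne_zero x)]; simp
  have e2 : p y ^ (i + 3 - (t : ℤ)) = p y ^ i * p y ^ (3 - (t : ℕ)) := by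
    rw [add_sub_assoc, zpow_add₀ (h.ne_zero y), ← zpow_natCast (p y) (3 - (t : ℕ))]
    congr 2
    have := t.2
    push_cast [show (t : ℕ) ≤ 3 by omega]
    ring
  rw [e1, e2]; ring

/-- The quadratic relation. -/
theorem gMul_eq (h : IsBoxFamily k step C p T) (q₁ q₂ : ℂ)
    (hq : ∀ S x y, gPoly q₁ q₂ (p y) (p x) * (C S x * C (step S x) y) =
      -(gPoly q₁ q₂ (p x) (p y) * (C S y * C (step S y) x))) (i j : ℤ) (S : St) :
    gMul q₁ q₂ T T i j (k S) = -gMul q₁ q₂ T T j i (k S) := by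
  obtain ⟨U, hU, hU'⟩ := h.exists_cover_two S
  rw [h.gMul_apply q₁ q₂ i j S U hU hU', h.gMul_apply q₁ q₂ j i S U hU hU', Finset.sum_comm,
    ← Finset.sum_neg_distrib]
  refine Finset.sum_congr rfl fun x _ => ?_
  rw [← Finset.sum_neg_distrib]
  refine Finset.sum_congr rfl fun y _ => ?_
  rw [hq S y x, h.comm S y x, ← neg_smul]
  congr 1; ring

/-- The cubic relation. -/
theorem serre (h : IsBoxFamily k step C p T) (q₁ q₂ : ℂ) (hq₁ : q₁ ≠ 0) (hq₂ : q₂ ≠ 0)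
    (hq : ∀ S x y, gPoly q₁ q₂ (p y) (p x) * (C S x * C (step S x) y) =
      -(gPoly q₁ q₂ (p x) (p y) * (C S y * C (step S y) x)))
    (hC : ∀ S x y z, C S x ≠ 0 → C (step S x) y ≠ 0 → C (step (step S x) y) z ≠ 0 →
      gPoly q₁ q₂ (p x) (p y) ≠ 0 ∧ gPoly q₁ q₂ (p x) (p z) ≠ 0 ∧ gPoly q₁ q₂ (p y) (p z) ≠ 0)
    (S : St) :
    (T 0 * (T 1 * T (-1) - T (-1) * T 1) - (T 1 * T (-1) - T (-1) * T 1) * T 0) (k S) = 0 := by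
  obtain ⟨U, hU, hU', hU''⟩ := h.exists_cover_three S
  set W : B → B → B → ℂ := fun x y z => C S x * C (step S x) y * C (step (step S x) y) z with hW
  -- The four monomials of the expanded commutator [T₀,[T₁,T₋₁]], for boxes added in the order x, y,
  -- z, over the common denominator p x * p y * p z.
  set K : B → B → B → ℂ := fun x y z => (p x * p y * p z)⁻¹ *
    (p y ^ 2 * p z - p x ^ 2 * p z - p x * p z ^ 2 + p x * p y ^ 2) with hK
  have hexp : (T 0 * (T 1 * T (-1) - T (-1) * T 1) - (T 1 * T (-1) - T (-1) * T 1) * T 0) (k S) =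
      ∑ x ∈ U, ∑ y ∈ U, ∑ z ∈ U, (W x y z * K x y z) • k (step (step (step S x) y) z) := by
    have e : T 0 * (T 1 * T (-1) - T (-1) * T 1) - (T 1 * T (-1) - T (-1) * T 1) * T 0 =
        T 0 * T 1 * T (-1) - T 0 * T (-1) * T 1 - T 1 * T (-1) * T 0 + T (-1) * T 1 * T 0 := by
      noncomm_ring
    rw [e, LinearMap.add_apply, LinearMap.sub_apply, LinearMap.sub_apply]
    simp only [h.mul_mul_apply _ _ _ S U hU hU' hU'', ← Finset.sum_sub_distrib,
      ← Finset.sum_add_distrib, ← sub_smul, ← add_smul]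
    refine Finset.sum_congr rfl fun x _ => Finset.sum_congr rfl fun y _ =>
      Finset.sum_congr rfl fun z _ => ?_
    congr 1
    have hx := h.ne_zero x
    have hy := h.ne_zero y
    have hz := h.ne_zero z
    simp only [hW, hK, zpow_neg, zpow_one, zpow_zero]
    field_simp
  rw [hexp]
  refine sum_triple_eq_zero U _ ?_
  have main : ∀ x y z, W x y z ≠ 0 →
      W x y z * K x y z + W y x z * K y x z + W x z y * K x z y + W y z x * K y z x +
        W z x y * K z x y + W z y x * K z y x = 0 := by
    intro x y z hne
    have hx : C S x ≠ 0 := by intro h0; simp [hW, h0] at hne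
    have hy : C (step S x) y ≠ 0 := by intro h0; simp [hW, h0] at hne
    have hz : C (step (step S x) y) z ≠ 0 := by intro h0; simp [hW, h0] at hne
    obtain ⟨g1, g2, g3⟩ := hC S x y z hx hy hz
    have key := serre_aux (q₁ + q₂ + qThree q₁ q₂)
      (q₁ * q₂ + q₁ * qThree q₁ q₂ + q₂ * qThree q₁ q₂) (p x) (p y) (p z) (gPoly q₁ q₂)
      (fun a b => by
        have h3 := mul_qThree hq₁ hq₂
        simp only [gPoly]; linear_combination (-b ^ 3) * h3)
      (W₁ := W x y z) (W₂ := W y x z) (W₃ := W x z y) (W₄ := W y z x) (W₅ := W z x y)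
      (W₆ := W z y x)
      (by simp only [hW]; rw [h.comm S y x]; linear_combination C (step (step S x) y) z * hq S x y)
      (by simp only [hW]; linear_combination C S x * hq (step S x) y z)
      (by simp only [hW]; linear_combination C S y * hq (step S y) x z)
      (by simp only [hW]; rw [h.comm S z x]; linear_combination C (step (step S x) z) y * hq S x z)
      (by simp only [hW]; rw [h.comm S z y]; linear_combination C (step (step S y) z) x * hq S y z)
      g1 g2 g3
    simp only [hK]
    linear_combination (p x * p y * p z)⁻¹ * key
  intro x y z
  have c1 : step (step (step S y) x) z = step (step (step S x) y) z := by rw [h.comm S y x]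
  have c2 : step (step (step S x) z) y = step (step (step S x) y) z := h.comm _ _ _
  have c3 : step (step (step S y) z) x = step (step (step S x) y) z := by
    rw [h.comm (step S y), c1]
  have c4 : step (step (step S z) x) y = step (step (step S x) y) z := by rw [h.comm S z x, c2]
  have c5 : step (step (step S z) y) x = step (step (step S x) y) z := by rw [h.comm S z y, c3]
  simp only [c1, c2, c3, c4, c5, ← add_smul]
  convert zero_smul ℂ _
  -- The six-term identity is symmetric in x, y, z, while the nonvanishing of g is known only along
  -- an order of nonzero amplitude. It is therefore started from any such order; if there is none,
  -- all terms vanish.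
  by_cases h1 : W x y z = 0
  · by_cases h2 : W y x z = 0
    · by_cases h3 : W x z y = 0
      · by_cases h4 : W y z x = 0
        · by_cases h5 : W z x y = 0
          · by_cases h6 : W z y x = 0
            · simp [h1, h2, h3, h4, h5, h6]
            · linear_combination main z y x h6
          · linear_combination main z x y h5
        · linear_combination main y z x h4
      · linear_combination main x z y h3
    · linear_combination main y x z h2
  · exact main x y z h1

end IsBoxFamily

/-- Commutation of a family of operators diagonal in the vectors `k S` with a box family. -/
theorem IsBoxFamily.diagonal_eq {k : St → V} {step : St → B → St} {C : St → B → ℂ} {p : B → ℂ}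
    {T : ℤ → Module.End ℂ V} (h : IsBoxFamily k step C p T) (q₁ q₂ : ℂ)
    (D : ℤ → Module.End ℂ V) (d : St → ℤ → ℂ) (hD : ∀ a S, D a (k S) = d S a • k S)
    (hd : ∀ S x i, C S x ≠ 0 →
      ∑ t : Fin 4, gCoeff q₁ q₂ t * p x ^ (t : ℕ) * d (step S x) (i + 3 - (t : ℤ)) =
        -∑ t : Fin 4, gCoeff q₁ q₂ t * p x ^ (3 - (t : ℕ)) * d S (i + (t : ℤ)))
    (i j : ℤ) (S : St) :
    gMul q₁ q₂ D T i j (k S) = -gMul q₁ q₂ T D j i (k S) := by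
  obtain ⟨U, hU⟩ := h.finite S
  simp only [gMul, LinearMap.sum_apply, LinearMap.smul_apply, Module.End.mul_apply, hD,
    h.apply _ S U hU, map_smul, map_sum, Finset.smul_sum, smul_smul]
  rw [Finset.sum_comm]
  conv_rhs => rw [Finset.sum_comm, ← Finset.sum_neg_distrib]
  refine Finset.sum_congr rfl fun x _ => ?_
  rw [← Finset.sum_smul, ← Finset.sum_smul, ← neg_smul]
  congr 1
  by_cases hx : C S x = 0
  · simp [hx]
  have e := hd S x i hx
  have hp := h.ne_zero x
  calc _ = C S x * p x ^ j *
        ∑ t : Fin 4, gCoeff q₁ q₂ t * p x ^ (t : ℕ) * d (step S x) (i + 3 - (t : ℤ)) := by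
        rw [Finset.mul_sum]
        refine Finset.sum_congr rfl fun t _ => ?_
        rw [zpow_add₀ hp, zpow_natCast]; ring
    _ = _ := by
        rw [e, mul_neg, Finset.mul_sum]
        congr 1
        refine Finset.sum_congr rfl fun t _ => ?_
        rw [add_sub_assoc, zpow_add₀ hp, ← zpow_natCast (p x) (3 - (t : ℕ))]
        have := t.2
        push_cast [show (t : ℕ) ≤ 3 by omega]
        ring

end BoxOperators

/-- The commutator of a raising and a lowering family is diagonal. -/
theorem IsBoxFamily.commutator_apply {St B V : Type} [AddCommGroup V] [Module ℂ V]
    {k : St → V} {p : B → ℂ} {step step' : St → B → St} {C C' : St → B → ℂ}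
    {T T' : ℤ → Module.End ℂ V} (h : IsBoxFamily k step C p T) (h' : IsBoxFamily k step' C' p T')
    (hoff : ∀ S b b', b ≠ b' → C' S b' * C (step' S b') b = C S b * C' (step S b) b')
    (hcomm : ∀ S b b', b ≠ b' → C S b * C' (step S b) b' ≠ 0 →
      step (step' S b') b = step' (step S b) b')
    (hdiag : ∀ S b, C S b ≠ 0 → step' (step S b) b = S)
    (hdiag' : ∀ S b, C' S b ≠ 0 → step (step' S b) b = S)
    (i j : ℤ) (S : St) (U : Finset B) (hU : ∀ b ∉ U, C S b = 0) (hU' : ∀ b ∉ U, C' S b = 0) :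
    (T i * T' j - T' j * T i) (k S) =
      (∑ b ∈ U, (C' S b * C (step' S b) b - C S b * C' (step S b) b) * p b ^ (i + j)) • k S := by
  classical
  choose F hF using h.finite
  choose F' hF' using h'.finite
  -- U covers the first steps from S; the enlargement also covers every second step. Outside U only
  -- off-diagonal terms occur, and these cancel, so the final sum returns to U.
  set U2 := U ∪ (U.biUnion fun x => F (step' S x)) ∪ U.biUnion fun x => F' (step S x) with hU2
  have sub : U ⊆ U2 := by rw [hU2]; intro x hx; simp [hx]
  have c1 : ∀ b ∉ U2, C S b = 0 := fun b hb => hU b fun h => hb (sub h)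
  have c2 : ∀ b ∉ U2, C' S b = 0 := fun b hb => hU' b fun h => hb (sub h)
  have c3 : ∀ x, C' S x ≠ 0 → ∀ b ∉ U2, C (step' S x) b = 0 := by
    intro x hx b hb
    refine hF _ _ fun hb' => hb ?_
    have : x ∈ U := by_contra fun hn => hx (hU' _ hn)
    simp only [hU2, Finset.mem_union, Finset.mem_biUnion]
    exact Or.inl (Or.inr ⟨x, this, hb'⟩)
  have c4 : ∀ x, C S x ≠ 0 → ∀ b ∉ U2, C' (step S x) b = 0 := by
    intro x hx b hb
    refine hF' _ _ fun hb' => hb ?_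
    have : x ∈ U := by_contra fun hn => hx (hU _ hn)
    simp only [hU2, Finset.mem_union, Finset.mem_biUnion]
    exact Or.inr ⟨x, this, hb'⟩
  have e1 : T i (T' j (k S)) = ∑ b ∈ U2, ∑ b' ∈ U2,
      (C' S b' * C (step' S b') b * (p b' ^ j * p b ^ i)) • k (step (step' S b') b) := by
    rw [h'.apply j S U2 c2, map_sum, Finset.sum_comm]
    refine Finset.sum_congr rfl fun x _ => ?_
    rw [map_smul]
    by_cases hx : C' S x = 0
    · simp [hx]
    rw [h.apply i _ U2 (c3 x hx), Finset.smul_sum]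
    refine Finset.sum_congr rfl fun y _ => ?_
    rw [smul_smul]; congr 1; ring
  have e2 : T' j (T i (k S)) = ∑ b ∈ U2, ∑ b' ∈ U2,
      (C S b * C' (step S b) b' * (p b' ^ j * p b ^ i)) • k (step' (step S b) b') := by
    rw [h.apply i S U2 c1, map_sum]
    refine Finset.sum_congr rfl fun x _ => ?_
    rw [map_smul]
    by_cases hx : C S x = 0
    · simp [hx]
    rw [h'.apply j _ U2 (c4 x hx), Finset.smul_sum]
    refine Finset.sum_congr rfl fun y _ => ?_
    rw [smul_smul]; congr 1; ring
  rw [LinearMap.sub_apply, Module.End.mul_apply, Module.End.mul_apply, e1, e2,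
    ← Finset.sum_sub_distrib, Finset.sum_smul, ← Finset.sum_subset sub]
  · refine Finset.sum_congr rfl fun b hb => ?_
    rw [← Finset.sum_sub_distrib, Finset.sum_eq_single_of_mem b (sub hb)]
    · have e3 : (C' S b * C (step' S b) b * (p b ^ j * p b ^ i)) • k (step (step' S b) b) =
          (C' S b * C (step' S b) b * (p b ^ j * p b ^ i)) • k S := by
        by_cases hx : C' S b = 0
        · simp [hx]
        · rw [hdiag' S b hx]
      have e4 : (C S b * C' (step S b) b * (p b ^ j * p b ^ i)) • k (step' (step S b) b) =
          (C S b * C' (step S b) b * (p b ^ j * p b ^ i)) • k S := by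
        by_cases hx : C S b = 0
        · simp [hx]
        · rw [hdiag S b hx]
      rw [e3, e4, ← sub_smul, zpow_add₀ (h.ne_zero b)]
      congr 1; ring
    · intro b' _ hb'
      rw [hoff S b b' (Ne.symm hb')]
      by_cases hx : C S b * C' (step S b) b' = 0
      · simp [hx]
      · rw [hcomm S b b' (Ne.symm hb') hx, sub_self]
  · intro b _ hb
    rw [← Finset.sum_sub_distrib]
    refine Finset.sum_eq_zero fun b' _ => ?_
    by_cases hbb : b = b'
    · subst hbb; simp [hU b hb, hU' b hb]
    · rw [hoff S b b' hbb]; simp [hU b hb]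

/-! ### Partial fractions -/

-- Both sides have degree at most |I| and agree at the |I| + 1 points 0 and c i. With x = 1/X this
-- is the decomposition f(x) = ∏ aⱼ/cⱼ + ∑ rᵢ/(1 - cᵢ x) with denominators cleared, in the form
-- suited to the expansion at x = ∞. The a's need not be distinct or differ from the c's.
open Polynomial in
theorem sum_residue_aux {I : Type} [Fintype I] [DecidableEq I] (a c : I → ℂ) (ha : ∀ i, a i ≠ 0)
    (hc : ∀ i, c i ≠ 0) (hinj : Function.Injective c) (r : I → ℂ)
    (hr : ∀ i, r i = ∏ j, (1 - a j * (c i)⁻¹) / (if j = i then 1 else 1 - c j * (c i)⁻¹)) :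
    (C (∏ j, a j / c j) * ∏ j, (1 - C (a j)⁻¹ * X) : ℂ[X]) =
      C (∏ j, a j / c j) * ∏ j, (1 - C (c j)⁻¹ * X) -
        ∑ i, C (r i * (c i)⁻¹) * X * ∏ j ∈ Finset.univ.erase i, (1 - C (c j)⁻¹ * X) := by
  set S : Finset ℂ := insert 0 (Finset.univ.image c) with hS
  have hcard : S.card = Fintype.card I + 1 := by
    rw [hS, Finset.card_insert_of_notMem (by simpa using hc), Finset.card_image_of_injective _ hinj,
      Finset.card_univ]
  have dlin : ∀ b : ℂ, (1 - C b * X : ℂ[X]).natDegree ≤ 1 := fun b => by compute_degree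
  have dprod : ∀ (t : Finset I) (b : I → ℂ), (∏ j ∈ t, (1 - C (b j) * X) : ℂ[X]).natDegree ≤ t.card :=
    fun t b => (natDegree_prod_le _ _).trans ((Finset.sum_le_sum fun j _ => dlin (b j)).trans (by simp))
  have degC : ∀ (b : ℂ) (P : ℂ[X]), P.natDegree ≤ Fintype.card I →
      (C b * P).natDegree ≤ Fintype.card I := fun b P h => (natDegree_C_mul_le _ _).trans h
  have lt_of : ∀ P : ℂ[X], P.natDegree ≤ Fintype.card I → P.degree < S.card := by
    intro P h
    rw [hcard]
    exact (degree_le_natDegree).trans_lt (by exact_mod_cast Nat.lt_succ_of_le h)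
  refine eq_of_degrees_lt_of_eval_finset_eq S (lt_of _ (degC _ _ (dprod _ _))) (lt_of _ ?_) ?_
  · refine (natDegree_sub_le _ _).trans (max_le (degC _ _ (dprod _ _)) ?_)
    refine natDegree_sum_le_of_forall_le _ _ fun i _ => ?_
    rw [mul_assoc]
    refine degC _ _ ?_
    refine natDegree_mul_le.trans ?_
    have := dprod (Finset.univ.erase i) fun j => (c j)⁻¹
    rw [Finset.card_erase_of_mem (Finset.mem_univ i), Finset.card_univ] at this
    have h1 : 0 < Fintype.card I := Fintype.card_pos_iff.mpr ⟨i⟩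
    rw [natDegree_X]; omega
  · intro y hy
    simp only [hS, Finset.mem_insert, Finset.mem_image, Finset.mem_univ, true_and] at hy
    simp only [eval_mul, eval_C, eval_prod, eval_sub, eval_one, eval_X, eval_finsetSum]
    rcases hy with rfl | ⟨i, rfl⟩
    · simp
    · have z : ∏ j, (1 - (c j)⁻¹ * c i) = 0 :=
        Finset.prod_eq_zero (Finset.mem_univ i) (by rw [inv_mul_cancel₀ (hc i), sub_self])
      rw [z, mul_zero, zero_sub, Finset.sum_eq_single_of_mem i (Finset.mem_univ i)]
      · rw [mul_assoc (r i), inv_mul_cancel₀ (hc i), mul_one, hr i,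
          ← Finset.mul_prod_erase Finset.univ (fun j => a j / c j) (Finset.mem_univ i),
          ← Finset.mul_prod_erase Finset.univ (fun j => 1 - (a j)⁻¹ * c i) (Finset.mem_univ i),
          ← Finset.mul_prod_erase Finset.univ
            (fun j => (1 - a j * (c i)⁻¹) / (if j = i then 1 else 1 - c j * (c i)⁻¹))
            (Finset.mem_univ i), if_pos rfl]
        rw [mul_mul_mul_comm, ← Finset.prod_mul_distrib, ← neg_mul, ← neg_mul, mul_assoc (-_),
          ← Finset.prod_mul_distrib]
        have hai := ha i
        have hci := hc i
        congr 1
        · field_simp; ring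
        · refine Finset.prod_congr rfl fun j hj => ?_
          rw [if_neg (Finset.ne_of_mem_erase hj)]
          have hne : c i - c j ≠ 0 := sub_ne_zero.mpr fun h =>
            (Finset.ne_of_mem_erase hj) (hinj h).symm
          have hne' : c j - c i ≠ 0 := sub_ne_zero.mpr fun h =>
            (Finset.ne_of_mem_erase hj) (hinj h)
          have haj := ha j
          have hcj := hc j
          have hne2 : 1 - c j * (c i)⁻¹ ≠ 0 := by
            rw [show 1 - c j * (c i)⁻¹ = (c i - c j) * (c i)⁻¹ by field_simp]
            exact mul_ne_zero hne (inv_ne_zero hci)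
          field_simp
          ring
      · intro j _ hj
        rw [Finset.prod_eq_zero (Finset.mem_erase.mpr ⟨hj.symm, Finset.mem_univ i⟩), mul_zero]
        rw [inv_mul_cancel₀ (hc i), sub_self]

-- The same decomposition in the form suited to x = 0: evaluate the previous identity at y⁻¹ for
-- every y ≠ 0 and clear the powers of y.
open Polynomial in
theorem sum_residue_aux' {I : Type} [Fintype I] [DecidableEq I] (a c : I → ℂ) (ha : ∀ i, a i ≠ 0)
    (hc : ∀ i, c i ≠ 0) (hinj : Function.Injective c) (r : I → ℂ)
    (hr : ∀ i, r i = ∏ j, (1 - a j * (c i)⁻¹) / (if j = i then 1 else 1 - c j * (c i)⁻¹)) :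
    (∏ j, (1 - C (a j) * X) : ℂ[X]) =
      C (∏ j, a j / c j) * ∏ j, (1 - C (c j) * X) +
        ∑ i, C (r i) * ∏ j ∈ Finset.univ.erase i, (1 - C (c j) * X) := by
  refine eq_of_infinite_eval_eq _ _ ((Set.finite_singleton (0 : ℂ)).infinite_compl.mono ?_)
  intro y hy
  have hy : y ≠ 0 := hy
  have key := congrArg (eval y⁻¹) (sum_residue_aux a c ha hc hinj r hr)
  simp only [Set.mem_ofPred_eq, eval_mul, eval_C, eval_prod, eval_sub, eval_one, eval_X,
    eval_finsetSum, eval_add] at key ⊢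
  have flip : ∀ (t : Finset I) (b : I → ℂ), (∀ i, b i ≠ 0) →
      ∏ j ∈ t, (1 - b j * y) = (∏ j ∈ t, -(b j * y)) * ∏ j ∈ t, (1 - (b j)⁻¹ * y⁻¹) := by
    intro t b hb
    rw [← Finset.prod_mul_distrib]
    refine Finset.prod_congr rfl fun j _ => ?_
    have := hb j
    field_simp; ring
  have hA : ∏ j, -(a j * y) = (∏ j, a j / c j) * ∏ j, -(c j * y) := by
    rw [← Finset.prod_mul_distrib]
    refine Finset.prod_congr rfl fun j _ => ?_
    have := hc j
    field_simp
  rw [flip _ a ha, flip _ c hc, hA]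
  have e : ∑ i, r i * ∏ j ∈ Finset.univ.erase i, (1 - c j * y) = -(∏ j, -(c j * y)) *
      ∑ i, r i * (c i)⁻¹ * y⁻¹ * ∏ j ∈ Finset.univ.erase i, (1 - (c j)⁻¹ * y⁻¹) := by
    rw [Finset.mul_sum]
    refine Finset.sum_congr rfl fun i _ => ?_
    rw [flip _ c hc, ← Finset.mul_prod_erase Finset.univ _ (Finset.mem_univ i)]
    have := hc i
    generalize ∏ j ∈ Finset.univ.erase i, -(c j * y) = A
    generalize ∏ j ∈ Finset.univ.erase i, (1 - (c j)⁻¹ * y⁻¹) = B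
    field_simp
  rw [e]
  linear_combination (∏ j, -(c j * y)) * key

open PowerSeries in
theorem one_sub_smul_X_mul_mk (b : ℂ) :
    (1 - b • (X : PowerSeries ℂ)) * mk (fun n => b ^ n) = 1 := by
  ext n
  rcases n with _ | n
  · simp [sub_mul, coeff_zero_eq_constantCoeff]
  · rw [sub_mul, one_mul, map_sub, smul_mul_assoc, map_smul, coeff_succ_X_mul, coeff_mk, coeff_mk,
      coeff_one, if_neg (Nat.succ_ne_zero n), smul_eq_mul]
    ring

open PowerSeries in
theorem prod_one_sub_smul_X_ne_zero {I : Type} (t : Finset I) (b : I → ℂ) :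
    ∏ j ∈ t, (1 - b j • (X : PowerSeries ℂ)) ≠ 0 :=
  Finset.prod_ne_zero_iff.mpr fun j _ => left_ne_zero_of_mul_eq_one (one_sub_smul_X_mul_mk (b j))

open PowerSeries in
/-- The coefficients of the expansions at `x = 0` and `x = ∞` of `∏ (1 - aᵢ x) / (1 - cᵢ x)` differ
by the residues. -/
theorem coeff_sub_coeff_eq_sum_residue {I : Type} [Fintype I] [DecidableEq I] (a c : I → ℂ)
    (ha : ∀ i, a i ≠ 0) (hc : ∀ i, c i ≠ 0) (hinj : Function.Injective c) (r : I → ℂ)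
    (hr : ∀ i, r i = ∏ j, (1 - a j * (c i)⁻¹) / (if j = i then 1 else 1 - c j * (c i)⁻¹))
    (P M : PowerSeries ℂ)
    (hP : P * ∏ j, (1 - c j • X) = ∏ j, (1 - a j • X))
    (hM : M * ∏ j, (1 - (c j)⁻¹ • X) = (∏ j, a j / c j) • ∏ j, (1 - (a j)⁻¹ • X)) (k : ℤ) :
    (if 0 ≤ k then coeff k.toNat P else 0) - (if k ≤ 0 then coeff (-k).toNat M else 0) =
      ∑ i, r i * c i ^ k := by
  have key := congrArg (Polynomial.coeToPowerSeries.ringHom (R := ℂ))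
    (sum_residue_aux a c ha hc hinj r hr)
  have key' := congrArg (Polynomial.coeToPowerSeries.ringHom (R := ℂ))
    (sum_residue_aux' a c ha hc hinj r hr)
  simp only [map_mul, map_prod, map_sub, map_one, map_sum, map_add,
    Polynomial.coeToPowerSeries.ringHom_apply, Polynomial.coe_C, Polynomial.coe_X] at key key'
  simp only [smul_eq_C_mul] at hP hM
  have geom := one_sub_smul_X_mul_mk
  have nz := fun b : I → ℂ => prod_one_sub_smul_X_ne_zero Finset.univ b
  simp only [smul_eq_C_mul] at geom nz
  have eP : P = C (∏ j, a j / c j) + ∑ i, C (r i) * mk (fun n => c i ^ n) := by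
    refine mul_right_cancel₀ (nz c) ?_
    rw [hP, key', ← map_prod, add_mul, Finset.sum_mul]
    congr 1
    refine Finset.sum_congr rfl fun i _ => ?_
    rw [← Finset.mul_prod_erase Finset.univ _ (Finset.mem_univ i)]
    linear_combination (-C (r i) * ∏ j ∈ Finset.univ.erase i, (1 - C (c j) * X)) * geom (c i)
  have eM : M = C (∏ j, a j / c j) -
      ∑ i, C (r i) * C (c i)⁻¹ * X * mk (fun n => (c i)⁻¹ ^ n) := by
    refine mul_right_cancel₀ (nz fun j => (c j)⁻¹) ?_
    rw [hM, map_prod, key, sub_mul, Finset.sum_mul]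
    refine congrArg₂ _ rfl (Finset.sum_congr rfl fun i _ => ?_)
    rw [← Finset.mul_prod_erase Finset.univ (fun j => 1 - C (c j)⁻¹ * (X : PowerSeries ℂ))
      (Finset.mem_univ i)]
    have g := geom (c i)⁻¹
    generalize mk (fun n => (c i)⁻¹ ^ n) = G at g ⊢
    generalize ∏ j ∈ Finset.univ.erase i, (1 - C (c j)⁻¹ * (X : PowerSeries ℂ)) = B
    linear_combination (-C (r i) * C (c i)⁻¹ * X * B) * g
  have cP : ∀ n : ℕ, coeff n P = (if n = 0 then ∏ j, a j / c j else 0) + ∑ i, r i * c i ^ n := by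
    intro n
    rw [eP, map_add, coeff_C, map_sum]
    simp
  have cM0 : coeff 0 M = ∏ j, a j / c j := by
    rw [eM, map_sub, map_sum]
    simp [coeff_C]
  have cM : ∀ n : ℕ, coeff (n + 1) M = -∑ i, r i * (c i)⁻¹ ^ (n + 1) := by
    intro n
    rw [eM, map_sub, map_sum, coeff_C, if_neg (Nat.succ_ne_zero n), zero_sub]
    congr 1
    refine Finset.sum_congr rfl fun i _ => ?_
    rw [mul_assoc, mul_assoc, coeff_C_mul, coeff_C_mul, coeff_succ_X_mul, coeff_mk]
    ring
  rcases lt_trichotomy k 0 with hk | rfl | hk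
  · obtain ⟨n, rfl⟩ : ∃ n : ℕ, k = -((n : ℤ) + 1) := ⟨(-k - 1).toNat, by omega⟩
    rw [if_neg (by omega), if_pos (by omega), show (- -((n : ℤ) + 1)).toNat = n + 1 by omega, cM]
    rw [zero_sub, neg_neg]
    refine Finset.sum_congr rfl fun i _ => ?_
    rw [zpow_neg, inv_pow, ← zpow_natCast]; push_cast; rfl
  -- Only at k = 0 do both expansions contribute. The constant ∏ aⱼ/cⱼ cancels and ∑ rᵢ remains.
  · simp [-coeff_zero_eq_constantCoeff, cP, cM0]
  · obtain ⟨n, rfl⟩ : ∃ n : ℕ, k = (n : ℤ) + 1 := ⟨(k - 1).toNat, by omega⟩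
    rw [if_pos (by omega), if_neg (by omega), show ((n : ℤ) + 1).toNat = n + 1 by omega, cP,
      if_neg (by omega), zero_add, sub_zero]
    refine Finset.sum_congr rfl fun i _ => ?_
    rw [← zpow_natCast]; push_cast; rfl

/-! ### Weights of boxes -/

/-- The weight `q₁ᵃ q₃ˢ u` of the box in row `s` and column `a`. -/
def wt (q₁ q₂ u : ℂ) (s a : ℤ) : ℂ := q₁ ^ a * qThree q₁ q₂ ^ s * u

/-- The consequence of genericity that matters: distinct boxes have distinct weights. -/
structure GenericWt {n : ℕ} (q₁ q₂ : ℂ) (u : Fin n → ℂ) : Prop where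
  q₁_ne : q₁ ≠ 0
  q₂_ne : q₂ ≠ 0
  u_ne : ∀ i, u i ≠ 0
  inj : ∀ i k s t a b, wt q₁ q₂ (u i) s a = wt q₁ q₂ (u k) t b → i = k ∧ s = t ∧ a = b

theorem qThree_ne {q₁ q₂ : ℂ} (h₁ : q₁ ≠ 0) (h₂ : q₂ ≠ 0) : qThree q₁ q₂ ≠ 0 := by
  simp [qThree, h₁, h₂]

theorem qThree_zpow (q₁ q₂ : ℂ) (s : ℤ) : qThree q₁ q₂ ^ s = (q₁ ^ s)⁻¹ * (q₂ ^ s)⁻¹ := by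
  rw [qThree, inv_zpow, mul_zpow, mul_inv]

theorem wt_ne {q₁ q₂ u : ℂ} (h₁ : q₁ ≠ 0) (h₂ : q₂ ≠ 0) (hu : u ≠ 0) (s a : ℤ) :
    wt q₁ q₂ u s a ≠ 0 :=
  mul_ne_zero (mul_ne_zero (zpow_ne_zero _ h₁) (zpow_ne_zero _ (qThree_ne h₁ h₂))) hu

theorem wt_inv (q₁ q₂ u : ℂ) (s a : ℤ) : wt q₁⁻¹ q₂⁻¹ u⁻¹ s a = (wt q₁ q₂ u s a)⁻¹ := by
  simp only [wt, qThree_inv, inv_zpow, mul_inv]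

theorem GenericWt.inv {n : ℕ} {q₁ q₂ : ℂ} {u : Fin n → ℂ} (h : GenericWt q₁ q₂ u) :
    GenericWt q₁⁻¹ q₂⁻¹ fun i => (u i)⁻¹ where
  q₁_ne := inv_ne_zero h.q₁_ne
  q₂_ne := inv_ne_zero h.q₂_ne
  u_ne i := inv_ne_zero (h.u_ne i)
  inj i k s t a b hw := h.inj i k s t a b (by simpa only [wt_inv, inv_inj] using hw)

theorem GenericWt.comp {n m : ℕ} {q₁ q₂ : ℂ} {u : Fin n → ℂ} (h : GenericWt q₁ q₂ u)
    (f : Fin m → Fin n) (hf : Function.Injective f) : GenericWt q₁ q₂ fun i => u (f i) where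
  q₁_ne := h.q₁_ne
  q₂_ne := h.q₂_ne
  u_ne i := h.u_ne _
  inj i k s t a b hw := by
    obtain ⟨h1, h2⟩ := h.inj _ _ s t a b hw
    exact ⟨hf h1, h2⟩

theorem IsGeneric.genericWt {n : ℕ} {q₁ q₂ : ℂ} {u : Fin n → ℂ}
    (h : IsGeneric (Sum.elim ![q₁, q₂] u)) : GenericWt q₁ q₂ u := by
  have h₁ : q₁ ≠ 0 := h.1 (Sum.inl 0)
  have h₂ : q₂ ≠ 0 := h.1 (Sum.inl 1)
  have hu : ∀ i, u i ≠ 0 := fun i => h.1 (Sum.inr i)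
  refine ⟨h₁, h₂, hu, fun i k s t a b hw => ?_⟩
  -- Since q₃ = (q₁q₂)⁻¹, equality of the weights reads q₁^(a-s-b+t) q₂^(t-s) uᵢ/u_k = 1.
  have key := h.2 (Sum.elim ![a - s - b + t, t - s] (Pi.single i 1 - Pi.single k 1)) ?_
  · have e0 : a - s - b + t = 0 := congrFun key (Sum.inl 0)
    have e1 : t - s = 0 := congrFun key (Sum.inl 1)
    refine ⟨?_, by omega, by omega⟩
    by_contra hik
    have e2 := congrFun key (Sum.inr i)
    simp [hik] at e2
  · have hs : ∏ j, u j ^ ((Pi.single i 1 - Pi.single k 1 : Fin n → ℤ) j) = u i * (u k)⁻¹ := by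
      have e : ∀ l, ∏ j, u j ^ ((Pi.single l 1 : Fin n → ℤ) j) = u l := by
        intro l
        rw [Finset.prod_eq_single l] <;> simp +contextual
      simp only [Pi.sub_apply, zpow_sub₀ (hu _), div_eq_mul_inv, Finset.prod_mul_distrib,
        Finset.prod_inv_distrib, e]
    rw [Fintype.prod_sum_type]
    simp only [Sum.elim_inl, Sum.elim_inr, hs, Fin.prod_univ_two]
    simp only [wt, qThree_zpow] at hw
    simp only [Matrix.cons_val_zero, Matrix.cons_val_one, zpow_add₀ h₁, zpow_sub₀ h₁, zpow_sub₀ h₂]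
    have hk := hu k
    have z1 := zpow_ne_zero s h₁
    have z2 := zpow_ne_zero s h₂
    have z3 := zpow_ne_zero t h₁
    have z4 := zpow_ne_zero t h₂
    have z5 := zpow_ne_zero b h₁
    generalize q₁ ^ s = A at *
    generalize q₂ ^ s = B at *
    generalize q₁ ^ t = A' at *
    generalize q₂ ^ t = B' at *
    generalize q₁ ^ b = E at *
    generalize q₁ ^ a = D at *
    field_simp at hw ⊢
    linear_combination hw

theorem q₁_mul_wt {q₁ : ℂ} (h₁ : q₁ ≠ 0) (q₂ u : ℂ) (s a : ℤ) :
    q₁ * wt q₁ q₂ u s a = wt q₁ q₂ u s (a + 1) := by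
  simp only [wt, zpow_add₀ h₁, zpow_one]; ring

theorem q₃_mul_wt {q₁ q₂ : ℂ} (h₁ : q₁ ≠ 0) (h₂ : q₂ ≠ 0) (u : ℂ) (s a : ℤ) :
    qThree q₁ q₂ * wt q₁ q₂ u s a = wt q₁ q₂ u (s + 1) a := by
  simp only [wt, zpow_add₀ (qThree_ne h₁ h₂), zpow_one]; ring

/-- Multiplication by q₁, q₃, q₂ moves one column right, one row down, and one step up the diagonal.
The last move can leave the quadrant, which is why `wt` takes integer indices. -/
theorem q₂_mul_wt {q₁ q₂ : ℂ} (h₁ : q₁ ≠ 0) (h₂ : q₂ ≠ 0) (u : ℂ) (s a : ℤ) :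
    q₂ * wt q₁ q₂ u s a = wt q₁ q₂ u (s - 1) (a - 1) := by
  have h := mul_qThree h₁ h₂
  have h3 := qThree_ne h₁ h₂
  have e := q₁_mul_wt h₁ q₂ u s (a - 1)
  have e' := q₃_mul_wt h₁ h₂ u (s - 1) (a - 1)
  rw [sub_add_cancel] at e e'
  rw [← e, ← e', ← mul_assoc, ← mul_assoc, mul_comm q₂, h, one_mul]

/-- Row j of length a is the vector |a - j⟩ of V(u q₂⁻ʲ); its parameters become box weights of the
Fock module. -/
theorem wt_row {q₁ : ℂ} (h₁ : q₁ ≠ 0) (q₂ u : ℂ) (j : ℕ) (a : ℤ) :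
    q₁ ^ (a - j) * (u * q₂ ^ (-(j : ℤ))) = wt q₁ q₂ u j a := by
  simp only [wt, qThree_zpow, zpow_sub₀ h₁, zpow_neg]; ring

/-- The numerator of the factor by which the eigenvalue of `ψ⁺` changes when a box is added. -/
def boxNum (q₁ q₂ u : ℂ) {R : Type} [CommRing R] [Algebra ℂ R] (s a : ℤ) (x : R) : R :=
  (1 - wt q₁ q₂ u s (a - 1) • x) * (1 - wt q₁ q₂ u (s + 1) (a + 1) • x) *
    (1 - wt q₁ q₂ u (s - 1) a • x)

/-- The denominator of the factor by which the eigenvalue of `ψ⁺` changes when a box is added. -/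
def boxDen (q₁ q₂ u : ℂ) {R : Type} [CommRing R] [Algebra ℂ R] (s a : ℤ) (x : R) : R :=
  (1 - wt q₁ q₂ u s (a + 1) • x) * (1 - wt q₁ q₂ u (s - 1) (a - 1) • x) *
    (1 - wt q₁ q₂ u (s + 1) a • x)

/-- The product over all the boxes `(j, t)`, `t < S j`. -/
def boxProd {M : Type} [CommMonoid M] (S : ℕ →₀ ℕ) (g : ℕ → ℕ → M) : M :=
  S.prod fun j a => ∏ t ∈ Finset.range a, g j t

theorem boxProd_eq_prod {M : Type} [CommMonoid M] (S : ℕ →₀ ℕ) (g : ℕ → ℕ → M) (T : Finset ℕ)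
    (hT : ∀ j ∉ T, S j = 0) : boxProd S g = ∏ j ∈ T, ∏ t ∈ Finset.range (S j), g j t := by
  rw [boxProd, Finsupp.prod_of_support_subset S (s := T) _ _ (by simp)]
  intro j hj
  by_contra h
  exact (Finsupp.mem_support_iff.mp hj) (hT j h)

theorem boxProd_add {M : Type} [CommMonoid M] (S : ℕ →₀ ℕ) (s : ℕ) (g : ℕ → ℕ → M) :
    boxProd (S + Finsupp.single s 1) g = boxProd S g * g s (S s) := by
  set T := insert s S.support
  have hs : s ∈ T := Finset.mem_insert_self _ _
  have hT : ∀ j ∉ T, j ≠ s ∧ S j = 0 := fun j hj => by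
    simpa only [T, Finset.mem_insert, not_or, Finsupp.mem_support_iff, not_not] using hj
  have hne : ∀ j, j ≠ s → (S + Finsupp.single s 1 : ℕ →₀ ℕ) j = S j := fun j hj => by
    rw [Finsupp.add_apply, Finsupp.single_eq_of_ne hj, add_zero]
  rw [boxProd_eq_prod S g T fun j hj => (hT j hj).2,
    boxProd_eq_prod _ g T fun j hj => (hne j (hT j hj).1).trans (hT j hj).2,
    ← Finset.mul_prod_erase T _ hs, ← Finset.mul_prod_erase T (fun j => ∏ t ∈ Finset.range (S j), _) hs,
    Finset.prod_congr rfl (s₁ := T.erase s) (g := fun j : ℕ => ∏ t ∈ Finset.range (S j), g j t)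
      fun j hj => by rw [hne j (Finset.ne_of_mem_erase hj)]]
  rw [Finsupp.add_apply, Finsupp.single_eq_same, Finset.prod_range_succ, mul_right_comm]

theorem boxProd_mul {M : Type} [CommMonoid M] (S : ℕ →₀ ℕ) (g g' : ℕ → ℕ → M) :
    boxProd S (fun j t => g j t * g' j t) = boxProd S g * boxProd S g' := by
  simp only [boxProd, Finset.prod_mul_distrib, Finsupp.prod_mul]

theorem boxProd_eq_one {M : Type} [CommMonoid M] (S : ℕ →₀ ℕ) {g : ℕ → ℕ → M}
    (hg : ∀ j t, g j t = 1) : boxProd S g = 1 := by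
  simp only [boxProd, hg, Finset.prod_const_one, Finsupp.prod_fun_one]

theorem boxProd_ne_zero (S : ℕ →₀ ℕ) {g : ℕ → ℕ → ℂ} (hg : ∀ j t, g j t ≠ 0) :
    boxProd S g ≠ 0 :=
  Finset.prod_ne_zero_iff.mpr fun _ _ => Finset.prod_ne_zero_iff.mpr fun _ _ => hg _ _

/-! ### Eigenvalues of ψ⁺ by rows and by boxes, over any field containing ℂ. -/

section Rows

variable {K : Type} [Field K] [Algebra ℂ K] (q₁ q₂ u : ℂ)

/-- The eigenvalue of `ψ⁺` on row `j` of length `a`. -/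
def rowVal (j a : ℤ) (x : K) : K :=
  (1 - wt q₁ q₂ u (j + 1) a • x) * (1 - wt q₁ q₂ u (j - 1) (a - 1) • x) /
    ((1 - wt q₁ q₂ u j a • x) * (1 - wt q₁ q₂ u j (a - 1) • x))

/-- The eigenvalue of `ψ⁺` on the empty rows of index at least `N`. -/
def vacVal (N : ℤ) (x : K) : K :=
  (1 - wt q₁ q₂ u (N - 1) (-1) • x) / (1 - wt q₁ q₂ u N 0 • x)

/-- The eigenvalue of `ψ⁺` on a sequence of rows, as a product over boxes. -/
def psiBox (S : ℕ →₀ ℕ) (x : K) : K :=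
  vacVal q₁ q₂ u 0 x * S.prod fun j a =>
    ∏ t ∈ Finset.range a, boxNum q₁ q₂ u j t x / boxDen q₁ q₂ u j t x

variable {q₁ q₂ u}

theorem rowPsiPlus_eq_rowVal (h₁ : q₁ ≠ 0) (h₂ : q₂ ≠ 0) (l : FinPartition) (j : ℕ) (x : K) :
    rowPsiPlus q₁ q₂ u l j x = rowVal q₁ q₂ u j (l.part j) x := by
  have e0 := wt_row h₁ q₂ u j (l.part j)
  have e1 := wt_row h₁ q₂ u j (l.part j - 1)
  have e3 := q₃_mul_wt h₁ h₂ u j (l.part j)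
  have e2 := q₂_mul_wt h₁ h₂ u j (l.part j)
  have a3 : q₁ ^ ((l.part j : ℤ) - j) * qThree q₁ q₂ * (u * q₂ ^ (-(j : ℤ))) =
      wt q₁ q₂ u (j + 1) (l.part j) := by rw [← e3, ← e0]; ring
  have a2 : q₁ ^ ((l.part j : ℤ) - j) * q₂ * (u * q₂ ^ (-(j : ℤ))) =
      wt q₁ q₂ u (j - 1) (l.part j - 1) := by rw [← e2, ← e0]; ring
  rw [rowPsiPlus, vecPsiPlus, rowVal, div_eq_mul_inv, a3, a2, e0, sub_right_comm, e1]

theorem vacPsiPlus_eq_vacVal (h₁ : q₁ ≠ 0) (h₂ : q₂ ≠ 0) (s : ℕ) (x : K) :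
    vacPsiPlus q₂ (u * qThree q₁ q₂ ^ s) x = vacVal q₁ q₂ u s x := by
  have e2 := q₂_mul_wt h₁ h₂ u s 0
  rw [zero_sub] at e2
  rw [vacPsiPlus, vacVal, div_eq_mul_inv, ← e2, wt]
  simp [mul_comm]

/-- Lengthening a row by one box multiplies its factor by `boxNum`/`boxDen`. In the product form
only the factors of the row itself have to be nonzero, so the identity survives at weights of the
same component, where `boxDen` may vanish. -/
theorem rowVal_succ_mul (j a : ℤ) (x : K) (h0 : 1 - wt q₁ q₂ u j (a - 1) • x ≠ 0)
    (h1 : 1 - wt q₁ q₂ u j a • x ≠ 0) (h2 : 1 - wt q₁ q₂ u j (a + 1) • x ≠ 0) :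
    boxDen q₁ q₂ u j a x * rowVal q₁ q₂ u j (a + 1) x =
      boxNum q₁ q₂ u j a x * rowVal q₁ q₂ u j a x := by
  simp only [boxDen, boxNum, rowVal, add_sub_cancel_right]
  field_simp

theorem boxDen_ne {x : K} (hx : ∀ s a, 1 - wt q₁ q₂ u s a • x ≠ 0) (s a : ℤ) :
    boxDen q₁ q₂ u s a x ≠ 0 := mul_ne_zero (mul_ne_zero (hx _ _) (hx _ _)) (hx _ _)

theorem boxNum_ne {x : K} (hx : ∀ s a, 1 - wt q₁ q₂ u s a • x ≠ 0) (s a : ℤ) :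
    boxNum q₁ q₂ u s a x ≠ 0 := mul_ne_zero (mul_ne_zero (hx _ _) (hx _ _)) (hx _ _)

theorem rowVal_ne {x : K} (hx : ∀ s a, 1 - wt q₁ q₂ u s a • x ≠ 0) (s a : ℤ) :
    rowVal q₁ q₂ u s a x ≠ 0 :=
  div_ne_zero (mul_ne_zero (hx _ _) (hx _ _)) (mul_ne_zero (hx _ _) (hx _ _))

theorem rowVal_eq_prod {x : K} (hx : ∀ s a, 1 - wt q₁ q₂ u s a • x ≠ 0) (j : ℤ) (a : ℕ) :
    rowVal q₁ q₂ u j a x = rowVal q₁ q₂ u j 0 x *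
      ∏ t ∈ Finset.range a, boxNum q₁ q₂ u j t x / boxDen q₁ q₂ u j t x := by
  induction a with
  | zero => simp
  | succ a ih =>
    rw [Finset.prod_range_succ, ← mul_assoc, ← ih]
    have := rowVal_succ_mul j a x (hx _ _) (hx _ _) (hx _ _)
    have hd := boxDen_ne hx j a
    push_cast
    field_simp
    linear_combination this

theorem psiBox_eq_prod (S : ℕ →₀ ℕ) (x : K) (T : Finset ℕ) (hT : ∀ j ∉ T, S j = 0) :
    psiBox q₁ q₂ u S x = vacVal q₁ q₂ u 0 x *
      ∏ j ∈ T, ∏ t ∈ Finset.range (S j), boxNum q₁ q₂ u j t x / boxDen q₁ q₂ u j t x :=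
  congrArg _ (boxProd_eq_prod S (fun j t => boxNum q₁ q₂ u j t x / boxDen q₁ q₂ u j t x) T hT)

theorem psiBox_add (S : ℕ →₀ ℕ) (s : ℕ) (x : K) :
    psiBox q₁ q₂ u (S + Finsupp.single s 1) x =
      psiBox q₁ q₂ u S x * (boxNum q₁ q₂ u s (S s) x / boxDen q₁ q₂ u s (S s) x) := by
  rw [psiBox, psiBox, mul_assoc]
  exact congrArg _ (boxProd_add S s fun j t => boxNum q₁ q₂ u j t x / boxDen q₁ q₂ u j t x)

/-- Empty rows telescope: the factor of empty row N is the quotient of the vacuum factors at N and N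
+ 1. -/
theorem vacVal_zero {x : K} (hx : ∀ s a, 1 - wt q₁ q₂ u s a • x ≠ 0) (N : ℕ) :
    vacVal q₁ q₂ u 0 x = vacVal q₁ q₂ u N x * ∏ j ∈ Finset.range N, rowVal q₁ q₂ u j 0 x := by
  induction N with
  | zero => simp
  | succ N ih =>
    rw [ih, Finset.prod_range_succ]
    have a1 := hx (N + 1) 0
    have a2 := hx N 0
    have a3 := hx N (-1)
    simp only [vacVal, rowVal]
    push_cast
    simp only [add_sub_cancel_right]
    field_simp

theorem psiBox_eq_rows {x : K} (hx : ∀ s a, 1 - wt q₁ q₂ u s a • x ≠ 0) (S : ℕ →₀ ℕ) (N : ℕ)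
    (hN : ∀ j, N ≤ j → S j = 0) :
    psiBox q₁ q₂ u S x =
      vacVal q₁ q₂ u N x * ∏ j ∈ Finset.range N, rowVal q₁ q₂ u j (S j) x := by
  rw [psiBox_eq_prod S x (Finset.range N) (fun j hj => hN j (by simpa using hj)), vacVal_zero hx N,
    mul_assoc, ← Finset.prod_mul_distrib]
  congr 1
  exact Finset.prod_congr rfl fun j _ => (rowVal_eq_prod hx j (S j)).symm

/-- The quotient of a row by the empty row of the same index is the product of its box factors; it
is 1 outside the support, which makes the infinite product finite. -/
theorem fockPsiPlus_eq_psiBox (h₁ : q₁ ≠ 0) (h₂ : q₂ ≠ 0) {x : K}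
    (hx : ∀ s a, 1 - wt q₁ q₂ u s a • x ≠ 0) (l : FinPartition) :
    fockPsiPlus q₁ q₂ u l x = psiBox q₁ q₂ u l.1 x := by
  have e : ∀ j : ℕ, rowPsiPlus q₁ q₂ u l j x * (rowPsiPlus q₁ q₂ u FinPartition.empty j x)⁻¹ =
      ∏ t ∈ Finset.range (l.1 j), boxNum q₁ q₂ u j t x / boxDen q₁ q₂ u j t x := by
    intro j
    rw [rowPsiPlus_eq_rowVal h₁ h₂, rowPsiPlus_eq_rowVal h₁ h₂,
      show FinPartition.empty.part j = 0 from rfl, show l.part j = l.1 j from rfl,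
      rowVal_eq_prod hx, Nat.cast_zero]
    have := rowVal_ne hx j 0
    field_simp
  rw [fockPsiPlus, psiBox, Finsupp.prod]
  congr 1
  · have := vacPsiPlus_eq_vacVal (u := u) h₁ h₂ 0 x
    simpa using this
  · simp only [e]
    refine finprod_eq_prod_of_mulSupport_subset _ fun j hj => ?_
    simp only [Finset.mem_coe, Finsupp.mem_support_iff]
    intro h0
    simp [h0] at hj

end Rows

/-! ### Duality between the expansions at `0` and at `∞` -/

theorem rowPsiMinus_eq {R : Type} [CommRing R] [Algebra ℂ R] [Inv R] (q₁ q₂ u : ℂ)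
    (l : FinPartition) (j : ℕ) (y : R) :
    rowPsiMinus q₁ q₂ u l j y = rowPsiPlus q₁⁻¹ q₂⁻¹ u⁻¹ l j y := by
  simp only [rowPsiMinus, rowPsiPlus, vecPsiMinus, vecPsiPlus, qThree_inv, mul_inv, inv_zpow',
    neg_sub, neg_neg]
  rw [show (j : ℤ) - l.part j + 1 = 1 - (l.part j - j) by ring, ← zpow_neg, neg_neg]

/-- The formulas for ψ⁻ in z are those for ψ⁺ in 1/z with all parameters inverted, up to the
constant q₂. Statements about ψ⁺ thus transfer to ψ⁻. -/
theorem fockPsiMinus_eq {R : Type} [CommRing R] [Algebra ℂ R] [Inv R] (q₁ q₂ u : ℂ)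
    (l : FinPartition) (y : R) :
    fockPsiMinus q₁ q₂ u l y = q₂ • fockPsiPlus q₁⁻¹ q₂⁻¹ u⁻¹ l y := by
  simp only [fockPsiMinus, fockPsiPlus, rowPsiMinus_eq, vacPsiMinus, vacPsiPlus, smul_mul_assoc]

theorem one_sub_inv_smul {w y : ℂ} (hw : w ≠ 0) (hy : y ≠ 0) :
    1 - w⁻¹ • y = -(w⁻¹ * y) * (1 - w • y⁻¹) := by
  simp only [smul_eq_mul]; field_simp; ring

/-- Pulling -(w⁻¹ y) out of each linear factor leaves no monomial per box, because numerator and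
denominator weights of a box have the same product; the vacuum leaves q₂⁻¹. So ψ⁺ and ψ⁻ come from
one rational function. -/
theorem psiBox_inv {q₁ q₂ u : ℂ} (h₁ : q₁ ≠ 0) (h₂ : q₂ ≠ 0) (hu : u ≠ 0) (S : ℕ →₀ ℕ) {y : ℂ}
    (hy : y ≠ 0) : q₂ * psiBox q₁⁻¹ q₂⁻¹ u⁻¹ S y = psiBox q₁ q₂ u S y⁻¹ := by
  have hw := wt_ne h₁ h₂ hu
  rw [psiBox, psiBox, ← mul_assoc]
  congr 1
  · simp only [vacVal, wt_inv]
    rw [one_sub_inv_smul (hw _ _) hy, one_sub_inv_smul (hw _ _) hy, mul_div_mul_comm]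
    have e := q₂_mul_wt h₁ h₂ u 0 0
    simp only [zero_sub] at e ⊢
    rw [← e]
    have := hw 0 0
    rw [← mul_assoc]
    convert one_mul _ using 2
    field_simp
  · refine Finset.prod_congr rfl fun j _ => Finset.prod_congr rfl fun t _ => ?_
    simp only [boxNum, boxDen, wt_inv]
    simp only [one_sub_inv_smul (hw _ _) hy]
    have h3 := qThree_ne h₁ h₂
    have hp := hw j t
    have e1 := q₁_mul_wt h₁ q₂ u j t
    have e2 := q₂_mul_wt h₁ h₂ u j t
    have e3 := q₃_mul_wt h₁ h₂ u j t
    have e1' := q₁_mul_wt h₁ q₂ u j (t - 1)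
    have e2' := q₂_mul_wt h₁ h₂ u (j + 1) (t + 1)
    have e3' := q₃_mul_wt h₁ h₂ u (j - 1) t
    rw [sub_add_cancel] at e1' e3'
    rw [add_sub_cancel_right, add_sub_cancel_right] at e2'
    -- Both products equal the cube of the weight of the box, by q₁q₂q₃ = 1.
    have hprod : (wt q₁ q₂ u j (t - 1)) * (wt q₁ q₂ u (j + 1) (t + 1)) *
        (wt q₁ q₂ u (j - 1) t) = wt q₁ q₂ u j (t + 1) * wt q₁ q₂ u (j - 1) (t - 1) *
        wt q₁ q₂ u (j + 1) t := by
      rw [← e1, ← e2, ← e3]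
      have hq := mul_qThree h₁ h₂
      have : q₁ * wt q₁ q₂ u j (t - 1) * (q₂ * wt q₁ q₂ u (j + 1) (t + 1)) *
          (qThree q₁ q₂ * wt q₁ q₂ u (j - 1) t) = wt q₁ q₂ u j t ^ 3 := by
        rw [e1', e2', e3']; ring
      linear_combination this - (wt q₁ q₂ u j (t - 1) * wt q₁ q₂ u (j + 1) (t + 1) *
        wt q₁ q₂ u (j - 1) t + wt q₁ q₂ u j t ^ 3) * hq
    have n1 := hw j (t - 1)
    have n2 := hw (j + 1) (t + 1)
    have n3 := hw (j - 1) t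
    have n4 := hw j (t + 1)
    have n5 := hw (j - 1) (t - 1)
    have n6 := hw (j + 1) t
    generalize wt q₁ q₂ u j (t - 1) = w1 at *
    generalize wt q₁ q₂ u (j + 1) (t + 1) = w2 at *
    generalize wt q₁ q₂ u (j - 1) t = w3 at *
    generalize wt q₁ q₂ u j (t + 1) = w4 at *
    generalize wt q₁ q₂ u (j - 1) (t - 1) = w5 at *
    generalize wt q₁ q₂ u (j + 1) t = w6 at *
    have gen : ∀ A B D E F G : ℂ,
        -(w1⁻¹ * y) * A * (-(w2⁻¹ * y) * B) * (-(w3⁻¹ * y) * D) /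
          (-(w4⁻¹ * y) * E * (-(w5⁻¹ * y) * F) * (-(w6⁻¹ * y) * G)) = A * B * D / (E * F * G) := by
      intro A B D E F G
      rw [show -(w1⁻¹ * y) * A * (-(w2⁻¹ * y) * B) * (-(w3⁻¹ * y) * D) =
        -((w1 * w2 * w3)⁻¹ * y ^ 3) * (A * B * D) by rw [mul_inv, mul_inv]; ring,
        show -(w4⁻¹ * y) * E * (-(w5⁻¹ * y) * F) * (-(w6⁻¹ * y) * G) =
        -((w4 * w5 * w6)⁻¹ * y ^ 3) * (E * F * G) by rw [mul_inv, mul_inv]; ring, hprod]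
      rw [mul_div_mul_left]
      exact neg_ne_zero.mpr (mul_ne_zero (inv_ne_zero (mul_ne_zero (mul_ne_zero n4 n5) n6))
        (pow_ne_zero _ hy))
    exact gen _ _ _ _ _ _

theorem GenericWt.one_sub_wt_ne {n : ℕ} {q₁ q₂ : ℂ} {u : Fin n → ℂ} (h : GenericWt q₁ q₂ u)
    (i k : Fin n) (s a t b : ℤ) (hne : ¬(k = i ∧ t = s ∧ b = a)) :
    1 - wt q₁ q₂ (u k) t b • (wt q₁ q₂ (u i) s a)⁻¹ ≠ 0 := by
  intro h0
  have hw := wt_ne h.q₁_ne h.q₂_ne (h.u_ne i) s a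
  refine hne (h.inj _ _ _ _ _ _ ?_)
  rw [sub_eq_zero, smul_eq_mul, eq_mul_inv_iff_mul_eq₀ hw, one_mul] at h0
  exact h0.symm

theorem GenericWt.fockPsiPlus_eq {n : ℕ} {q₁ q₂ : ℂ} {u : Fin n → ℂ} (h : GenericWt q₁ q₂ u)
    {i k : Fin n} (hik : k ≠ i) (l : FinPartition) (s a : ℤ) :
    fockPsiPlus q₁ q₂ (u k) l (wt q₁ q₂ (u i) s a)⁻¹ =
      psiBox q₁ q₂ (u k) l.1 (wt q₁ q₂ (u i) s a)⁻¹ :=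
  fockPsiPlus_eq_psiBox h.q₁_ne h.q₂_ne
    (fun t b => h.one_sub_wt_ne i k s a t b fun hh => hik hh.1) l

theorem GenericWt.fockPsiMinus_eq {n : ℕ} {q₁ q₂ : ℂ} {u : Fin n → ℂ} (h : GenericWt q₁ q₂ u)
    {i k : Fin n} (hik : k ≠ i) (l : FinPartition) (s a : ℤ) :
    fockPsiMinus q₁ q₂ (u k) l (wt q₁ q₂ (u i) s a) =
      psiBox q₁ q₂ (u k) l.1 (wt q₁ q₂ (u i) s a)⁻¹ := by
  have hw := wt_ne h.q₁_ne h.q₂_ne (h.u_ne i) s a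
  rw [_root_.fockPsiMinus_eq, ← psiBox_inv h.q₁_ne h.q₂_ne (h.u_ne k) _ hw, smul_eq_mul]
  congr 1
  have := h.inv.fockPsiPlus_eq hik l s a
  simpa only [wt_inv, inv_inv] using this

/-! ### Poles and zeros of the eigenvalues -/

/-- The poles of the eigenvalue of `ψ⁺` on a sequence with at most `N` nonzero rows. -/
def poleWt (q₁ q₂ u : ℂ) (S : ℕ →₀ ℕ) (N : ℕ) (c : Fin (N + 1) × Bool) : ℂ :=
  wt q₁ q₂ u (c.1 : ℕ) (if c.2 then (S c.1 : ℤ) else S c.1 - 1)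

/-- The zeros of the eigenvalue of `ψ⁺` on a sequence with at most `N` nonzero rows. -/
def zeroWt (q₁ q₂ u : ℂ) (S : ℕ →₀ ℕ) (N : ℕ) (c : Fin (N + 1) × Bool) : ℂ :=
  if c.2 then wt q₁ q₂ u ((c.1 : ℕ) - 1) (S c.1 - 1)
  else if (c.1 : ℕ) < N then wt q₁ q₂ u ((c.1 : ℕ) + 1) (S c.1)
  else wt q₁ q₂ u (c.1 : ℕ) (S c.1 - 1)

theorem poleWt_inv (q₁ q₂ u : ℂ) (S : ℕ →₀ ℕ) (N : ℕ) (c : Fin (N + 1) × Bool) :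
    poleWt q₁⁻¹ q₂⁻¹ u⁻¹ S N c = (poleWt q₁ q₂ u S N c)⁻¹ := wt_inv _ _ _ _ _

theorem zeroWt_inv (q₁ q₂ u : ℂ) (S : ℕ →₀ ℕ) (N : ℕ) (c : Fin (N + 1) × Bool) :
    zeroWt q₁⁻¹ q₂⁻¹ u⁻¹ S N c = (zeroWt q₁ q₂ u S N c)⁻¹ := by
  simp only [zeroWt, wt_inv]; split_ifs <;> rfl

/-- The value of the rational function at z = 0: each row contributes q₂ · q₂⁻¹, and the vacuum
contributes q₂. -/
theorem prod_zeroWt_div_poleWt {q₁ q₂ u : ℂ} (h₁ : q₁ ≠ 0) (h₂ : q₂ ≠ 0) (hu : u ≠ 0)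
    (S : ℕ →₀ ℕ) (N : ℕ) : ∏ c, zeroWt q₁ q₂ u S N c / poleWt q₁ q₂ u S N c = q₂ := by
  have hw := wt_ne h₁ h₂ hu
  have hq := mul_qThree h₁ h₂
  have h3 := qThree_ne h₁ h₂
  have e2 : ∀ s a : ℤ, wt q₁ q₂ u (s - 1) (a - 1) / wt q₁ q₂ u s a = q₂ := fun s a => by
    rw [← q₂_mul_wt h₁ h₂ u s a, mul_div_cancel_right₀ _ (hw _ _)]
  have e3 : ∀ s a : ℤ, wt q₁ q₂ u (s + 1) a / wt q₁ q₂ u s (a - 1) = q₂⁻¹ := fun s a => by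
    have e := q₁_mul_wt h₁ q₂ u s (a - 1)
    rw [sub_add_cancel] at e
    rw [← q₃_mul_wt h₁ h₂ u s a, ← e, ← mul_assoc, mul_div_cancel_right₀ _ (hw _ _)]
    exact eq_inv_of_mul_eq_one_left (by linear_combination hq)
  rw [Fintype.prod_prod_type, Fin.prod_univ_castSucc]
  simp only [Fintype.prod_bool, zeroWt, poleWt, Fin.val_castSucc, Fin.val_last, Fin.is_lt, if_true,
    lt_irrefl, if_false, Bool.false_eq_true, e2, e3]
  rw [div_self (hw _ _)]
  simp [h₂]

theorem psiBox_eq_poles {K : Type} [Field K] [Algebra ℂ K] {q₁ q₂ u : ℂ} {x : K}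
    (hx : ∀ s a, 1 - wt q₁ q₂ u s a • x ≠ 0) (S : ℕ →₀ ℕ) (N : ℕ)
    (hN : ∀ j, N ≤ j → S j = 0) :
    psiBox q₁ q₂ u S x =
      ∏ c, (1 - zeroWt q₁ q₂ u S N c • x) / (1 - poleWt q₁ q₂ u S N c • x) := by
  rw [psiBox_eq_rows hx S N hN, Fintype.prod_prod_type, Fin.prod_univ_castSucc, mul_comm,
    Finset.prod_range]
  simp only [Fintype.prod_bool, zeroWt, poleWt, Fin.val_castSucc, Fin.val_last, Fin.is_lt, if_true,
    lt_irrefl, if_false, Bool.false_eq_true]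
  -- The index (N, false) is a dummy whose zero and pole coincide; it gives zeros and poles the same
  -- index set.
  rw [div_self (hx _ _), mul_one, hN N le_rfl]
  congr 1
  · refine Finset.prod_congr rfl fun j _ => ?_
    rw [rowVal, mul_comm, ← div_mul_div_comm]

/-! ### Power series -/

section Series

open PowerSeries

/-- In the fraction field of power series no linear factor vanishes, so the field identities for
eigenvalues hold at x = X without exceptions and descend to power series by injectivity. -/
theorem one_sub_smul_algebraMap_X_ne (c : ℂ) :
    1 - c • algebraMap ℂ⟦X⟧ (FractionRing ℂ⟦X⟧) X ≠ 0 := by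
  have h := left_ne_zero_of_mul_eq_one (one_sub_smul_X_mul_mk c)
  intro h0
  apply h
  apply IsFractionRing.injective ℂ⟦X⟧ (FractionRing ℂ⟦X⟧)
  rw [map_zero, ← h0, map_sub, map_one, Algebra.smul_def, map_mul, Algebra.smul_def,
    ← IsScalarTower.algebraMap_apply]

theorem algebraMap_fractionRing_smul (c : ℂ) (f : ℂ⟦X⟧) :
    algebraMap ℂ⟦X⟧ (FractionRing ℂ⟦X⟧) (c • f) = c • algebraMap ℂ⟦X⟧ (FractionRing ℂ⟦X⟧) f := by
  rw [Algebra.smul_def, map_mul, Algebra.smul_def, ← IsScalarTower.algebraMap_apply]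

theorem algebraMap_fractionRing_inv (f : ℂ⟦X⟧) (hf : constantCoeff f ≠ 0) :
    algebraMap ℂ⟦X⟧ (FractionRing ℂ⟦X⟧) f⁻¹ = (algebraMap ℂ⟦X⟧ (FractionRing ℂ⟦X⟧) f)⁻¹ := by
  refine eq_inv_of_mul_eq_one_left ?_
  rw [← map_mul, PowerSeries.inv_mul_cancel f hf, map_one]

theorem constantCoeff_rowPsiPlus (q₁ q₂ u : ℂ) (l : FinPartition) (j : ℕ) :
    constantCoeff (rowPsiPlus q₁ q₂ u l j (X : ℂ⟦X⟧)) = 1 := by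
  simp [rowPsiPlus, vecPsiPlus, smul_eq_C_mul]

theorem algebraMap_rowPsiPlus (q₁ q₂ u : ℂ) (l : FinPartition) (j : ℕ) :
    algebraMap ℂ⟦X⟧ (FractionRing ℂ⟦X⟧) (rowPsiPlus q₁ q₂ u l j X) =
      rowPsiPlus q₁ q₂ u l j (algebraMap ℂ⟦X⟧ (FractionRing ℂ⟦X⟧) X) := by
  rw [rowPsiPlus, vecPsiPlus, map_mul, algebraMap_fractionRing_inv _ (by simp [smul_eq_C_mul])]
  simp only [map_mul, map_sub, map_one, algebraMap_fractionRing_smul]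
  rfl

theorem algebraMap_fockPsiPlus (q₁ q₂ u : ℂ) (l : FinPartition) :
    algebraMap ℂ⟦X⟧ (FractionRing ℂ⟦X⟧) (fockPsiPlus q₁ q₂ u l X) =
      fockPsiPlus q₁ q₂ u l (algebraMap ℂ⟦X⟧ (FractionRing ℂ⟦X⟧) X) := by
  rw [fockPsiPlus, map_mul, vacPsiPlus, map_mul,
    algebraMap_fractionRing_inv _ (by simp [smul_eq_C_mul])]
  -- Injectivity allows passing through the infinite product without first proving that its support
  -- is finite.
  have := MonoidHom.map_finprod_of_injective
    (algebraMap ℂ⟦X⟧ (FractionRing ℂ⟦X⟧) : ℂ⟦X⟧ →* FractionRing ℂ⟦X⟧)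
    (IsFractionRing.injective ℂ⟦X⟧ (FractionRing ℂ⟦X⟧))
    (fun j => rowPsiPlus q₁ q₂ u l j X * (rowPsiPlus q₁ q₂ u FinPartition.empty j X)⁻¹)
  simp only [MonoidHom.coe_coe] at this
  have hinv : ∀ j, algebraMap ℂ⟦X⟧ (FractionRing ℂ⟦X⟧)
      (rowPsiPlus q₁ q₂ u FinPartition.empty j X)⁻¹ = _ := fun j =>
    algebraMap_fractionRing_inv (rowPsiPlus q₁ q₂ u FinPartition.empty j X)
      (by rw [constantCoeff_rowPsiPlus]; exact one_ne_zero)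
  rw [this]
  simp only [map_mul, map_sub, map_one, algebraMap_fractionRing_smul, algebraMap_rowPsiPlus, hinv]
  rfl

theorem fockPsiPlus_X_mul_poles {q₁ q₂ : ℂ} (h₁ : q₁ ≠ 0) (h₂ : q₂ ≠ 0) (u : ℂ) (l : FinPartition)
    (N : ℕ) (hN : ∀ j, N ≤ j → l.1 j = 0) :
    fockPsiPlus q₁ q₂ u l (X : ℂ⟦X⟧) * ∏ c, (1 - poleWt q₁ q₂ u l.1 N c • X) =
      ∏ c, (1 - zeroWt q₁ q₂ u l.1 N c • X) := by
  apply IsFractionRing.injective ℂ⟦X⟧ (FractionRing ℂ⟦X⟧)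
  have hx := fun s a => one_sub_smul_algebraMap_X_ne (wt q₁ q₂ u s a)
  simp only [map_mul, map_prod, map_sub, map_one, algebraMap_fractionRing_smul,
    algebraMap_fockPsiPlus]
  rw [fockPsiPlus_eq_psiBox h₁ h₂ hx, psiBox_eq_poles hx l.1 N hN, Finset.prod_div_distrib,
    div_mul_cancel₀]
  exact Finset.prod_ne_zero_iff.mpr fun c _ => one_sub_smul_algebraMap_X_ne _

theorem fockPsiMinus_X_mul_poles {q₁ q₂ : ℂ} (h₁ : q₁ ≠ 0) (h₂ : q₂ ≠ 0) (u : ℂ)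
    (l : FinPartition) (N : ℕ) (hN : ∀ j, N ≤ j → l.1 j = 0) :
    fockPsiMinus q₁ q₂ u l (X : ℂ⟦X⟧) * ∏ c, (1 - (poleWt q₁ q₂ u l.1 N c)⁻¹ • X) =
      q₂ • ∏ c, (1 - (zeroWt q₁ q₂ u l.1 N c)⁻¹ • X) := by
  have := fockPsiPlus_X_mul_poles (inv_ne_zero h₁) (inv_ne_zero h₂) u⁻¹ l N hN
  simp only [poleWt_inv, zeroWt_inv] at this
  rw [fockPsiMinus_eq, smul_mul_assoc, this]

theorem fockPsiPlus_X_add {q₁ q₂ : ℂ} (h₁ : q₁ ≠ 0) (h₂ : q₂ ≠ 0) (u : ℂ) {l m : FinPartition}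
    {s : ℕ} (hm : m.1 = l.1 + Finsupp.single s 1) :
    boxDen q₁ q₂ u s (l.1 s) (X : ℂ⟦X⟧) * fockPsiPlus q₁ q₂ u m (X : ℂ⟦X⟧) =
      boxNum q₁ q₂ u s (l.1 s) (X : ℂ⟦X⟧) * fockPsiPlus q₁ q₂ u l (X : ℂ⟦X⟧) := by
  apply IsFractionRing.injective ℂ⟦X⟧ (FractionRing ℂ⟦X⟧)
  have hx := fun s a => one_sub_smul_algebraMap_X_ne (wt q₁ q₂ u s a)
  have hd := boxDen_ne hx s (l.1 s)
  have e1 : ∀ a, algebraMap ℂ⟦X⟧ (FractionRing ℂ⟦X⟧) (boxDen q₁ q₂ u s a X) =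
      boxDen q₁ q₂ u s a (algebraMap ℂ⟦X⟧ (FractionRing ℂ⟦X⟧) X) := fun a => by
    simp only [boxDen, map_mul, map_sub, map_one, algebraMap_fractionRing_smul]
  have e2 : ∀ a, algebraMap ℂ⟦X⟧ (FractionRing ℂ⟦X⟧) (boxNum q₁ q₂ u s a X) =
      boxNum q₁ q₂ u s a (algebraMap ℂ⟦X⟧ (FractionRing ℂ⟦X⟧) X) := fun a => by
    simp only [boxNum, map_mul, map_sub, map_one, algebraMap_fractionRing_smul]
  rw [map_mul, map_mul, e1, e2, algebraMap_fockPsiPlus, algebraMap_fockPsiPlus,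
    fockPsiPlus_eq_psiBox h₁ h₂ hx, fockPsiPlus_eq_psiBox h₁ h₂ hx, hm, psiBox_add]
  field_simp

/-- The coefficients of a power series, indexed by the integers. -/
def intCoeff (P : ℂ⟦X⟧) (k : ℤ) : ℂ := if 0 ≤ k then coeff k.toNat P else 0

theorem intCoeff_mul_X_pow (P : ℂ⟦X⟧) (t : ℕ) (k : ℤ) :
    intCoeff (P * X ^ t) k = intCoeff P (k - t) := by
  unfold intCoeff
  by_cases hk : 0 ≤ k
  · rw [if_pos hk, coeff_mul_X_pow']
    by_cases ht : (t : ℤ) ≤ k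
    · rw [if_pos (by omega), if_pos (by omega)]; congr 2; omega
    · rw [if_neg (by omega), if_neg (by omega)]
  · rw [if_neg hk, if_neg (by omega)]

theorem intCoeff_mul_sum (P : ℂ⟦X⟧) (α : Fin 4 → ℂ) (k : ℤ) :
    intCoeff ((∑ t : Fin 4, C (α t) * X ^ (t : ℕ)) * P) k =
      ∑ t : Fin 4, α t * intCoeff P (k - (t : ℕ)) := by
  simp only [← intCoeff_mul_X_pow, Finset.sum_mul, mul_assoc]
  unfold intCoeff
  split_ifs with h
  · rw [map_sum]
    refine Finset.sum_congr rfl fun t _ => ?_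
    rw [coeff_C_mul, mul_comm P]
  · simp

theorem boxDen_X {q₁ q₂ : ℂ} (h₁ : q₁ ≠ 0) (h₂ : q₂ ≠ 0) (u : ℂ) (s a : ℤ) :
    boxDen q₁ q₂ u s a (X : ℂ⟦X⟧) =
      ∑ t : Fin 4, C (gCoeff q₁ q₂ t * wt q₁ q₂ u s a ^ (t : ℕ)) * X ^ (t : ℕ) := by
  simp only [boxDen, ← q₁_mul_wt h₁ q₂, ← q₂_mul_wt h₁ h₂, ← q₃_mul_wt h₁ h₂, smul_eq_C_mul,
    Fin.sum_univ_four, gCoeff]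
  simp
  ring

/-- The numerator involves the weights p/q₁, p/q₂, p/q₃, hence the coefficients of g at inverse
parameters. -/
theorem boxNum_X {q₁ q₂ : ℂ} (h₁ : q₁ ≠ 0) (h₂ : q₂ ≠ 0) (u : ℂ) (s a : ℤ) :
    boxNum q₁ q₂ u s a (X : ℂ⟦X⟧) =
      ∑ t : Fin 4, C (gCoeff q₁⁻¹ q₂⁻¹ t * wt q₁ q₂ u s a ^ (t : ℕ)) * X ^ (t : ℕ) := by
  have e1 := q₁_mul_wt h₁ q₂ u s (a - 1)
  have e2 := q₂_mul_wt h₁ h₂ u (s + 1) (a + 1)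
  have e3 := q₃_mul_wt h₁ h₂ u (s - 1) a
  rw [sub_add_cancel] at e1 e3
  rw [add_sub_cancel_right, add_sub_cancel_right] at e2
  have e1' := (inv_mul_eq_iff_eq_mul₀ h₁).mpr e1.symm
  have e2' := (inv_mul_eq_iff_eq_mul₀ h₂).mpr e2.symm
  have e3' := (inv_mul_eq_iff_eq_mul₀ (qThree_ne h₁ h₂)).mpr e3.symm
  simp only [boxNum, ← e1', ← e2', ← e3', smul_eq_C_mul, Fin.sum_univ_four, gCoeff, qThree_inv]
  simp [-map_inv₀]
  ring

/-- `d` and `d'` are the coefficients of series related by adding a box of weight `p`. -/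
def BoxRel (q₁ q₂ p : ℂ) (d d' : ℤ → ℂ) : Prop :=
  ∀ k : ℤ, ∑ t : Fin 4, gCoeff q₁ q₂ t * p ^ (t : ℕ) * d' (k - (t : ℕ)) =
    ∑ t : Fin 4, gCoeff q₁⁻¹ q₂⁻¹ t * p ^ (t : ℕ) * d (k - (t : ℕ))

theorem boxRel_intCoeff {q₁ q₂ : ℂ} (h₁ : q₁ ≠ 0) (h₂ : q₂ ≠ 0) {u : ℂ} {s a : ℤ} {P P' : ℂ⟦X⟧}
    (h : boxDen q₁ q₂ u s a X * P' = boxNum q₁ q₂ u s a X * P) :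
    BoxRel q₁ q₂ (wt q₁ q₂ u s a) (intCoeff P) (intCoeff P') := by
  intro k
  rw [boxDen_X h₁ h₂, boxNum_X h₁ h₂] at h
  rw [← intCoeff_mul_sum, ← intCoeff_mul_sum, h]

/-- Reindexing k as 3 - k and reversing the coefficients of g turns the relation for expansions in z
at inverse parameters into the relation for expansions in 1/z; this is how ψ⁻ reduces to ψ⁺. -/
theorem BoxRel.neg {q₁ q₂ p : ℂ} (h₁ : q₁ ≠ 0) (h₂ : q₂ ≠ 0) (hp : p ≠ 0) {d d' : ℤ → ℂ}
    (h : BoxRel q₁⁻¹ q₂⁻¹ p⁻¹ d d') :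
    BoxRel q₁ q₂ p (fun k => d (-k)) (fun k => d' (-k)) := by
  intro k
  have := h (3 - k)
  rw [inv_inv, inv_inv] at this
  have g := gCoeff_inv h₁ h₂
  have g0 := g 0
  have g1 := g 1
  have g2 := g 2
  have g3 := g 3
  simp only [show (3 - 0 : Fin 4) = 3 from rfl, show (3 - 1 : Fin 4) = 2 from rfl,
    show (3 - 2 : Fin 4) = 1 from rfl, show (3 - 3 : Fin 4) = 0 from rfl] at g0 g1 g2 g3
  simp only [Fin.sum_univ_four, g0, g1, g2, g3] at this ⊢
  simp only [Fin.val_zero, Fin.val_one, Fin.val_two, show ((3 : Fin 4) : ℕ) = 3 from rfl,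
    Nat.cast_zero, Nat.cast_one, Nat.cast_ofNat, pow_zero, pow_one, sub_zero] at this ⊢
  simp only [show (3 : ℤ) - k - 1 = 2 - k by ring, show (3 : ℤ) - k - 2 = 1 - k by ring,
    show (3 : ℤ) - k - 3 = -k by ring] at this
  simp only [neg_sub]
  field_simp at this
  linear_combination -this

theorem BoxRel.sum_eq {q₁ q₂ p : ℂ} (h₁ : q₁ ≠ 0) (h₂ : q₂ ≠ 0) {d d' : ℤ → ℂ}
    (h : BoxRel q₁ q₂ p d d') (i : ℤ) :
    ∑ t : Fin 4, gCoeff q₁ q₂ t * p ^ (t : ℕ) * d' (i + 3 - (t : ℤ)) =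
      -∑ t : Fin 4, gCoeff q₁ q₂ t * p ^ (3 - (t : ℕ)) * d (i + (t : ℤ)) := by
  have := h (i + 3)
  have g := gCoeff_inv h₁ h₂
  have g0 := g 0
  have g1 := g 1
  have g2 := g 2
  have g3 := g 3
  simp only [show (3 - 0 : Fin 4) = 3 from rfl, show (3 - 1 : Fin 4) = 2 from rfl,
    show (3 - 2 : Fin 4) = 1 from rfl, show (3 - 3 : Fin 4) = 0 from rfl] at g0 g1 g2 g3
  simp only [Fin.sum_univ_four, g0, g1, g2, g3] at this ⊢
  simp only [Fin.val_zero, Fin.val_one, Fin.val_two, show ((3 : Fin 4) : ℕ) = 3 from rfl,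
    Nat.cast_zero, Nat.cast_one, Nat.cast_ofNat, pow_zero, pow_one, sub_zero, add_zero,
    Nat.sub_self] at this ⊢
  simp only [show i + 3 - 1 = i + 2 by ring, show i + 3 - 2 = i + 1 by ring,
    show i + 3 - 3 = i by ring] at this ⊢
  linear_combination this

/-- The relation is symmetric under exchanging the two series and inverting q₁, q₂: removing a box
is adding one at inverse parameters. This form serves the lowering operators. -/
theorem BoxRel.sum_eq_inv {q₁ q₂ p : ℂ} (h₁ : q₁ ≠ 0) (h₂ : q₂ ≠ 0) {d d' : ℤ → ℂ}
    (h : BoxRel q₁ q₂ p d d') (i : ℤ) :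
    ∑ t : Fin 4, gCoeff q₁⁻¹ q₂⁻¹ t * p ^ (t : ℕ) * d (i + 3 - (t : ℤ)) =
      -∑ t : Fin 4, gCoeff q₁⁻¹ q₂⁻¹ t * p ^ (3 - (t : ℕ)) * d' (i + (t : ℤ)) :=
  BoxRel.sum_eq (inv_ne_zero h₁) (inv_ne_zero h₂) (fun k => by rw [inv_inv, inv_inv, h k]) i

end Series

/-! ### Amplitudes for adding a box to a single sequence of rows -/

/-- The constant `⟨S + 𝟏ₛ|e|S⟩`, for an arbitrary sequence of rows. -/
def eAmp (q₁ q₂ u : ℂ) (S : ℕ →₀ ℕ) (s : ℕ) : ℂ :=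
  (1 - q₁)⁻¹ * ∏ j ∈ Finset.range s, rowVal q₁ q₂ u j (S j) (wt q₁ q₂ u s (S s))⁻¹

/-- The constant `⟨S|f|S + 𝟏ₛ⟩`, for an arbitrary sequence of rows. -/
def fAmp (q₁ q₂ u : ℂ) (S : ℕ →₀ ℕ) (s : ℕ) : ℂ :=
  q₁ * (1 - q₁)⁻¹ * vacVal q₁ q₂ u (s + 1) (wt q₁ q₂ u s (S s))⁻¹ *
    ∏ j ∈ S.support with s < j, rowVal q₁ q₂ u j (S j) (wt q₁ q₂ u s (S s))⁻¹ /
      rowVal q₁ q₂ u j 0 (wt q₁ q₂ u s (S s))⁻¹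

namespace GenericWt

variable {n : ℕ} {q₁ q₂ : ℂ} {u : Fin n → ℂ} (h : GenericWt q₁ q₂ u) (i : Fin n)

theorem one_sub_wt_row_ne (h : GenericWt q₁ q₂ u) {s t : ℤ} (hst : t ≠ s) (a b : ℤ) :
    1 - wt q₁ q₂ (u i) t b • (wt q₁ q₂ (u i) s a)⁻¹ ≠ 0 :=
  h.one_sub_wt_ne i i s a t b fun hh => hst hh.2.1

theorem rowVal_zero_ne (h : GenericWt q₁ q₂ u) {s j : ℕ} (hj : s < j) (a : ℕ) :
    rowVal q₁ q₂ (u i) j 0 (wt q₁ q₂ (u i) s a)⁻¹ ≠ 0 := by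
  refine div_ne_zero (mul_ne_zero (h.one_sub_wt_row_ne i (by omega) _ _)
    (h.one_sub_wt_ne i i _ _ _ _ ?_)) (mul_ne_zero (h.one_sub_wt_row_ne i (by omega) _ _)
    (h.one_sub_wt_row_ne i (by omega) _ _))
  -- The row j - 1 may be s itself, but then the columns -1 and a ≥ 0 differ.
  omega

theorem fAmp_eq_prod (h : GenericWt q₁ q₂ u) (S : ℕ →₀ ℕ) (s : ℕ) (T : Finset ℕ)
    (hT : ∀ j ∉ T, S j = 0) :
    fAmp q₁ q₂ (u i) S s = q₁ * (1 - q₁)⁻¹ * vacVal q₁ q₂ (u i) (s + 1) (wt q₁ q₂ (u i) s (S s))⁻¹ *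
    ∏ j ∈ T with s < j, rowVal q₁ q₂ (u i) j (S j) (wt q₁ q₂ (u i) s (S s))⁻¹ /
      rowVal q₁ q₂ (u i) j 0 (wt q₁ q₂ (u i) s (S s))⁻¹ := by
  rw [fAmp]
  congr 1
  refine Finset.prod_subset ?_ ?_
  · intro j hj
    simp only [Finset.mem_filter, Finsupp.mem_support_iff] at hj ⊢
    exact ⟨by_contra fun hn => hj.1 (hT j hn), hj.2⟩
  · intro j hj hj'
    simp only [Finset.mem_filter, Finsupp.mem_support_iff] at hj hj'
    have h0 : S j = 0 := by_contra fun hn => hj' ⟨hn, hj.2⟩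
    rw [h0, Nat.cast_zero, div_self (h.rowVal_zero_ne i hj.2 _)]

/-- In terms of the rows of index less than `N`, all others being empty. -/
theorem fAmp_eq_rows (h : GenericWt q₁ q₂ u) (S : ℕ →₀ ℕ) (s N : ℕ) (hN : ∀ j, N ≤ j → S j = 0)
    (hs : s < N) :
    fAmp q₁ q₂ (u i) S s = q₁ * (1 - q₁)⁻¹ * (vacVal q₁ q₂ (u i) N (wt q₁ q₂ (u i) s (S s))⁻¹ *
      ∏ j ∈ Finset.Ico (s + 1) N, rowVal q₁ q₂ (u i) j (S j) (wt q₁ q₂ (u i) s (S s))⁻¹) := by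
  rw [h.fAmp_eq_prod i S s (Finset.range N) (fun j hj => hN j (by simpa using hj))]
  have hf : (Finset.range N).filter (s < ·) = Finset.Ico (s + 1) N := by
    ext j; simp; omega
  rw [hf, Finset.prod_div_distrib]
  set x := (wt q₁ q₂ (u i) s (S s))⁻¹ with hx
  have hne : ∏ j ∈ Finset.Ico (s + 1) N, rowVal q₁ q₂ (u i) j 0 x ≠ 0 :=
    Finset.prod_ne_zero_iff.mpr fun j hj => h.rowVal_zero_ne i (by simp at hj; omega) _
  -- Telescoping of empty rows again, now only from s + 1 on, where the factors do not vanish at a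
  -- weight of row s.
  have hv : ∀ M : ℕ, s + 1 ≤ M → vacVal q₁ q₂ (u i) (s + 1) x =
      vacVal q₁ q₂ (u i) M x * ∏ j ∈ Finset.Ico (s + 1) M, rowVal q₁ q₂ (u i) j 0 x := by
    intro M hM
    induction M, hM using Nat.le_induction with
    | base => simp
    | succ M hM ih =>
      rw [ih, Finset.prod_Ico_succ_top hM]
      have a1 := h.one_sub_wt_row_ne i (s := s) (t := M + 1) (by omega) (S s) 0
      have a2 := h.one_sub_wt_row_ne i (s := s) (t := M) (by omega) (S s) 0
      have a3 := h.one_sub_wt_row_ne i (s := s) (t := M) (by omega) (S s) (-1)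
      rw [← hx] at a1 a2 a3
      simp only [vacVal, rowVal]
      push_cast
      simp only [add_sub_cancel_right]
      field_simp
  rw [hv N hs]
  field_simp

theorem eAmp_add_of_lt (q₁ q₂ u : ℂ) (S : ℕ →₀ ℕ) {s s' : ℕ} (hs : s < s') :
    eAmp q₁ q₂ u (S + Finsupp.single s' 1 : ℕ →₀ ℕ) s = eAmp q₁ q₂ u S s := by
  have e : ∀ j ≤ s, (S + Finsupp.single s' 1 : ℕ →₀ ℕ) j = S j := fun j hj => by
    rw [Finsupp.add_apply, Finsupp.single_eq_of_ne (by omega), add_zero]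
  rw [eAmp, eAmp, e s le_rfl]
  congr 1
  exact Finset.prod_congr rfl fun j hj => by rw [e j (by simp at hj; omega)]

theorem fAmp_add_of_lt (h : GenericWt q₁ q₂ u) (S : ℕ →₀ ℕ) {s s' : ℕ} (hs : s < s') :
    fAmp q₁ q₂ (u i) (S + Finsupp.single s 1 : ℕ →₀ ℕ) s' = fAmp q₁ q₂ (u i) S s' := by
  have e : ∀ j, s' ≤ j → (S + Finsupp.single s 1 : ℕ →₀ ℕ) j = S j := fun j hj => by
    rw [Finsupp.add_apply, Finsupp.single_eq_of_ne (by omega), add_zero]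
  rw [h.fAmp_eq_prod i (S + Finsupp.single s 1) s' (insert s S.support), h.fAmp_eq_prod i S s'
    (insert s S.support), e s' le_rfl]
  · congr 1
    exact Finset.prod_congr rfl fun j hj => by rw [e j (by simp at hj; omega)]
  · intro j hj; simp at hj; exact hj.2
  · intro j hj; simp at hj
    rw [Finsupp.add_apply, Finsupp.single_eq_of_ne hj.1, hj.2, add_zero]

/-- The earlier row s is one of the factors of the amplitude at s', so only the factor of the new
box changes. -/
theorem eAmp_add_mul (h : GenericWt q₁ q₂ u) (S : ℕ →₀ ℕ) {s s' : ℕ} (hs : s < s') :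
    boxDen q₁ q₂ (u i) s (S s) (wt q₁ q₂ (u i) s' (S s'))⁻¹ *
        eAmp q₁ q₂ (u i) (S + Finsupp.single s 1) s' =
      boxNum q₁ q₂ (u i) s (S s) (wt q₁ q₂ (u i) s' (S s'))⁻¹ * eAmp q₁ q₂ (u i) S s' := by
  have e : ∀ j, j ≠ s → (S + Finsupp.single s 1 : ℕ →₀ ℕ) j = S j := fun j hj => by
    rw [Finsupp.add_apply, Finsupp.single_eq_of_ne hj, add_zero]
  have e' : (S + Finsupp.single s 1 : ℕ →₀ ℕ) s = S s + 1 := by simp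
  have hmem : s ∈ Finset.range s' := by simpa using hs
  rw [eAmp, eAmp, e s' (by omega), ← Finset.mul_prod_erase _ _ hmem,
    ← Finset.mul_prod_erase _ (fun j : ℕ => rowVal q₁ q₂ (u i) j (S j) _) hmem, e',
    Finset.prod_congr rfl (fun j hj => by rw [e j (Finset.ne_of_mem_erase hj)])]
  have key := rowVal_succ_mul (K := ℂ) s (S s) (wt q₁ q₂ (u i) s' (S s'))⁻¹
    (h.one_sub_wt_row_ne i (by omega) _ _) (h.one_sub_wt_row_ne i (by omega) _ _)
    (h.one_sub_wt_row_ne i (by omega) _ _)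
  push_cast
  linear_combination ((1 - q₁)⁻¹ * ∏ j ∈ (Finset.range s').erase s,
    rowVal q₁ q₂ (u i) j (S j) (wt q₁ q₂ (u i) s' (S s'))⁻¹) * key

theorem fAmp_add_mul (h : GenericWt q₁ q₂ u) (S : ℕ →₀ ℕ) {s s' : ℕ} (hs : s < s') :
    boxDen q₁ q₂ (u i) s' (S s') (wt q₁ q₂ (u i) s (S s))⁻¹ *
        fAmp q₁ q₂ (u i) (S + Finsupp.single s' 1) s =
      boxNum q₁ q₂ (u i) s' (S s') (wt q₁ q₂ (u i) s (S s))⁻¹ * fAmp q₁ q₂ (u i) S s := by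
  have e : ∀ j, j ≠ s' → (S + Finsupp.single s' 1 : ℕ →₀ ℕ) j = S j := fun j hj => by
    rw [Finsupp.add_apply, Finsupp.single_eq_of_ne hj, add_zero]
  have e' : (S + Finsupp.single s' 1 : ℕ →₀ ℕ) s' = S s' + 1 := by simp
  have hmem : s' ∈ (insert s' S.support).filter (s < ·) := by simpa using hs
  rw [h.fAmp_eq_prod i (S + Finsupp.single s' 1) s (insert s' S.support), h.fAmp_eq_prod i S s
    (insert s' S.support), e s (by omega), ← Finset.mul_prod_erase _ _ hmem,
    ← Finset.mul_prod_erase _ (fun j : ℕ => rowVal q₁ q₂ (u i) j (S j) _ / _) hmem, e',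
    Finset.prod_congr rfl (fun j hj => by rw [e j (Finset.ne_of_mem_erase hj)])]
  · have key := rowVal_succ_mul (K := ℂ) s' (S s') (wt q₁ q₂ (u i) s (S s))⁻¹
      (h.one_sub_wt_row_ne i (by omega) _ _) (h.one_sub_wt_row_ne i (by omega) _ _)
      (h.one_sub_wt_row_ne i (by omega) _ _)
    push_cast
    generalize ∏ j ∈ ((insert s' S.support).filter (s < ·)).erase s', (_ : ℂ) = A
    linear_combination (q₁ * (1 - q₁)⁻¹ *
      vacVal q₁ q₂ (u i) (s + 1) (wt q₁ q₂ (u i) s (S s))⁻¹ * A *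
      (rowVal q₁ q₂ (u i) s' 0 (wt q₁ q₂ (u i) s (S s))⁻¹)⁻¹) * key
  · intro j hj; simp at hj; exact hj.2
  · intro j hj; simp at hj
    rw [Finsupp.add_apply, Finsupp.single_eq_of_ne hj.1, hj.2, add_zero]

/-- A row of the same length directly above contributes the zero wt(s+1, S s), which is the weight
of the box to be added. -/
theorem eAmp_eq_zero (h : GenericWt q₁ q₂ u) (S : ℕ →₀ ℕ) (s : ℕ) (hS : S s = S (s + 1)) :
    eAmp q₁ q₂ (u i) S (s + 1) = 0 := by
  rw [eAmp, Finset.prod_eq_zero (Finset.mem_range.mpr (Nat.lt_succ_self s)), mul_zero]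
  have := wt_ne h.q₁_ne h.q₂_ne (h.u_ne i) (s + 1) (S (s + 1))
  rw [rowVal, hS]
  push_cast
  rw [smul_eq_mul, mul_inv_cancel₀ this]
  simp

/-- The row below sticks out by one box and contributes the zero wt(s, S(s+1) - 1), which is the
weight of the box in question. -/
theorem fAmp_eq_zero (h : GenericWt q₁ q₂ u) (S : ℕ →₀ ℕ) (s : ℕ) (hS : S (s + 1) = S s + 1) :
    fAmp q₁ q₂ (u i) S s = 0 := by
  rw [fAmp, Finset.prod_eq_zero (i := s + 1), mul_zero]
  · simp; omega
  · have := wt_ne h.q₁_ne h.q₂_ne (h.u_ne i) s (S s)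
    rw [rowVal, rowVal, hS]
    push_cast
    rw [add_sub_cancel_right, add_sub_cancel_right, smul_eq_mul (wt q₁ q₂ (u i) s (S s)),
      mul_inv_cancel₀ this]
    simp

end GenericWt

/-- Together with `gPoly_wt'` this identifies `boxNum`/`boxDen` of a box of weight w, evaluated at
1/p, with -g(w,p)/g(p,w). -/
theorem gPoly_wt {q₁ q₂ u : ℂ} (h₁ : q₁ ≠ 0) (h₂ : q₂ ≠ 0) {p : ℂ} (hp : p ≠ 0)
    (s a : ℤ) : gPoly q₁ q₂ p (wt q₁ q₂ u s a) = p ^ 3 * boxDen q₁ q₂ u s a p⁻¹ := by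
  simp only [gPoly, boxDen, q₁_mul_wt h₁, q₂_mul_wt h₁ h₂, q₃_mul_wt h₁ h₂, smul_eq_mul]
  field_simp

theorem gPoly_wt' {q₁ q₂ u : ℂ} (h₁ : q₁ ≠ 0) (h₂ : q₂ ≠ 0) {p : ℂ} (hp : p ≠ 0)
    (s a : ℤ) : gPoly q₁ q₂ (wt q₁ q₂ u s a) p = -(p ^ 3 * boxNum q₁ q₂ u s a p⁻¹) := by
  have e1 := q₁_mul_wt h₁ q₂ u s (a - 1)
  have e2 := q₂_mul_wt h₁ h₂ u (s + 1) (a + 1)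
  have e3 := q₃_mul_wt h₁ h₂ u (s - 1) a
  rw [sub_add_cancel] at e1 e3
  rw [add_sub_cancel_right, add_sub_cancel_right] at e2
  simp only [gPoly, boxNum, smul_eq_mul]
  conv_lhs => congr; · congr; · rw [← e1]
                       · rw [← e2]
              · rw [← e3]
  have hq := mul_qThree h₁ h₂
  field_simp
  linear_combination ((wt q₁ q₂ u s (a - 1) - p) * (wt q₁ q₂ u (s + 1) (a + 1) - p) *
    (wt q₁ q₂ u (s - 1) a - p)) * hq

/-- By genericity g vanishes on two box weights only if the first box is the right neighbour of the
second, its upper left diagonal neighbour, or its lower neighbour. -/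
theorem GenericWt.gPoly_eq_zero {n : ℕ} {q₁ q₂ : ℂ} {u : Fin n → ℂ} (h : GenericWt q₁ q₂ u)
    {i k : Fin n} {s t a b : ℤ}
    (h0 : gPoly q₁ q₂ (wt q₁ q₂ (u i) s a) (wt q₁ q₂ (u k) t b) = 0) :
    i = k ∧ (s = t ∧ a = b + 1 ∨ s = t - 1 ∧ a = b - 1 ∨ s = t + 1 ∧ a = b) := by
  rw [gPoly, q₁_mul_wt h.q₁_ne, q₂_mul_wt h.q₁_ne h.q₂_ne, q₃_mul_wt h.q₁_ne h.q₂_ne, mul_eq_zero,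
    mul_eq_zero, sub_eq_zero, sub_eq_zero, sub_eq_zero] at h0
  rcases h0 with (h0 | h0) | h0 <;> obtain ⟨h1, h2, h3⟩ := h.inj _ _ _ _ _ _ h0 <;> simp_all

/-! ### Amplitudes for tuples -/

/-- A tuple of sequences of rows. -/
abbrev RowTuple (n : ℕ) : Type := Fin n → ℕ →₀ ℕ

/-- The tuple with a single row, of length `1`, at the position `d`. -/
def unitRow {n : ℕ} (d : Fin n × ℕ) : RowTuple n := Pi.single d.1 (Finsupp.single d.2 1)

theorem unitRow_apply {n : ℕ} (d : Fin n × ℕ) (k : Fin n) (j : ℕ) :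
    unitRow d k j = if k = d.1 ∧ j = d.2 then 1 else 0 := by
  unfold unitRow
  by_cases hk : k = d.1
  · subst hk
    rw [Pi.single_eq_same, Finsupp.single_apply]
    simp [eq_comm]
  · rw [Pi.single_eq_of_ne hk]; simp [hk]

theorem unitRow_self {n : ℕ} (d : Fin n × ℕ) : unitRow d d.1 = Finsupp.single d.2 1 :=
  Pi.single_eq_same _ _

theorem unitRow_of_ne {n : ℕ} (d : Fin n × ℕ) {k : Fin n} (hk : k ≠ d.1) : unitRow d k = 0 :=
  Pi.single_eq_of_ne hk _

/-- The rows of each sequence are weakly decreasing. -/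
def IsPartTuple {n : ℕ} (S : RowTuple n) : Prop := ∀ i j, S i (j + 1) ≤ S i j

/-- The lexicographic order on positions. -/
def PosLt {n : ℕ} (d d' : Fin n × ℕ) : Prop := d.1 < d'.1 ∨ d.1 = d'.1 ∧ d.2 < d'.2

theorem PosLt.ne {n : ℕ} {d d' : Fin n × ℕ} (h : PosLt d d') : d ≠ d' := by
  rintro rfl
  rcases h with h | h
  · exact lt_irrefl _ h
  · exact lt_irrefl _ h.2

theorem posLt_or {n : ℕ} {d d' : Fin n × ℕ} (h : d ≠ d') : PosLt d d' ∨ PosLt d' d := by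
  rcases lt_trichotomy d.1 d'.1 with h1 | h1 | h1
  · exact Or.inl (Or.inl h1)
  · rcases lt_trichotomy d.2 d'.2 with h2 | h2 | h2
    · exact Or.inl (Or.inr ⟨h1, h2⟩)
    · exact absurd (Prod.ext h1 h2) h
    · exact Or.inr (Or.inr ⟨h1.symm, h2⟩)
  · exact Or.inr (Or.inl h1)

theorem add_unitRow_apply_of_ne {n : ℕ} (S : RowTuple n) {d d' : Fin n × ℕ} (hd : d ≠ d') :
    (S + unitRow d') d.1 d.2 = S d.1 d.2 := by
  rw [Pi.add_apply, Finsupp.add_apply, unitRow_apply, if_neg, add_zero]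
  exact fun hh => hd (Prod.ext hh.1 hh.2)

section Tuples

variable {n : ℕ} (q₁ q₂ : ℂ) (u : Fin n → ℂ)

/-- The weight of the box to be added at the position `d`. -/
def posWt (S : RowTuple n) (d : Fin n × ℕ) : ℂ := wt q₁ q₂ (u d.1) d.2 (S d.1 d.2)

/-- The constant `⟨S + 𝟏_d|e|S⟩`. -/
def tupleE (S : RowTuple n) (d : Fin n × ℕ) : ℂ :=
  (∏ k ∈ Finset.Iio d.1, psiBox q₁ q₂ (u k) (S k) (posWt q₁ q₂ u S d)⁻¹) *
    eAmp q₁ q₂ (u d.1) (S d.1) d.2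

/-- The constant `⟨S|f|S + 𝟏_d⟩`. -/
def tupleF (S : RowTuple n) (d : Fin n × ℕ) : ℂ :=
  fAmp q₁ q₂ (u d.1) (S d.1) d.2 *
    ∏ k ∈ Finset.Ioi d.1, psiBox q₁ q₂ (u k) (S k) (posWt q₁ q₂ u S d)⁻¹

variable {q₁ q₂ u}

theorem posWt_add (S : RowTuple n) {d d' : Fin n × ℕ} (hd : d ≠ d') :
    posWt q₁ q₂ u (S + unitRow d') d = posWt q₁ q₂ u S d := by
  rw [posWt, posWt, add_unitRow_apply_of_ne S hd]

theorem GenericWt.posWt_ne (h : GenericWt q₁ q₂ u) (S : RowTuple n) (d : Fin n × ℕ) :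
    posWt q₁ q₂ u S d ≠ 0 := wt_ne h.q₁_ne h.q₂_ne (h.u_ne _) _ _

theorem add_unitRow_self (S : RowTuple n) (d : Fin n × ℕ) :
    (S + unitRow d) d.1 = S d.1 + Finsupp.single d.2 1 := by
  rw [Pi.add_apply, unitRow_self]

theorem add_unitRow_of_ne (S : RowTuple n) (d : Fin n × ℕ) {k : Fin n} (hk : k ≠ d.1) :
    (S + unitRow d) k = S k := by
  rw [Pi.add_apply, unitRow_of_ne d hk, add_zero]

/-- The e-amplitude at d involves only d itself and the positions preceding it. A tensor product of
Fock modules thus behaves like one long list of rows. -/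
theorem tupleE_add_of_posLt (S : RowTuple n) {d d' : Fin n × ℕ} (hd : PosLt d d') :
    tupleE q₁ q₂ u (S + unitRow d') d = tupleE q₁ q₂ u S d := by
  rw [tupleE, tupleE, posWt_add S hd.ne]
  congr 1
  · refine Finset.prod_congr rfl fun k hk => ?_
    rw [add_unitRow_of_ne]
    rintro rfl
    have := Finset.mem_Iio.mp hk
    rcases hd with hd | hd
    · exact lt_asymm hd this
    · exact absurd hd.1 this.ne'
  · by_cases hi : d.1 = d'.1
    · have hs : d.2 < d'.2 := by
        rcases hd with hd | hd
        · exact absurd hi hd.ne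
        · exact hd.2
      rw [Pi.add_apply, hi, unitRow_self, GenericWt.eAmp_add_of_lt _ _ _ _ hs]
    · rw [add_unitRow_of_ne S d' hi]

theorem GenericWt.tupleF_add_of_posLt (h : GenericWt q₁ q₂ u) (S : RowTuple n)
    {d d' : Fin n × ℕ} (hd : PosLt d d') :
    tupleF q₁ q₂ u (S + unitRow d) d' = tupleF q₁ q₂ u S d' := by
  rw [tupleF, tupleF, posWt_add S hd.ne.symm]
  congr 1
  · by_cases hi : d'.1 = d.1
    · have hs : d.2 < d'.2 := by
        rcases hd with hd | hd
        · exact absurd hi hd.ne'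
        · exact hd.2
      rw [Pi.add_apply, hi, unitRow_self, h.fAmp_add_of_lt _ _ hs]
    · rw [add_unitRow_of_ne S d hi]
  · refine Finset.prod_congr rfl fun k hk => ?_
    rw [add_unitRow_of_ne]
    rintro rfl
    have := Finset.mem_Ioi.mp hk
    rcases hd with hd | hd
    · exact lt_asymm hd this
    · exact absurd hd.1 this.ne'

theorem GenericWt.boxDen_mul_psiBox_add (h : GenericWt q₁ q₂ u) {i k : Fin n} (hik : k ≠ i)
    (S : ℕ →₀ ℕ) (s : ℕ) (t a : ℤ) :
    boxDen q₁ q₂ (u k) s (S s) (wt q₁ q₂ (u i) t a)⁻¹ *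
        psiBox q₁ q₂ (u k) (S + Finsupp.single s 1) (wt q₁ q₂ (u i) t a)⁻¹ =
      boxNum q₁ q₂ (u k) s (S s) (wt q₁ q₂ (u i) t a)⁻¹ *
        psiBox q₁ q₂ (u k) S (wt q₁ q₂ (u i) t a)⁻¹ := by
  rw [psiBox_add]
  have := boxDen_ne (K := ℂ) (fun t' b => h.one_sub_wt_ne i k t a t' b fun hh => hik hh.1) s (S s)
  generalize (wt q₁ q₂ (u i) t a)⁻¹ = x at this ⊢
  field_simp

/-- An earlier position enters the amplitude at d' through a single factor: the eigenvalue of an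
earlier component, or an earlier row of the same component. In both cases the new box multiplies it
by -g(p_d,p_d')/g(p_d',p_d). -/
theorem GenericWt.tupleE_add_mul (h : GenericWt q₁ q₂ u) (S : RowTuple n) {d d' : Fin n × ℕ}
    (hd : PosLt d d') :
    gPoly q₁ q₂ (posWt q₁ q₂ u S d') (posWt q₁ q₂ u S d) * tupleE q₁ q₂ u (S + unitRow d) d' =
      -(gPoly q₁ q₂ (posWt q₁ q₂ u S d) (posWt q₁ q₂ u S d') * tupleE q₁ q₂ u S d') := by
  have hp := h.posWt_ne S d'
  rw [posWt.eq_1 q₁ q₂ u S d, gPoly_wt h.q₁_ne h.q₂_ne hp, gPoly_wt' h.q₁_ne h.q₂_ne hp, tupleE,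
    tupleE, posWt_add S hd.ne.symm]
  rcases hd with hd | ⟨hd, hs⟩
  · have hmem : d.1 ∈ Finset.Iio d'.1 := Finset.mem_Iio.mpr hd
    have key := h.boxDen_mul_psiBox_add hd.ne (S d.1) d.2 d'.2 (S d'.1 d'.2)
    rw [← posWt.eq_1 q₁ q₂ u S d'] at key
    rw [add_unitRow_of_ne S d hd.ne', ← Finset.mul_prod_erase _ _ hmem,
      ← Finset.mul_prod_erase _ (fun k => psiBox q₁ q₂ (u k) (S k) _) hmem, add_unitRow_self,
      Finset.prod_congr rfl (fun k hk => by
        rw [add_unitRow_of_ne S d (Finset.ne_of_mem_erase hk)])]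
    generalize ∏ k ∈ (Finset.Iio d'.1).erase d.1, (_ : ℂ) = A
    linear_combination (posWt q₁ q₂ u S d' ^ 3 * A * eAmp q₁ q₂ (u d'.1) (S d'.1) d'.2) * key
  · have key := h.eAmp_add_mul d'.1 (S d'.1) hs
    rw [← posWt.eq_1 q₁ q₂ u S d'] at key
    rw [Finset.prod_congr rfl (fun k hk => by
      rw [add_unitRow_of_ne S d ((Finset.mem_Iio.mp hk).trans_eq hd.symm).ne])]
    rw [hd, Pi.add_apply, ← hd, unitRow_self, hd]
    generalize ∏ k ∈ Finset.Iio d'.1, (_ : ℂ) = A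
    linear_combination (posWt q₁ q₂ u S d' ^ 3 * A) * key

theorem GenericWt.tupleF_add_mul (h : GenericWt q₁ q₂ u) (S : RowTuple n) {d d' : Fin n × ℕ}
    (hd : PosLt d d') :
    gPoly q₁ q₂ (posWt q₁ q₂ u S d) (posWt q₁ q₂ u S d') * tupleF q₁ q₂ u (S + unitRow d') d =
      -(gPoly q₁ q₂ (posWt q₁ q₂ u S d') (posWt q₁ q₂ u S d) * tupleF q₁ q₂ u S d) := by
  have hp := h.posWt_ne S d
  rw [posWt.eq_1 q₁ q₂ u S d', gPoly_wt h.q₁_ne h.q₂_ne hp, gPoly_wt' h.q₁_ne h.q₂_ne hp, tupleF,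
    tupleF, posWt_add S hd.ne]
  rcases hd with hd | ⟨hd, hs⟩
  · have hmem : d'.1 ∈ Finset.Ioi d.1 := Finset.mem_Ioi.mpr hd
    have key := h.boxDen_mul_psiBox_add hd.ne' (S d'.1) d'.2 d.2 (S d.1 d.2)
    rw [← posWt.eq_1 q₁ q₂ u S d] at key
    rw [add_unitRow_of_ne S d' hd.ne, ← Finset.mul_prod_erase _ _ hmem,
      ← Finset.mul_prod_erase _ (fun k => psiBox q₁ q₂ (u k) (S k) _) hmem, add_unitRow_self,
      Finset.prod_congr rfl (fun k hk => by
        rw [add_unitRow_of_ne S d' (Finset.ne_of_mem_erase hk)])]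
    generalize ∏ k ∈ (Finset.Ioi d.1).erase d'.1, (_ : ℂ) = A
    linear_combination (posWt q₁ q₂ u S d ^ 3 * A * fAmp q₁ q₂ (u d.1) (S d.1) d.2) * key
  · have key := h.fAmp_add_mul d.1 (S d.1) hs
    rw [← posWt.eq_1 q₁ q₂ u S d] at key
    rw [Finset.prod_congr rfl (fun k hk => by
      rw [add_unitRow_of_ne S d' (hd.symm.trans_lt (Finset.mem_Ioi.mp hk)).ne'])]
    rw [← hd, Pi.add_apply, hd, unitRow_self, ← hd]
    generalize ∏ k ∈ Finset.Ioi d.1, (_ : ℂ) = A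
    linear_combination (posWt q₁ q₂ u S d ^ 3 * A) * key

theorem GenericWt.tupleE_exchange (h : GenericWt q₁ q₂ u) (S : RowTuple n) {d d' : Fin n × ℕ}
    (hd : d ≠ d') :
    gPoly q₁ q₂ (posWt q₁ q₂ u S d') (posWt q₁ q₂ u S d) *
        (tupleE q₁ q₂ u S d * tupleE q₁ q₂ u (S + unitRow d) d') =
      -(gPoly q₁ q₂ (posWt q₁ q₂ u S d) (posWt q₁ q₂ u S d') *
        (tupleE q₁ q₂ u S d' * tupleE q₁ q₂ u (S + unitRow d') d)) := by
  rcases posLt_or hd with hd | hd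
  · rw [tupleE_add_of_posLt S hd]
    linear_combination tupleE q₁ q₂ u S d * h.tupleE_add_mul S hd
  · rw [tupleE_add_of_posLt S hd]
    linear_combination tupleE q₁ q₂ u S d' * h.tupleE_add_mul S hd

theorem GenericWt.tupleF_exchange (h : GenericWt q₁ q₂ u) (S : RowTuple n) {d d' : Fin n × ℕ}
    (hd : d ≠ d') :
    gPoly q₁ q₂ (posWt q₁ q₂ u S d') (posWt q₁ q₂ u S d) *
        (tupleF q₁ q₂ u S d * tupleF q₁ q₂ u (S + unitRow d) d') =
      -(gPoly q₁ q₂ (posWt q₁ q₂ u S d) (posWt q₁ q₂ u S d') *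
        (tupleF q₁ q₂ u S d' * tupleF q₁ q₂ u (S + unitRow d') d)) := by
  rcases posLt_or hd with hd | hd
  · rw [h.tupleF_add_of_posLt S hd]
    linear_combination tupleF q₁ q₂ u S d' * h.tupleF_add_mul S hd
  · rw [h.tupleF_add_of_posLt S hd]
    linear_combination tupleF q₁ q₂ u S d * h.tupleF_add_mul S hd

/-- If d precedes d', neither amplitude changes; otherwise the two change by reciprocal factors. -/
theorem GenericWt.tupleE_mul_tupleF (h : GenericWt q₁ q₂ u) (S : RowTuple n) {d d' : Fin n × ℕ}
    (hd : d ≠ d') (hg : gPoly q₁ q₂ (posWt q₁ q₂ u S d) (posWt q₁ q₂ u S d') ≠ 0)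
    (hg' : gPoly q₁ q₂ (posWt q₁ q₂ u S d') (posWt q₁ q₂ u S d) ≠ 0) :
    tupleE q₁ q₂ u (S + unitRow d') d * tupleF q₁ q₂ u (S + unitRow d) d' =
      tupleE q₁ q₂ u S d * tupleF q₁ q₂ u S d' := by
  rcases posLt_or hd with hd | hd
  · rw [h.tupleF_add_of_posLt S hd, tupleE_add_of_posLt S hd]
  · refine mul_left_cancel₀ (mul_ne_zero hg hg') ?_
    have e1 := h.tupleE_add_mul S hd
    have e2 := h.tupleF_add_mul S hd
    linear_combination (gPoly q₁ q₂ (posWt q₁ q₂ u S d') (posWt q₁ q₂ u S d) *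
      tupleF q₁ q₂ u (S + unitRow d) d') * e1 -
      (gPoly q₁ q₂ (posWt q₁ q₂ u S d') (posWt q₁ q₂ u S d) * tupleE q₁ q₂ u S d) * e2

/-- Monotonicity can fail only between the enlarged row and the row above it, which must have had
equal lengths. -/
theorem GenericWt.tupleE_eq_zero (h : GenericWt q₁ q₂ u) {S : RowTuple n} {d : Fin n × ℕ}
    (hS : IsPartTuple S) (hS' : ¬IsPartTuple (S + unitRow d)) : tupleE q₁ q₂ u S d = 0 := by
  rw [tupleE]
  simp only [IsPartTuple, not_forall, Pi.add_apply, Finsupp.add_apply, unitRow_apply] at hS'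
  obtain ⟨i, j, hij⟩ := hS'
  have h1 := hS i j
  have h2 : i = d.1 ∧ j + 1 = d.2 := by
    by_contra hn
    rw [if_neg hn] at hij
    omega
  obtain ⟨rfl, h2⟩ := h2
  rw [if_pos ⟨rfl, h2⟩, if_neg (by omega)] at hij
  rw [← h2, h.eAmp_eq_zero d.1 (S d.1) j (by omega), mul_zero]

theorem GenericWt.tupleF_eq_zero (h : GenericWt q₁ q₂ u) {S : RowTuple n} {d : Fin n × ℕ}
    (hS : ¬IsPartTuple S) (hS' : IsPartTuple (S + unitRow d)) : tupleF q₁ q₂ u S d = 0 := by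
  rw [tupleF]
  simp only [IsPartTuple, not_forall] at hS
  obtain ⟨i, j, hij⟩ := hS
  have h1 := hS' i j
  simp only [Pi.add_apply, Finsupp.add_apply, unitRow_apply] at h1
  have h2 : i = d.1 ∧ j = d.2 := by
    by_contra hn
    rw [if_neg hn] at h1
    omega
  obtain ⟨rfl, rfl⟩ := h2
  rw [if_neg (by omega), if_pos ⟨rfl, rfl⟩] at h1
  rw [h.fAmp_eq_zero d.1 (S d.1) d.2 (by omega), zero_mul]

end Tuples

/-! ### Coefficients of the raising and lowering operators -/

section Coefficients

variable {n : ℕ} (q₁ q₂ : ℂ) (u : Fin n → ℂ)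

/-- The weight of the box in column `b.2` at the position `b.1`. -/
def boxWt (b : (Fin n × ℕ) × ℕ) : ℂ := wt q₁ q₂ (u b.1.1) b.1.2 b.2

open Classical in
/-- The coefficient of `e` for adding the box `b` to `S`. -/
def upCoeff (S : RowTuple n) (b : (Fin n × ℕ) × ℕ) : ℂ :=
  if IsPartTuple S ∧ IsPartTuple (S + unitRow b.1) ∧ S b.1.1 b.1.2 = b.2 then
    tupleE q₁ q₂ u S b.1 else 0

open Classical in
/-- The coefficient of `f` for removing the box `b` from `S`. -/
def downCoeff (S : RowTuple n) (b : (Fin n × ℕ) × ℕ) : ℂ :=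
  if IsPartTuple S ∧ IsPartTuple (S - unitRow b.1) ∧ S b.1.1 b.1.2 = b.2 + 1 then
    tupleF q₁ q₂ u (S - unitRow b.1) b.1 else 0

variable {q₁ q₂ u}

theorem upCoeff_ne {S : RowTuple n} {b : (Fin n × ℕ) × ℕ} (hb : upCoeff q₁ q₂ u S b ≠ 0) :
    IsPartTuple S ∧ IsPartTuple (S + unitRow b.1) ∧ S b.1.1 b.1.2 = b.2 := by
  by_contra h
  exact hb (if_neg h)

theorem downCoeff_ne {S : RowTuple n} {b : (Fin n × ℕ) × ℕ} (hb : downCoeff q₁ q₂ u S b ≠ 0) :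
    IsPartTuple S ∧ IsPartTuple (S - unitRow b.1) ∧ S b.1.1 b.1.2 = b.2 + 1 := by
  by_contra h
  exact hb (if_neg h)

theorem sub_unitRow_apply (S : RowTuple n) (d : Fin n × ℕ) (k : Fin n) (j : ℕ) :
    (S - unitRow d) k j = S k j - if k = d.1 ∧ j = d.2 then 1 else 0 := by
  rw [Pi.sub_apply, Finsupp.tsub_apply, unitRow_apply]

theorem add_unitRow_apply (S : RowTuple n) (d : Fin n × ℕ) (k : Fin n) (j : ℕ) :
    (S + unitRow d) k j = S k j + if k = d.1 ∧ j = d.2 then 1 else 0 := by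
  rw [Pi.add_apply, Finsupp.add_apply, unitRow_apply]

theorem add_sub_unitRow (S : RowTuple n) (d : Fin n × ℕ) : S + unitRow d - unitRow d = S :=
  add_tsub_cancel_right S (unitRow d)

theorem sub_add_unitRow {S : RowTuple n} {d : Fin n × ℕ} (h : S d.1 d.2 ≠ 0) :
    S - unitRow d + unitRow d = S := by
  ext k j
  rw [add_unitRow_apply, sub_unitRow_apply]
  split_ifs with hk
  · obtain ⟨rfl, rfl⟩ := hk; omega
  · omega

theorem GenericWt.boxWt_ne (h : GenericWt q₁ q₂ u) (b : (Fin n × ℕ) × ℕ) :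
    boxWt q₁ q₂ u b ≠ 0 := wt_ne h.q₁_ne h.q₂_ne (h.u_ne _) _ _

theorem gPoly_boxWt_succ {q₁ q₂ : ℂ} (hq₁ : q₁ ≠ 0) {u : Fin n → ℂ} (d : Fin n × ℕ) (a : ℕ) :
    gPoly q₁ q₂ (boxWt q₁ q₂ u (d, a + 1)) (boxWt q₁ q₂ u (d, a)) = 0 := by
  rw [gPoly, boxWt, boxWt, q₁_mul_wt hq₁]
  simp

/-- The exchange rule for amplitudes survives the restriction to partitions because amplitudes of
forbidden steps vanish. -/
theorem GenericWt.upCoeff_exchange (h : GenericWt q₁ q₂ u) (S : RowTuple n)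
    (x y : (Fin n × ℕ) × ℕ) :
    gPoly q₁ q₂ (boxWt q₁ q₂ u y) (boxWt q₁ q₂ u x) *
        (upCoeff q₁ q₂ u S x * upCoeff q₁ q₂ u (S + unitRow x.1) y) =
      -(gPoly q₁ q₂ (boxWt q₁ q₂ u x) (boxWt q₁ q₂ u y) *
        (upCoeff q₁ q₂ u S y * upCoeff q₁ q₂ u (S + unitRow y.1) x)) := by
  obtain ⟨d, a⟩ := x
  obtain ⟨d', a'⟩ := y
  by_cases hd : d = d'
  · subst hd
    -- Two boxes added to one row are neighbours, and g(q₁p, p) = 0 kills each side separately.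
    have key : ∀ a a' : ℕ, gPoly q₁ q₂ (boxWt q₁ q₂ u (d, a')) (boxWt q₁ q₂ u (d, a)) *
        (upCoeff q₁ q₂ u S (d, a) * upCoeff q₁ q₂ u (S + unitRow d) (d, a')) = 0 := by
      intro a a'
      by_contra hne
      have h1 := (upCoeff_ne (left_ne_zero_of_mul (right_ne_zero_of_mul hne))).2.2
      have h2 := (upCoeff_ne (right_ne_zero_of_mul (right_ne_zero_of_mul hne))).2.2
      simp only [add_unitRow_apply, and_self, if_true] at h1 h2
      obtain rfl : a' = a + 1 := by omega
      exact left_ne_zero_of_mul hne (gPoly_boxWt_succ h.q₁_ne d a)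
    rw [key, key, neg_zero]
  have hd' : d' ≠ d := Ne.symm hd
  by_cases hS : IsPartTuple S ∧ S d.1 d.2 = a ∧ S d'.1 d'.2 = a'
  · obtain ⟨hS, rfl, rfl⟩ := hS
    -- The product depends only on whether the end point is a tuple of partitions: if only the
    -- intermediate tuple is not, the first amplitude is zero.
    have key : ∀ d d' : Fin n × ℕ, d ≠ d' → upCoeff q₁ q₂ u S (d, S d.1 d.2) *
        upCoeff q₁ q₂ u (S + unitRow d) (d', S d'.1 d'.2) =
        open Classical in if IsPartTuple (S + unitRow d + unitRow d') then
          tupleE q₁ q₂ u S d * tupleE q₁ q₂ u (S + unitRow d) d' else 0 := by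
      intro d d' hd
      have e := add_unitRow_apply_of_ne S hd.symm
      by_cases h2 : IsPartTuple (S + unitRow d + unitRow d')
      · by_cases h1 : IsPartTuple (S + unitRow d)
        · rw [upCoeff, upCoeff, if_pos ⟨hS, h1, rfl⟩, if_pos ⟨h1, h2, e⟩, if_pos h2]
        · simp [upCoeff, h1, h.tupleE_eq_zero hS h1]
      · simp [upCoeff, h2]
    rw [key d d' hd, key d' d hd', add_right_comm S (unitRow d')]
    split_ifs with h2
    · exact h.tupleE_exchange S hd
    · simp
  · have key : ∀ (d d' : Fin n × ℕ) (a a' : ℕ), d ≠ d' →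
        ¬(IsPartTuple S ∧ S d.1 d.2 = a ∧ S d'.1 d'.2 = a') →
        upCoeff q₁ q₂ u S (d, a) * upCoeff q₁ q₂ u (S + unitRow d) (d', a') = 0 := by
      intro d d' a a' hd hS
      by_contra hne
      have h1 := upCoeff_ne (left_ne_zero_of_mul hne)
      have h2 := (upCoeff_ne (right_ne_zero_of_mul hne)).2.2
      rw [add_unitRow_apply_of_ne S hd.symm] at h2
      exact hS ⟨h1.1, h1.2.2, h2⟩
    rw [key d d' a a' hd hS, key d' d a' a hd' (by tauto)]
    simp

theorem GenericWt.downCoeff_exchange (h : GenericWt q₁ q₂ u) (S : RowTuple n)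
    (x y : (Fin n × ℕ) × ℕ) :
    gPoly q₁ q₂ (boxWt q₁ q₂ u x) (boxWt q₁ q₂ u y) *
        (downCoeff q₁ q₂ u S x * downCoeff q₁ q₂ u (S - unitRow x.1) y) =
      -(gPoly q₁ q₂ (boxWt q₁ q₂ u y) (boxWt q₁ q₂ u x) *
        (downCoeff q₁ q₂ u S y * downCoeff q₁ q₂ u (S - unitRow y.1) x)) := by
  obtain ⟨d, a⟩ := x
  obtain ⟨d', a'⟩ := y
  by_cases hd : d = d'
  · subst hd
    have key : ∀ a a' : ℕ, gPoly q₁ q₂ (boxWt q₁ q₂ u (d, a)) (boxWt q₁ q₂ u (d, a')) *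
        (downCoeff q₁ q₂ u S (d, a) * downCoeff q₁ q₂ u (S - unitRow d) (d, a')) = 0 := by
      intro a a'
      by_contra hne
      have h1 := (downCoeff_ne (left_ne_zero_of_mul (right_ne_zero_of_mul hne))).2.2
      have h2 := (downCoeff_ne (right_ne_zero_of_mul (right_ne_zero_of_mul hne))).2.2
      simp only [sub_unitRow_apply, and_self, if_true] at h1 h2
      obtain rfl : a = a' + 1 := by omega
      exact left_ne_zero_of_mul hne (gPoly_boxWt_succ h.q₁_ne d a')
    rw [key, key, neg_zero]
  have hd' : d' ≠ d := Ne.symm hd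
  have sub_of_ne : ∀ d d' : Fin n × ℕ, d ≠ d' → (S - unitRow d) d'.1 d'.2 = S d'.1 d'.2 := by
    intro d d' hd
    rw [sub_unitRow_apply, if_neg, Nat.sub_zero]
    exact fun hh => hd (Prod.ext hh.1.symm hh.2.symm)
  by_cases hS : IsPartTuple S ∧ S d.1 d.2 = a + 1 ∧ S d'.1 d'.2 = a' + 1
  · obtain ⟨hS, ha, ha'⟩ := hS
    have key : ∀ (d d' : Fin n × ℕ) (a a' : ℕ), d ≠ d' → S d.1 d.2 = a + 1 →
        S d'.1 d'.2 = a' + 1 → downCoeff q₁ q₂ u S (d, a) *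
        downCoeff q₁ q₂ u (S - unitRow d) (d', a') =
        open Classical in if IsPartTuple (S - unitRow d - unitRow d') then
          tupleF q₁ q₂ u (S - unitRow d) d * tupleF q₁ q₂ u (S - unitRow d - unitRow d') d'
          else 0 := by
      intro d d' a a' hd ha ha'
      have e := sub_of_ne d d' hd
      by_cases h2 : IsPartTuple (S - unitRow d - unitRow d')
      · by_cases h1 : IsPartTuple (S - unitRow d)
        · rw [downCoeff, downCoeff, if_pos ⟨hS, h1, ha⟩, if_pos ⟨h1, h2, e.trans ha'⟩, if_pos h2]
        · have := h.tupleF_eq_zero h1 (d := d) (by rwa [sub_add_unitRow (by omega)])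
          simp [downCoeff, h1, this]
      · simp [downCoeff, h2]
    rw [key d d' a a' hd ha ha', key d' d a' a hd' ha' ha, tsub_right_comm (a := S) (b := unitRow d')]
    split_ifs with h2
    -- Amplitudes of f are attached to the smaller tuple, so the exchange rule is applied at the
    -- common lower end S₀.
    · set S₀ := S - unitRow d - unitRow d' with hS₀
      have e1 : S - unitRow d = S₀ + unitRow d' := by
        rw [hS₀, sub_add_unitRow]; rw [sub_of_ne d d' hd]; omega
      have e2 : S - unitRow d' = S₀ + unitRow d := by
        rw [hS₀, tsub_right_comm, sub_add_unitRow]; rw [sub_of_ne d' d hd']; omega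
      have w1 : boxWt q₁ q₂ u (d, a) = posWt q₁ q₂ u S₀ d := by
        have : S₀ d.1 d.2 = a := by
          rw [hS₀, tsub_right_comm, sub_unitRow_apply, sub_of_ne d' d hd', ha]; simp
        rw [boxWt, posWt, this]
      have w2 : boxWt q₁ q₂ u (d', a') = posWt q₁ q₂ u S₀ d' := by
        have : S₀ d'.1 d'.2 = a' := by
          rw [hS₀, sub_unitRow_apply, sub_of_ne d d' hd, ha']; simp
        rw [boxWt, posWt, this]
      rw [e1, e2, w1, w2]
      linear_combination h.tupleF_exchange S₀ hd
    · simp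
  · have key : ∀ (d d' : Fin n × ℕ) (a a' : ℕ), d ≠ d' →
        ¬(IsPartTuple S ∧ S d.1 d.2 = a + 1 ∧ S d'.1 d'.2 = a' + 1) →
        downCoeff q₁ q₂ u S (d, a) * downCoeff q₁ q₂ u (S - unitRow d) (d', a') = 0 := by
      intro d d' a a' hd hS
      by_contra hne
      have h1 := downCoeff_ne (left_ne_zero_of_mul hne)
      have h2 := (downCoeff_ne (right_ne_zero_of_mul hne)).2.2
      rw [sub_of_ne d d' hd] at h2
      exact hS ⟨h1.1, h1.2.2, h2⟩
    rw [key d d' a a' hd hS, key d' d a' a hd' (by tauto)]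
    simp

/-! ### Nonvanishing along paths -/

/-- A zero of g would force the second box to be the left or upper neighbour of the first, hence
already present, or its lower right diagonal neighbour, which cannot be added immediately
afterwards. -/
theorem GenericWt.gPoly_path_two (h : GenericWt q₁ q₂ u) {S : RowTuple n} {d d' : Fin n × ℕ}
    (hS : IsPartTuple S) (hS' : IsPartTuple (S + unitRow d)) :
    gPoly q₁ q₂ (posWt q₁ q₂ u S d) (posWt q₁ q₂ u (S + unitRow d) d') ≠ 0 := by
  obtain ⟨i, s⟩ := d
  obtain ⟨k, t⟩ := d'
  intro h0
  obtain ⟨h1, h2⟩ := h.gPoly_eq_zero h0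
  dsimp only at h1 h2
  subst h1
  have v1 := hS i s
  have v2 := hS' i t
  simp only [add_unitRow_apply, true_and] at h2 v2
  rcases h2 with ⟨h2, h3⟩ | ⟨h2, h3⟩ | ⟨h2, h3⟩
  · obtain rfl : s = t := by omega
    rw [if_pos rfl] at h3; push_cast at h3; omega
  · obtain rfl : t = s + 1 := by omega
    rw [if_neg (by omega)] at h3; push_cast at h3; omega
  · obtain rfl : s = t + 1 := by omega
    simp at h3 v2; omega

/-- Before the lower right diagonal neighbour of a new box can be added, both the box to its right
and the box below it are needed, and one intermediate step supplies only one of them. -/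
theorem GenericWt.gPoly_path_three (h : GenericWt q₁ q₂ u) {S : RowTuple n}
    {d d' d'' : Fin n × ℕ} (hS : IsPartTuple S) (hS' : IsPartTuple (S + unitRow d))
    (hS'' : IsPartTuple (S + unitRow d + unitRow d'))
    (hS''' : IsPartTuple (S + unitRow d + unitRow d' + unitRow d'')) :
    gPoly q₁ q₂ (posWt q₁ q₂ u S d) (posWt q₁ q₂ u (S + unitRow d + unitRow d') d'') ≠ 0 := by
  obtain ⟨i, s⟩ := d
  obtain ⟨k, t⟩ := d''
  obtain ⟨j, r⟩ := d'
  intro h0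
  obtain ⟨h1, h2⟩ := h.gPoly_eq_zero h0
  dsimp only at h1 h2
  subst h1
  have v1 := hS i s
  have v2 := hS' i t
  have v3 := hS''' i s
  simp only [add_unitRow_apply, true_and] at h2 v2 v3
  rcases h2 with ⟨h2, h3⟩ | ⟨h2, h3⟩ | ⟨h2, h3⟩
  · obtain rfl : s = t := by omega
    rw [if_pos rfl] at h3; push_cast at h3; split_ifs at h3 <;> omega
  · obtain rfl : t = s + 1 := by omega
    simp at h3 v3
    split_ifs at h3 v3 <;> omega
  · obtain rfl : s = t + 1 := by omega
    simp at v2 v3 h3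
    split_ifs at h3 v3 <;> omega

theorem GenericWt.upCoeff_path (h : GenericWt q₁ q₂ u) (S : RowTuple n)
    (x y z : (Fin n × ℕ) × ℕ) (hx : upCoeff q₁ q₂ u S x ≠ 0)
    (hy : upCoeff q₁ q₂ u (S + unitRow x.1) y ≠ 0)
    (hz : upCoeff q₁ q₂ u (S + unitRow x.1 + unitRow y.1) z ≠ 0) :
    gPoly q₁ q₂ (boxWt q₁ q₂ u x) (boxWt q₁ q₂ u y) ≠ 0 ∧
      gPoly q₁ q₂ (boxWt q₁ q₂ u x) (boxWt q₁ q₂ u z) ≠ 0 ∧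
      gPoly q₁ q₂ (boxWt q₁ q₂ u y) (boxWt q₁ q₂ u z) ≠ 0 := by
  obtain ⟨x1, x2, x3⟩ := upCoeff_ne hx
  obtain ⟨y1, y2, y3⟩ := upCoeff_ne hy
  obtain ⟨z1, z2, z3⟩ := upCoeff_ne hz
  have ex : boxWt q₁ q₂ u x = posWt q₁ q₂ u S x.1 := by rw [boxWt, posWt, x3]
  have ey : boxWt q₁ q₂ u y = posWt q₁ q₂ u (S + unitRow x.1) y.1 := by rw [boxWt, posWt, y3]
  have ez : boxWt q₁ q₂ u z = posWt q₁ q₂ u (S + unitRow x.1 + unitRow y.1) z.1 := by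
    rw [boxWt, posWt, z3]
  rw [ex, ey, ez]
  exact ⟨h.gPoly_path_two x1 x2, h.gPoly_path_three x1 x2 y2 z2, h.gPoly_path_two y1 y2⟩

theorem GenericWt.downCoeff_path (h : GenericWt q₁ q₂ u) (S : RowTuple n)
    (x y z : (Fin n × ℕ) × ℕ) (hx : downCoeff q₁ q₂ u S x ≠ 0)
    (hy : downCoeff q₁ q₂ u (S - unitRow x.1) y ≠ 0)
    (hz : downCoeff q₁ q₂ u (S - unitRow x.1 - unitRow y.1) z ≠ 0) :
    gPoly q₁ q₂ (boxWt q₁ q₂ u y) (boxWt q₁ q₂ u x) ≠ 0 ∧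
      gPoly q₁ q₂ (boxWt q₁ q₂ u z) (boxWt q₁ q₂ u x) ≠ 0 ∧
      gPoly q₁ q₂ (boxWt q₁ q₂ u z) (boxWt q₁ q₂ u y) ≠ 0 := by
  obtain ⟨x1, x2, x3⟩ := downCoeff_ne hx
  obtain ⟨y1, y2, y3⟩ := downCoeff_ne hy
  obtain ⟨z1, z2, z3⟩ := downCoeff_ne hz
  -- Read backwards, a path of removals is a path of additions starting at S₀.
  set S₀ := S - unitRow x.1 - unitRow y.1 - unitRow z.1 with hS₀
  have e2 : S - unitRow x.1 - unitRow y.1 = S₀ + unitRow z.1 := by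
    rw [hS₀, sub_add_unitRow (by omega)]
  have e1 : S - unitRow x.1 = S₀ + unitRow z.1 + unitRow y.1 := by
    rw [← e2, sub_add_unitRow (by omega)]
  have e0 : S = S₀ + unitRow z.1 + unitRow y.1 + unitRow x.1 := by
    rw [← e1, sub_add_unitRow (by omega)]
  have ez : boxWt q₁ q₂ u z = posWt q₁ q₂ u S₀ z.1 := by
    have : S₀ z.1.1 z.1.2 = z.2 := by rw [hS₀, sub_unitRow_apply, z3]; simp
    rw [boxWt, posWt, this]
  have ey : boxWt q₁ q₂ u y = posWt q₁ q₂ u (S₀ + unitRow z.1) y.1 := by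
    have : (S₀ + unitRow z.1) y.1.1 y.1.2 = y.2 := by rw [← e2, sub_unitRow_apply, y3]; simp
    rw [boxWt, posWt, this]
  have ex : boxWt q₁ q₂ u x = posWt q₁ q₂ u (S₀ + unitRow z.1 + unitRow y.1) x.1 := by
    have : (S₀ + unitRow z.1 + unitRow y.1) x.1.1 x.1.2 = x.2 := by
      rw [← e1, sub_unitRow_apply, x3]; simp
    rw [boxWt, posWt, this]
  rw [ex, ey, ez]
  rw [e2] at y2
  rw [e1] at x2
  rw [e0] at x1
  exact ⟨h.gPoly_path_two y2 x2, h.gPoly_path_three z2 y2 x2 x1, h.gPoly_path_two z2 y2⟩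

/-! ### Commutation of raising and lowering -/

/-- Two boxes addable to the same tuple are never neighbours in the sense of the zeros of g. -/
theorem GenericWt.gPoly_ne_of_addable (h : GenericWt q₁ q₂ u) {S : RowTuple n}
    {d d' : Fin n × ℕ} (hS : IsPartTuple S) (hd : IsPartTuple (S + unitRow d))
    (hd' : IsPartTuple (S + unitRow d')) (hne : d ≠ d') :
    gPoly q₁ q₂ (posWt q₁ q₂ u S d) (posWt q₁ q₂ u S d') ≠ 0 := by
  obtain ⟨i, s⟩ := d
  obtain ⟨k, t⟩ := d'
  intro h0
  obtain ⟨h1, h2⟩ := h.gPoly_eq_zero h0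
  dsimp only at h1 h2
  subst h1
  have hst : s ≠ t := fun hst => hne (by rw [hst])
  have v1 := hS i s
  have v2 := hd i t
  simp only [add_unitRow_apply, true_and] at h2 v2
  rcases h2 with ⟨h2, h3⟩ | ⟨h2, h3⟩ | ⟨h2, h3⟩
  · omega
  · obtain rfl : t = s + 1 := by omega
    omega
  · obtain rfl : s = t + 1 := by omega
    rw [if_pos rfl, if_neg (by omega)] at v2
    omega

/-- When both one-box extensions are partitions, failure at the bottom or at the top would require
the two boxes to be neighbours and would spoil one of the extensions. Up-then-down and down-then-up
are therefore allowed together. -/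
theorem isPartTuple_of_add_add {S : RowTuple n} {d d' : Fin n × ℕ} (hne : d ≠ d')
    (hd : IsPartTuple (S + unitRow d)) (hd' : IsPartTuple (S + unitRow d')) :
    IsPartTuple S ↔ IsPartTuple (S + unitRow d + unitRow d') := by
  have hne' : ¬(d.1 = d'.1 ∧ d.2 = d'.2) := fun hh => hne (Prod.ext hh.1 hh.2)
  constructor
  · intro hS i j
    have v1 := hd i j
    have v2 := hd' i j
    have v3 := hS i j
    simp only [add_unitRow_apply] at v1 v2 ⊢
    split_ifs at v1 v2 ⊢ <;> omega
  · intro hS i j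
    have v1 := hd i j
    have v2 := hd' i j
    have v3 := hS i j
    simp only [add_unitRow_apply] at v1 v2 v3
    split_ifs at v1 v2 v3 <;> omega

end Coefficients

section Operators

variable {n : ℕ} {q₁ q₂ : ℂ} {u : Fin n → ℂ}

/-- The off-diagonal terms of [e, f] cancel: the intermediate tuples of the two orders are
admissible simultaneously, and the amplitudes agree by `tupleE_mul_tupleF`. -/
theorem GenericWt.down_mul_up (h : GenericWt q₁ q₂ u) (S : RowTuple n)
    (b b' : (Fin n × ℕ) × ℕ) (hb : b ≠ b') :
    downCoeff q₁ q₂ u S b' * upCoeff q₁ q₂ u (S - unitRow b'.1) b =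
      upCoeff q₁ q₂ u S b * downCoeff q₁ q₂ u (S + unitRow b.1) b' := by
  obtain ⟨d, a⟩ := b
  obtain ⟨d', a'⟩ := b'
  dsimp only
  by_cases hd : d = d'
  · subst hd
    have e1 : downCoeff q₁ q₂ u S (d, a') * upCoeff q₁ q₂ u (S - unitRow d) (d, a) = 0 := by
      by_contra hne
      have h1 := (downCoeff_ne (left_ne_zero_of_mul hne)).2.2
      have h2 := (upCoeff_ne (right_ne_zero_of_mul hne)).2.2
      rw [sub_unitRow_apply, if_pos ⟨rfl, rfl⟩] at h2
      exact hb (Prod.ext rfl (by dsimp only at h1 h2 ⊢; omega))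
    have e2 : upCoeff q₁ q₂ u S (d, a) * downCoeff q₁ q₂ u (S + unitRow d) (d, a') = 0 := by
      by_contra hne
      have h1 := (upCoeff_ne (left_ne_zero_of_mul hne)).2.2
      have h2 := (downCoeff_ne (right_ne_zero_of_mul hne)).2.2
      rw [add_unitRow_apply, if_pos ⟨rfl, rfl⟩] at h2
      exact hb (Prod.ext rfl (by dsimp only at h1 h2 ⊢; omega))
    rw [e1, e2]
  have hne' : ¬(d.1 = d'.1 ∧ d.2 = d'.2) := fun hh => hd (Prod.ext hh.1 hh.2)
  have esub : (S - unitRow d') d.1 d.2 = S d.1 d.2 := by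
    rw [sub_unitRow_apply, if_neg hne', Nat.sub_zero]
  by_cases hS : IsPartTuple S ∧ S d.1 d.2 = a ∧ S d'.1 d'.2 = a' + 1
  · obtain ⟨hS, ha, ha'⟩ := hS
    obtain ⟨S, rfl⟩ : ∃ S₀, S = S₀ + unitRow d' :=
      ⟨S - unitRow d', (sub_add_unitRow (by omega)).symm⟩
    have e3 : S + unitRow d' + unitRow d - unitRow d' = S + unitRow d := by
      rw [add_right_comm, add_sub_unitRow]
    have e4 : (S + unitRow d' + unitRow d) d'.1 d'.2 = a' + 1 := by
      rw [add_unitRow_apply_of_ne _ (Ne.symm hd), ha']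
    have e5 : S d.1 d.2 = a := (add_unitRow_apply_of_ne S hd).symm.trans ha
    rw [downCoeff, upCoeff, upCoeff, downCoeff]
    dsimp only
    rw [add_sub_unitRow, e3]
    by_cases h1 : IsPartTuple (S + unitRow d)
    · have h2 := isPartTuple_of_add_add (Ne.symm hd) hS h1
      by_cases h3 : IsPartTuple S
      · have h4 := h2.mp h3
        rw [if_pos ⟨hS, h3, ha'⟩, if_pos ⟨h3, h1, e5⟩, if_pos ⟨hS, h4, ha⟩, if_pos ⟨h4, h1, e4⟩,
          h.tupleE_mul_tupleF S hd (h.gPoly_ne_of_addable h3 h1 hS hd)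
          (h.gPoly_ne_of_addable h3 hS h1 (Ne.symm hd)), mul_comm]
      · rw [if_neg (fun hh => h3 hh.2.1), if_neg (c := _ ∧ _ ∧ (S + unitRow d') _ _ = _)
          (fun hh => h3 (h2.mpr hh.2.1)), zero_mul, zero_mul]
    · rw [if_neg (c := _ ∧ IsPartTuple (S + unitRow d) ∧ S _ _ = _) (fun hh => h1 hh.2.1),
        if_neg (c := _ ∧ IsPartTuple (S + unitRow d) ∧ _) (fun hh => h1 hh.2.1), mul_zero, mul_zero]
  · have e1 : downCoeff q₁ q₂ u S (d', a') * upCoeff q₁ q₂ u (S - unitRow d') (d, a) = 0 := by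
      by_contra hne
      have h1 := downCoeff_ne (left_ne_zero_of_mul hne)
      have h2 := (upCoeff_ne (right_ne_zero_of_mul hne)).2.2
      rw [esub] at h2
      exact hS ⟨h1.1, h2, h1.2.2⟩
    have e2 : upCoeff q₁ q₂ u S (d, a) * downCoeff q₁ q₂ u (S + unitRow d) (d', a') = 0 := by
      by_contra hne
      have h1 := upCoeff_ne (left_ne_zero_of_mul hne)
      have h2 := (downCoeff_ne (right_ne_zero_of_mul hne)).2.2
      rw [add_unitRow_apply_of_ne S (Ne.symm hd)] at h2
      exact hS ⟨h1.1, h1.2.2, h2⟩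
    rw [e1, e2]

/-! ### The operators -/

/-- The tuple of sequences underlying a tuple of partitions. -/
def toTuple (l : Fin n → FinPartition) : RowTuple n := fun i => (l i).1

theorem isPartTuple_toTuple (l : Fin n → FinPartition) : IsPartTuple (toTuple l) :=
  fun i j => (l i).2 (Nat.le_succ j)

/-- The tuple of partitions with the given rows. -/
def ofTuple (S : RowTuple n) (hS : IsPartTuple S) : Fin n → FinPartition :=
  fun i => ⟨S i, antitone_nat_of_succ_le (hS i)⟩

theorem toTuple_ofTuple (S : RowTuple n) (hS : IsPartTuple S) : toTuple (ofTuple S hS) = S := rfl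

theorem ofTuple_toTuple (l : Fin n → FinPartition) (h : IsPartTuple (toTuple l)) :
    ofTuple (toTuple l) h = l := rfl

open Classical in
/-- The basis vector indexed by `S`, or `0` if `S` is not a tuple of partitions. -/
def tupleVec (S : RowTuple n) : (Fin n → FinPartition) →₀ ℂ :=
  if h : IsPartTuple S then Finsupp.single (ofTuple S h) 1 else 0

theorem tupleVec_toTuple (l : Fin n → FinPartition) :
    tupleVec (toTuple l) = Finsupp.single l 1 := by
  rw [tupleVec, dif_pos (isPartTuple_toTuple l), ofTuple_toTuple]

theorem tupleVec_of_not {S : RowTuple n} (h : ¬IsPartTuple S) : tupleVec S = 0 := dif_neg h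

theorem end_ext {f g : Module.End ℂ ((Fin n → FinPartition) →₀ ℂ)}
    (h : ∀ S : RowTuple n, f (tupleVec S) = g (tupleVec S)) : f = g := by
  refine Finsupp.lhom_ext' fun l => LinearMap.ext_ring ?_
  simpa [tupleVec_toTuple] using h (toTuple l)

/-- The operator with coefficients `C S b * p b ^ a` along the steps `S ↦ step S b`. -/
def boxOp (step : RowTuple n → (Fin n × ℕ) × ℕ → RowTuple n)
    (C : RowTuple n → (Fin n × ℕ) × ℕ → ℂ) (p : (Fin n × ℕ) × ℕ → ℂ) (a : ℤ) :
    Module.End ℂ ((Fin n → FinPartition) →₀ ℂ) :=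
  Finsupp.linearCombination ℂ fun l =>
    ∑ᶠ b, (C (toTuple l) b * p b ^ a) • tupleVec (step (toTuple l) b)

theorem isBoxFamily_boxOp {step : RowTuple n → (Fin n × ℕ) × ℕ → RowTuple n}
    {C : RowTuple n → (Fin n × ℕ) × ℕ → ℂ} {p : (Fin n × ℕ) × ℕ → ℂ}
    (hC : ∀ S, ¬IsPartTuple S → ∀ b, C S b = 0)
    (hfin : ∀ S, ∃ U : Finset ((Fin n × ℕ) × ℕ), ∀ b ∉ U, C S b = 0)
    (hcomm : ∀ S x y, step (step S x) y = step (step S y) x) (hp : ∀ b, p b ≠ 0) :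
    IsBoxFamily tupleVec step C p (boxOp step C p) where
  apply a S U hU := by
    by_cases hS : IsPartTuple S
    · rw [tupleVec, dif_pos hS, boxOp, Finsupp.linearCombination_single, one_smul, toTuple_ofTuple]
      refine finsum_eq_sum_of_support_subset _ fun b hb => ?_
      by_contra hn
      exact hb (by simp [hU b hn])
    · rw [tupleVec_of_not hS, map_zero]
      simp [hC S hS]
  finite := hfin
  comm := hcomm
  ne_zero := hp

/-- A finite set of boxes containing all the boxes that can be added or removed. -/
def boxCover (S : RowTuple n) (N : ℕ) : Finset ((Fin n × ℕ) × ℕ) :=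
  (Finset.univ ×ˢ Finset.range (N + 1)) ×ˢ Finset.range (∑ i, S i 0 + 1)

theorem exists_row_bound (S : RowTuple n) : ∃ N, ∀ i j, N ≤ j → S i j = 0 := by
  refine ⟨∑ i, (S i).support.sup id + 1, fun i j hj => ?_⟩
  by_contra hne
  have h1 : j ≤ (S i).support.sup id :=
    Finset.le_sup (f := id) (Finsupp.mem_support_iff.mpr hne)
  have h2 : (S i).support.sup id ≤ ∑ i, (S i).support.sup id :=
    Finset.single_le_sum (f := fun i => (S i).support.sup id) (fun _ _ => Nat.zero_le _)
      (Finset.mem_univ i)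
  omega

theorem IsPartTuple.le_sum {S : RowTuple n} (hS : IsPartTuple S) (i : Fin n) (j : ℕ) :
    S i j ≤ ∑ i, S i 0 :=
  (antitone_nat_of_succ_le (hS i) (Nat.zero_le j)).trans
    (Finset.single_le_sum (f := fun i => S i 0) (fun _ _ => Nat.zero_le _) (Finset.mem_univ i))

theorem upCoeff_eq_zero {S : RowTuple n} {N : ℕ} (hN : ∀ i j, N ≤ j → S i j = 0)
    (b : (Fin n × ℕ) × ℕ) (hb : b ∉ boxCover S N) : upCoeff q₁ q₂ u S b = 0 := by
  by_contra hne
  obtain ⟨h1, h2, h3⟩ := upCoeff_ne hne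
  refine hb ?_
  have := h1.le_sum b.1.1 b.1.2
  simp only [boxCover, Finset.mem_product, Finset.mem_univ, true_and, Finset.mem_range]
  refine ⟨?_, by omega⟩
  -- In a row of index above N the new box would lie below an empty row. Row N itself remains
  -- possible, hence `N + 1` in the cover.
  by_contra hlt
  have h4 := h2 b.1.1 (b.1.2 - 1)
  rw [Nat.sub_add_cancel (by omega), add_unitRow_apply, add_unitRow_apply, if_pos ⟨rfl, rfl⟩,
    if_neg (by omega), hN b.1.1 (b.1.2 - 1) (by omega)] at h4
  omega

theorem downCoeff_eq_zero {S : RowTuple n} {N : ℕ} (hN : ∀ i j, N ≤ j → S i j = 0)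
    (b : (Fin n × ℕ) × ℕ) (hb : b ∉ boxCover S N) : downCoeff q₁ q₂ u S b = 0 := by
  by_contra hne
  obtain ⟨h1, h2, h3⟩ := downCoeff_ne hne
  refine hb ?_
  have := h1.le_sum b.1.1 b.1.2
  simp only [boxCover, Finset.mem_product, Finset.mem_univ, true_and, Finset.mem_range]
  refine ⟨?_, by omega⟩
  by_contra hlt
  rw [hN _ _ (by omega)] at h3
  omega

variable (q₁ q₂ u) in
/-- The operators `e_a`. -/
def eOp (a : ℤ) : Module.End ℂ ((Fin n → FinPartition) →₀ ℂ) :=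
  boxOp (fun S b => S + unitRow b.1) (upCoeff q₁ q₂ u) (boxWt q₁ q₂ u) a

variable (q₁ q₂ u) in
/-- The operators `f_a`. -/
def fOp (a : ℤ) : Module.End ℂ ((Fin n → FinPartition) →₀ ℂ) :=
  boxOp (fun S b => S - unitRow b.1) (downCoeff q₁ q₂ u) (boxWt q₁ q₂ u) a

theorem GenericWt.isBoxFamily_eOp (h : GenericWt q₁ q₂ u) :
    IsBoxFamily tupleVec (fun S b => S + unitRow b.1) (upCoeff q₁ q₂ u) (boxWt q₁ q₂ u)
      (eOp q₁ q₂ u) :=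
  isBoxFamily_boxOp (fun _ hS _ => if_neg fun hh => hS hh.1)
    (fun S => (exists_row_bound S).elim fun N hN => ⟨boxCover S N, upCoeff_eq_zero hN⟩)
    (fun _ _ _ => add_right_comm _ _ _) h.boxWt_ne

theorem GenericWt.isBoxFamily_fOp (h : GenericWt q₁ q₂ u) :
    IsBoxFamily tupleVec (fun S b => S - unitRow b.1) (downCoeff q₁ q₂ u) (boxWt q₁ q₂ u)
      (fOp q₁ q₂ u) :=
  isBoxFamily_boxOp (fun _ hS _ => if_neg fun hh => hS hh.1)
    (fun S => (exists_row_bound S).elim fun N hN => ⟨boxCover S N, downCoeff_eq_zero hN⟩)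
    (fun _ _ _ => tsub_right_comm) h.boxWt_ne

/-- The operator with the eigenvalues `d l`. -/
def diagOp (d : (Fin n → FinPartition) → ℂ) : Module.End ℂ ((Fin n → FinPartition) →₀ ℂ) :=
  Finsupp.linearCombination ℂ fun l => d l • Finsupp.single l 1

theorem diagOp_single (d : (Fin n → FinPartition) → ℂ) (l : Fin n → FinPartition) :
    diagOp d (Finsupp.single l 1) = d l • Finsupp.single l 1 := by
  rw [diagOp, Finsupp.linearCombination_single, one_smul]

theorem diagOp_mul (d d' : (Fin n → FinPartition) → ℂ) :
    diagOp d * diagOp d' = diagOp fun l => d l * d' l := by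
  refine Finsupp.lhom_ext' fun l => LinearMap.ext_ring ?_
  simp only [LinearMap.comp_apply, Finsupp.lsingle_apply, Module.End.mul_apply, diagOp_single,
    map_smul, smul_smul]
  rw [mul_comm]

theorem diagOp_one : diagOp (fun _ : Fin n → FinPartition => (1 : ℂ)) = 1 := by
  refine Finsupp.lhom_ext' fun l => LinearMap.ext_ring ?_
  simp only [LinearMap.comp_apply, Finsupp.lsingle_apply, diagOp_single, one_smul,
    Module.End.one_apply]

theorem diagOp_zero : diagOp (fun _ : Fin n → FinPartition => (0 : ℂ)) = 0 := by
  refine Finsupp.lhom_ext' fun l => LinearMap.ext_ring ?_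
  simp only [LinearMap.comp_apply, Finsupp.lsingle_apply, diagOp_single, zero_smul,
    LinearMap.zero_apply]

theorem diagOp_tupleVec (d : (Fin n → FinPartition) → ℂ) (S : RowTuple n) :
    diagOp d (tupleVec S) = (open Classical in if h : IsPartTuple S then d (ofTuple S h) else 0) •
      tupleVec S := by
  by_cases h : IsPartTuple S
  · rw [dif_pos h, tupleVec, dif_pos h, diagOp_single]
  · rw [tupleVec_of_not h, map_zero, smul_zero]

/-! ### Eigenvalue series, and the operator relations other than [e, f]. -/

variable (q₁ q₂ u) in
/-- The series of eigenvalues of `ψ⁺` on a tuple of partitions. -/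
def plusSeries (l : Fin n → FinPartition) : PowerSeries ℂ :=
  ∏ i, fockPsiPlus q₁ q₂ (u i) (l i) (PowerSeries.X : PowerSeries ℂ)

variable (q₁ q₂ u) in
/-- The series of eigenvalues of `ψ⁻` on a tuple of partitions. -/
def minusSeries (l : Fin n → FinPartition) : PowerSeries ℂ :=
  ∏ i, fockPsiMinus q₁ q₂ (u i) (l i) (PowerSeries.X : PowerSeries ℂ)

theorem plusSeries_add (h₁ : q₁ ≠ 0) (h₂ : q₂ ≠ 0) {l m : Fin n → FinPartition} {d : Fin n × ℕ}
    (hm : toTuple m = toTuple l + unitRow d) :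
    boxDen q₁ q₂ (u d.1) d.2 ((l d.1).1 d.2) (PowerSeries.X : PowerSeries ℂ) *
        plusSeries q₁ q₂ u m =
      boxNum q₁ q₂ (u d.1) d.2 ((l d.1).1 d.2) (PowerSeries.X : PowerSeries ℂ) *
        plusSeries q₁ q₂ u l := by
  have hd : (m d.1).1 = (l d.1).1 + Finsupp.single d.2 1 := by
    have := congrFun hm d.1
    rwa [add_unitRow_self] at this
  have hk : ∀ k ≠ d.1, m k = l k := fun k hk => Subtype.ext (by
    have := congrFun hm k
    rwa [add_unitRow_of_ne _ _ hk] at this)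
  have key : ∀ m : Fin n → FinPartition, plusSeries q₁ q₂ u m =
      fockPsiPlus q₁ q₂ (u d.1) (m d.1) (PowerSeries.X : PowerSeries ℂ) *
        ∏ i ∈ Finset.univ.erase d.1,
          fockPsiPlus q₁ q₂ (u i) (m i) (PowerSeries.X : PowerSeries ℂ) := fun m =>
    (Finset.mul_prod_erase Finset.univ
      (fun i => fockPsiPlus q₁ q₂ (u i) (m i) (PowerSeries.X : PowerSeries ℂ))
      (Finset.mem_univ d.1)).symm
  have e : ∏ i ∈ Finset.univ.erase d.1,
      fockPsiPlus q₁ q₂ (u i) (m i) (PowerSeries.X : PowerSeries ℂ) =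
      ∏ i ∈ Finset.univ.erase d.1,
        fockPsiPlus q₁ q₂ (u i) (l i) (PowerSeries.X : PowerSeries ℂ) :=
    Finset.prod_congr rfl fun k hk' => by rw [hk k (Finset.ne_of_mem_erase hk')]
  rw [key m, key l, e, ← mul_assoc, ← mul_assoc, fockPsiPlus_X_add h₁ h₂ _ hd]

theorem minusSeries_eq (q₁ q₂ : ℂ) (u : Fin n → ℂ) (l : Fin n → FinPartition) :
    minusSeries q₁ q₂ u l = q₂ ^ n • plusSeries q₁⁻¹ q₂⁻¹ (fun i => (u i)⁻¹) l := by
  simp only [minusSeries, plusSeries, fockPsiMinus_eq]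
  rw [Finset.prod_smul]; simp

theorem boxRel_plusSeries (h₁ : q₁ ≠ 0) (h₂ : q₂ ≠ 0) {l m : Fin n → FinPartition}
    {d : Fin n × ℕ} (hm : toTuple m = toTuple l + unitRow d) :
    BoxRel q₁ q₂ (wt q₁ q₂ (u d.1) d.2 ((l d.1).1 d.2))
      (fun k => intCoeff (plusSeries q₁ q₂ u l) k) (fun k => intCoeff (plusSeries q₁ q₂ u m) k) :=
  boxRel_intCoeff h₁ h₂ (plusSeries_add h₁ h₂ hm)

theorem GenericWt.boxRel_minusSeries (h : GenericWt q₁ q₂ u) {l m : Fin n → FinPartition}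
    {d : Fin n × ℕ} (hm : toTuple m = toTuple l + unitRow d) :
    BoxRel q₁ q₂ (wt q₁ q₂ (u d.1) d.2 ((l d.1).1 d.2))
      (fun k => intCoeff (minusSeries q₁ q₂ u l) (-k))
      (fun k => intCoeff (minusSeries q₁ q₂ u m) (-k)) := by
  refine BoxRel.neg h.q₁_ne h.q₂_ne (wt_ne h.q₁_ne h.q₂_ne (h.u_ne _) _ _)
    (d := intCoeff _) (d' := intCoeff _) ?_
  rw [← wt_inv]
  refine boxRel_intCoeff (inv_ne_zero h.q₁_ne) (inv_ne_zero h.q₂_ne) ?_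
  rw [minusSeries_eq, minusSeries_eq, mul_smul_comm, mul_smul_comm,
    ← plusSeries_add (u := fun i => (u i)⁻¹) (inv_ne_zero h.q₁_ne) (inv_ne_zero h.q₂_ne) hm]

/-- Relation between a diagonal family and the raising operators. -/
theorem GenericWt.gMul_diagOp_eOp (h : GenericWt q₁ q₂ u)
    (d : (Fin n → FinPartition) → ℤ → ℂ)
    (hd : ∀ (l m : Fin n → FinPartition) (c : Fin n × ℕ), toTuple m = toTuple l + unitRow c →
      BoxRel q₁ q₂ (wt q₁ q₂ (u c.1) c.2 ((l c.1).1 c.2)) (d l) (d m)) (i j : ℤ) :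
    gMul q₁ q₂ (fun a => diagOp fun l => d l a) (eOp q₁ q₂ u) i j =
      -gMul q₁ q₂ (eOp q₁ q₂ u) (fun a => diagOp fun l => d l a) j i := by
  refine end_ext fun S => ?_
  classical
  refine h.isBoxFamily_eOp.diagonal_eq q₁ q₂ _
    (fun S a => if hS : IsPartTuple S then d (ofTuple S hS) a else 0)
    (fun a S => ?_) (fun S x i hx => ?_) i j S
  · rw [diagOp_tupleVec]
  · obtain ⟨h1, h2, h3⟩ := upCoeff_ne hx
    simp only [dif_pos h1, dif_pos h2]
    have := (hd (ofTuple S h1) (ofTuple _ h2) x.1 rfl).sum_eq h.q₁_ne h.q₂_ne i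
    rwa [show (ofTuple S h1 x.1.1).1 x.1.2 = x.2 from h3] at this

/-- Relation between a diagonal family and the lowering operators. -/
theorem GenericWt.gMulSwap_diagOp_fOp (h : GenericWt q₁ q₂ u)
    (d : (Fin n → FinPartition) → ℤ → ℂ)
    (hd : ∀ (l m : Fin n → FinPartition) (c : Fin n × ℕ), toTuple m = toTuple l + unitRow c →
      BoxRel q₁ q₂ (wt q₁ q₂ (u c.1) c.2 ((l c.1).1 c.2)) (d l) (d m)) (i j : ℤ) :
    gMulSwap q₁ q₂ (fun a => diagOp fun l => d l a) (fOp q₁ q₂ u) i j =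
      -gMulSwap q₁ q₂ (fOp q₁ q₂ u) (fun a => diagOp fun l => d l a) j i := by
  rw [gMulSwap_eq h.q₁_ne h.q₂_ne, gMulSwap_eq h.q₁_ne h.q₂_ne]
  -- The relation now has the shape of one for raising operators at inverse parameters, and the
  -- general statement applies to removal steps.
  refine congrArg Neg.neg ?_
  refine end_ext fun S => ?_
  classical
  refine h.isBoxFamily_fOp.diagonal_eq q₁⁻¹ q₂⁻¹ _
    (fun S a => if hS : IsPartTuple S then d (ofTuple S hS) a else 0)
    (fun a S => ?_) (fun S x i hx => ?_) i j S
  · rw [diagOp_tupleVec]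
  · obtain ⟨h1, h2, h3⟩ := downCoeff_ne hx
    simp only [dif_pos h1, dif_pos h2]
    have := (hd (ofTuple _ h2) (ofTuple S h1) x.1
      (sub_add_unitRow (h3 ▸ Nat.succ_ne_zero _)).symm).sum_eq_inv h.q₁_ne h.q₂_ne i
    have e : (ofTuple _ h2 x.1.1).1 x.1.2 = x.2 := by
      change (S - unitRow x.1) x.1.1 x.1.2 = x.2
      rw [sub_unitRow_apply, h3]; simp
    rwa [e] at this

theorem GenericWt.gMul_eOp_eOp (h : GenericWt q₁ q₂ u) (i j : ℤ) :
    gMul q₁ q₂ (eOp q₁ q₂ u) (eOp q₁ q₂ u) i j =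
      -gMul q₁ q₂ (eOp q₁ q₂ u) (eOp q₁ q₂ u) j i :=
  end_ext fun S => h.isBoxFamily_eOp.gMul_eq q₁ q₂ h.upCoeff_exchange i j S

theorem GenericWt.gPoly_inv_downCoeff (h : GenericWt q₁ q₂ u) (S : RowTuple n)
    (x y : (Fin n × ℕ) × ℕ) :
    gPoly q₁⁻¹ q₂⁻¹ (boxWt q₁ q₂ u y) (boxWt q₁ q₂ u x) *
        (downCoeff q₁ q₂ u S x * downCoeff q₁ q₂ u (S - unitRow x.1) y) =
      -(gPoly q₁⁻¹ q₂⁻¹ (boxWt q₁ q₂ u x) (boxWt q₁ q₂ u y) *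
        (downCoeff q₁ q₂ u S y * downCoeff q₁ q₂ u (S - unitRow y.1) x)) := by
  rw [gPoly_inv h.q₁_ne h.q₂_ne, gPoly_inv h.q₁_ne h.q₂_ne]
  linear_combination -h.downCoeff_exchange S x y

theorem GenericWt.gMulSwap_fOp_fOp (h : GenericWt q₁ q₂ u) (i j : ℤ) :
    gMulSwap q₁ q₂ (fOp q₁ q₂ u) (fOp q₁ q₂ u) i j =
      -gMulSwap q₁ q₂ (fOp q₁ q₂ u) (fOp q₁ q₂ u) j i := by
  rw [gMulSwap_eq h.q₁_ne h.q₂_ne, gMulSwap_eq h.q₁_ne h.q₂_ne]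
  refine congrArg Neg.neg ?_
  exact end_ext fun S => h.isBoxFamily_fOp.gMul_eq q₁⁻¹ q₂⁻¹ h.gPoly_inv_downCoeff i j S

theorem GenericWt.serre_eOp (h : GenericWt q₁ q₂ u) :
    eOp q₁ q₂ u 0 * (eOp q₁ q₂ u 1 * eOp q₁ q₂ u (-1) - eOp q₁ q₂ u (-1) * eOp q₁ q₂ u 1) -
      (eOp q₁ q₂ u 1 * eOp q₁ q₂ u (-1) - eOp q₁ q₂ u (-1) * eOp q₁ q₂ u 1) * eOp q₁ q₂ u 0 = 0 :=
  end_ext fun S => h.isBoxFamily_eOp.serre q₁ q₂ h.q₁_ne h.q₂_ne h.upCoeff_exchange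
    h.upCoeff_path S

theorem GenericWt.serre_fOp (h : GenericWt q₁ q₂ u) :
    fOp q₁ q₂ u 0 * (fOp q₁ q₂ u 1 * fOp q₁ q₂ u (-1) - fOp q₁ q₂ u (-1) * fOp q₁ q₂ u 1) -
      (fOp q₁ q₂ u 1 * fOp q₁ q₂ u (-1) - fOp q₁ q₂ u (-1) * fOp q₁ q₂ u 1) * fOp q₁ q₂ u 0 = 0 :=
  end_ext fun S => h.isBoxFamily_fOp.serre q₁⁻¹ q₂⁻¹ (inv_ne_zero h.q₁_ne) (inv_ne_zero h.q₂_ne)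
    h.gPoly_inv_downCoeff (fun S x y z hx hy hz => by
      obtain ⟨h1, h2, h3⟩ := h.downCoeff_path S x y z hx hy hz
      simp only [gPoly_inv h.q₁_ne h.q₂_ne, neg_ne_zero]
      exact ⟨h1, h2, h3⟩) S

end Operators

/-! ### The relation [e, f] from residues. -/

section Residues

variable {n : ℕ} {q₁ q₂ : ℂ} {u : Fin n → ℂ}

/-- Omitting one of the two pole factors of row s affects that row only: its two zeros and the other
pole remain, while all other rows and the vacuum reassemble. -/
theorem prod_residue_row {q₁ q₂ u : ℂ} (S : ℕ →₀ ℕ) (N : ℕ) (hN : S N = 0) (s : Fin N) (b : Bool)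
    (x : ℂ) (hx : 1 - wt q₁ q₂ u N (-1) • x ≠ 0) :
    ∏ c, (1 - zeroWt q₁ q₂ u S N c * x) /
        (if c = (s.castSucc, b) then 1 else 1 - poleWt q₁ q₂ u S N c * x) =
      (1 - wt q₁ q₂ u (s + 1) (S s) * x) * (1 - wt q₁ q₂ u (s - 1) (S s - 1) * x) /
          (1 - poleWt q₁ q₂ u S N (s.castSucc, !b) * x) *
        (vacVal q₁ q₂ u N x *
          ∏ j ∈ (Finset.range N).erase s, rowVal q₁ q₂ u j (S j) x) := by
  set A := (1 - wt q₁ q₂ u (s + 1) (S s) * x) * (1 - wt q₁ q₂ u (s - 1) (S s - 1) * x) /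
    (1 - poleWt q₁ q₂ u S N (s.castSucc, !b) * x) with hA
  set F : ℕ → ℂ := fun j => if j = (s : ℕ) then A else rowVal q₁ q₂ u j (S j) x with hF
  have h1 : ∏ j ∈ Finset.range N, F j =
      A * ∏ j ∈ (Finset.range N).erase s, rowVal q₁ q₂ u j (S j) x := by
    rw [← Finset.mul_prod_erase _ _ (Finset.mem_range.mpr s.2)]
    congr 1
    · exact if_pos rfl
    · exact Finset.prod_congr rfl fun j hj => if_neg (Finset.ne_of_mem_erase hj)
  rw [Fintype.prod_prod_type, Fin.prod_univ_castSucc, mul_left_comm, ← h1, Finset.prod_range,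
    mul_comm]
  congr 1
  · have hl : ∀ b', ¬((Fin.last N, b') = (s.castSucc, b)) := fun b' hh => by
      have := congrArg (fun c : Fin (N + 1) × Bool => (c.1 : ℕ)) hh
      simp at this
      have := s.2
      omega
    rw [Fintype.prod_bool, if_neg (hl _), if_neg (hl _)]
    simp only [zeroWt, poleWt, Fin.val_last, if_true, Bool.false_eq_true, if_false, lt_irrefl, hN,
      vacVal, smul_eq_mul] at hx ⊢
    simp only [Nat.cast_zero, zero_sub]
    rw [div_self hx, mul_one]
  · refine Finset.prod_congr rfl fun j _ => ?_
    by_cases hj : j = s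
    · subst hj
      rw [Fintype.prod_bool]
      simp only [hF, if_true, hA]
      cases b
      · simp [zeroWt, poleWt]; ring
      · simp [zeroWt, poleWt]; ring
    · have hj' : ¬((j : ℕ) = s) := fun hh => hj (Fin.ext hh)
      have hl : ∀ b', ¬((j.castSucc, b') = (s.castSucc, b)) := fun b' hh =>
        hj (Fin.castSucc_injective _ (congrArg Prod.fst hh))
      rw [Fintype.prod_bool, if_neg (hl _), if_neg (hl _)]
      simp only [hF, if_neg hj', zeroWt, poleWt, rowVal, Fin.val_castSucc, Fin.is_lt, if_true,
        Bool.false_eq_true, if_false, smul_eq_mul]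
      rw [div_mul_div_comm, mul_comm (1 - _) (1 - _)]

theorem GenericWt.prod_residue (h : GenericWt q₁ q₂ u) (S : RowTuple n) (N : ℕ)
    (hN : ∀ i j, N ≤ j → S i j = 0) (i : Fin n) (s : Fin N) (b : Bool) (a : ℤ) :
    ∏ c : Fin n × (Fin (N + 1) × Bool),
        (1 - zeroWt q₁ q₂ (u c.1) (S c.1) N c.2 * (wt q₁ q₂ (u i) s a)⁻¹) /
          (if c = (i, (s.castSucc, b)) then 1 else
            1 - poleWt q₁ q₂ (u c.1) (S c.1) N c.2 * (wt q₁ q₂ (u i) s a)⁻¹) =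
      (1 - wt q₁ q₂ (u i) (s + 1) (S i s) * (wt q₁ q₂ (u i) s a)⁻¹) *
          (1 - wt q₁ q₂ (u i) (s - 1) (S i s - 1) * (wt q₁ q₂ (u i) s a)⁻¹) /
          (1 - poleWt q₁ q₂ (u i) (S i) N (s.castSucc, !b) * (wt q₁ q₂ (u i) s a)⁻¹) *
        ((∏ k ∈ Finset.univ.erase i, psiBox q₁ q₂ (u k) (S k) (wt q₁ q₂ (u i) s a)⁻¹) *
          (vacVal q₁ q₂ (u i) N (wt q₁ q₂ (u i) s a)⁻¹ *
          ∏ j ∈ (Finset.range N).erase s, rowVal q₁ q₂ (u i) j (S i j) (wt q₁ q₂ (u i) s a)⁻¹)) := by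
  set x := (wt q₁ q₂ (u i) s a)⁻¹ with hx
  rw [Fintype.prod_prod_type, ← Finset.mul_prod_erase _ _ (Finset.mem_univ i), mul_left_comm,
    mul_comm]
  have hs := s.2
  congr 1
  · refine Finset.prod_congr rfl fun k hk => ?_
    have hk := Finset.ne_of_mem_erase hk
    rw [psiBox_eq_poles (fun t b => h.one_sub_wt_ne i k _ _ t b fun hh => hk hh.1) (S k) N (hN k)]
    refine Finset.prod_congr rfl fun c _ => ?_
    rw [if_neg (fun hh => hk (congrArg Prod.fst hh))]
    rfl
  · rw [← prod_residue_row (S i) N (hN i N le_rfl) s b x (h.one_sub_wt_row_ne i (by omega) _ _)]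
    refine Finset.prod_congr rfl fun c _ => ?_
    simp only [Prod.mk.injEq, true_and]

/-- E runs over the positions before d and F over those after it, so the product runs over all
positions other than d and is independent of the order of the tensor factors. -/
theorem GenericWt.tupleE_mul_tupleF_eq (h : GenericWt q₁ q₂ u) (S : RowTuple n) (N : ℕ)
    (d : Fin n × ℕ) (hN : ∀ j, N ≤ j → S d.1 j = 0) (hd : d.2 < N) :
    tupleE q₁ q₂ u S d * tupleF q₁ q₂ u S d =
      q₁ * (1 - q₁)⁻¹ ^ 2 *
        ((∏ k ∈ Finset.univ.erase d.1, psiBox q₁ q₂ (u k) (S k) (posWt q₁ q₂ u S d)⁻¹) *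
          (vacVal q₁ q₂ (u d.1) N (posWt q₁ q₂ u S d)⁻¹ *
          ∏ j ∈ (Finset.range N).erase d.2,
            rowVal q₁ q₂ (u d.1) j (S d.1 j) (posWt q₁ q₂ u S d)⁻¹)) := by
  have e1 : (Finset.univ : Finset (Fin n)).erase d.1 =
      (Finset.Iio d.1).disjUnion (Finset.Ioi d.1)
        (Finset.disjoint_left.mpr fun k hk hk' => by
          simp only [Finset.mem_Iio, Finset.mem_Ioi] at hk hk'; exact lt_asymm hk hk') := by
    ext k
    simp [lt_or_lt_iff_ne]
  have e2 : (Finset.range N).erase d.2 =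
      (Finset.range d.2).disjUnion (Finset.Ico (d.2 + 1) N)
        (Finset.disjoint_left.mpr fun k hk hk' => by
          simp only [Finset.mem_range, Finset.mem_Ico] at hk hk'; omega) := by
    ext k
    simp only [Finset.mem_erase, Finset.mem_range, Finset.mem_disjUnion, Finset.mem_Ico]
    omega
  rw [e1, e2, Finset.prod_disjUnion, Finset.prod_disjUnion, tupleE, tupleF,
    h.fAmp_eq_rows d.1 (S d.1) d.2 N hN hd, eAmp, posWt]
  ring

variable (q₁ q₂) in
/-- The value of `g` at `(1, 1)`. -/
def gOne : ℂ := (1 - q₁) * (1 - q₂) * (1 - qThree q₁ q₂)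

theorem GenericWt.q₁_ne_one (h : GenericWt q₁ q₂ u) (i : Fin n) : q₁ ≠ 1 := fun h1 => by
  have := q₁_mul_wt h.q₁_ne q₂ (u i) 0 0
  rw [h1, one_mul, ← h1] at this
  have := (h.inj _ _ _ _ _ _ this).2.2
  omega

/-- The pole at the next box of a row. The local factor (1-q₃)(1-q₂)/(1-q₁⁻¹) against the constant
q₁/(1-q₁)² of EF gives -g(1,1). -/
theorem GenericWt.residue_true (h : GenericWt q₁ q₂ u) (S : RowTuple n) (N : ℕ)
    (hN : ∀ i j, N ≤ j → S i j = 0) (i : Fin n) (s : Fin N) :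
    ∏ c : Fin n × (Fin (N + 1) × Bool),
        (1 - zeroWt q₁ q₂ (u c.1) (S c.1) N c.2 *
          (poleWt q₁ q₂ (u i) (S i) N (s.castSucc, true))⁻¹) /
          (if c = (i, (s.castSucc, true)) then 1 else
            1 - poleWt q₁ q₂ (u c.1) (S c.1) N c.2 *
              (poleWt q₁ q₂ (u i) (S i) N (s.castSucc, true))⁻¹) =
      -(gOne q₁ q₂ * (tupleE q₁ q₂ u S (i, s) * tupleF q₁ q₂ u S (i, s))) := by
  have hw : poleWt q₁ q₂ (u i) (S i) N (s.castSucc, true) = wt q₁ q₂ (u i) s (S i s) := by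
    simp [poleWt]
  rw [hw, h.prod_residue S N hN i s true (S i s),
    h.tupleE_mul_tupleF_eq S N (i, s) (hN i) s.2, posWt]
  dsimp only
  set G := (∏ k ∈ Finset.univ.erase i, psiBox q₁ q₂ (u k) (S k) (wt q₁ q₂ (u i) s (S i s))⁻¹) *
    (vacVal q₁ q₂ (u i) N (wt q₁ q₂ (u i) s (S i s))⁻¹ *
      ∏ j ∈ (Finset.range N).erase s,
        rowVal q₁ q₂ (u i) j (S i j) (wt q₁ q₂ (u i) s (S i s))⁻¹)
  have h0 := wt_ne h.q₁_ne h.q₂_ne (h.u_ne i) s (S i s)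
  have hq := sub_ne_zero.mpr (h.q₁_ne_one i).symm
  have h1 := h.q₁_ne
  have e1 : wt q₁ q₂ (u i) (s + 1) (S i s) * (wt q₁ q₂ (u i) s (S i s))⁻¹ = qThree q₁ q₂ := by
    rw [← q₃_mul_wt h.q₁_ne h.q₂_ne, mul_inv_cancel_right₀ h0]
  have e2 : wt q₁ q₂ (u i) (s - 1) (S i s - 1) * (wt q₁ q₂ (u i) s (S i s))⁻¹ = q₂ := by
    rw [← q₂_mul_wt h.q₁_ne h.q₂_ne, mul_inv_cancel_right₀ h0]
  have e3 : poleWt q₁ q₂ (u i) (S i) N (s.castSucc, !true) * (wt q₁ q₂ (u i) s (S i s))⁻¹ = q₁⁻¹ := by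
    have := q₁_mul_wt h.q₁_ne q₂ (u i) s (S i s - 1)
    rw [sub_add_cancel] at this
    rw [mul_inv_eq_iff_eq_mul₀ h0, ← this, inv_mul_cancel_left₀ h1]
    simp [poleWt]
  rw [e1, e2, e3, gOne, show (1 : ℂ) - q₁⁻¹ = -(1 - q₁) * q₁⁻¹ by field_simp; ring]
  field_simp

/-- The pole at the last box of a nonempty row. The local factor (1-q₃q₁)(1-q₂q₁)/(1-q₁) equals
q₁(1-q₂)(1-q₃)/(1-q₁), which gives the opposite sign. -/
theorem GenericWt.residue_false (h : GenericWt q₁ q₂ u) (S : RowTuple n) (N : ℕ)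
    (hN : ∀ i j, N ≤ j → S i j = 0) (i : Fin n) (s : Fin N) (hS : S i s ≠ 0) :
    ∏ c : Fin n × (Fin (N + 1) × Bool),
        (1 - zeroWt q₁ q₂ (u c.1) (S c.1) N c.2 *
          (poleWt q₁ q₂ (u i) (S i) N (s.castSucc, false))⁻¹) /
          (if c = (i, (s.castSucc, false)) then 1 else
            1 - poleWt q₁ q₂ (u c.1) (S c.1) N c.2 *
              (poleWt q₁ q₂ (u i) (S i) N (s.castSucc, false))⁻¹) =
      gOne q₁ q₂ * (tupleE q₁ q₂ u (S - unitRow (i, (s : ℕ))) (i, s) *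
        tupleF q₁ q₂ u (S - unitRow (i, (s : ℕ))) (i, s)) := by
  have hw : poleWt q₁ q₂ (u i) (S i) N (s.castSucc, false) = wt q₁ q₂ (u i) s (S i s - 1) := by
    simp [poleWt]
  have hp : posWt q₁ q₂ u (S - unitRow (i, (s : ℕ))) (i, s) = wt q₁ q₂ (u i) s (S i s - 1) := by
    rw [posWt, sub_unitRow_apply, if_pos ⟨rfl, rfl⟩, Nat.cast_sub (Nat.one_le_iff_ne_zero.mpr hS),
      Nat.cast_one]
  have hN' : ∀ j, N ≤ j → (S - unitRow (i, (s : ℕ))) i j = 0 := fun j hj => by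
    rw [sub_unitRow_apply, hN i j hj, Nat.zero_sub]
  have eK : ∀ k ∈ Finset.univ.erase i, (S - unitRow (i, (s : ℕ))) k = S k := fun k hk => by
    ext j
    rw [sub_unitRow_apply, if_neg (fun hh => Finset.ne_of_mem_erase hk hh.1), Nat.sub_zero]
  have eJ : ∀ j ∈ (Finset.range N).erase s, (S - unitRow (i, (s : ℕ))) i j = S i j :=
    fun j hj => by
      rw [sub_unitRow_apply, if_neg (fun hh => Finset.ne_of_mem_erase hj hh.2), Nat.sub_zero]
  rw [hw, h.prod_residue S N hN i s false (S i s - 1),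
    h.tupleE_mul_tupleF_eq (S - unitRow (i, (s : ℕ))) N (i, s) hN' s.2, hp]
  dsimp only
  rw [Finset.prod_congr (s₁ := Finset.univ.erase i)
      (f := fun k => psiBox q₁ q₂ (u k) ((S - unitRow (i, (s : ℕ))) k)
      (wt q₁ q₂ (u i) s (S i s - 1))⁻¹) rfl (g := fun k => psiBox q₁ q₂ (u k) (S k)
      (wt q₁ q₂ (u i) s (S i s - 1))⁻¹) (fun k hk => by rw [eK k hk]),
    Finset.prod_congr (s₁ := (Finset.range N).erase s)
      (f := fun j => rowVal q₁ q₂ (u i) j ((S - unitRow (i, (s : ℕ))) i j)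
        (wt q₁ q₂ (u i) s (S i s - 1))⁻¹) rfl (fun j hj => by rw [eJ j hj])]
  set G := (∏ k ∈ Finset.univ.erase i, psiBox q₁ q₂ (u k) (S k) (wt q₁ q₂ (u i) s (S i s - 1))⁻¹) *
    (vacVal q₁ q₂ (u i) N (wt q₁ q₂ (u i) s (S i s - 1))⁻¹ *
      ∏ j ∈ (Finset.range N).erase s,
        rowVal q₁ q₂ (u i) j (S i j) (wt q₁ q₂ (u i) s (S i s - 1))⁻¹)
  have h0 := wt_ne h.q₁_ne h.q₂_ne (h.u_ne i) s (S i s - 1)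
  have hq := sub_ne_zero.mpr (h.q₁_ne_one i).symm
  have h1 := h.q₁_ne
  have h2 := h.q₂_ne
  have e0 := q₁_mul_wt h.q₁_ne q₂ (u i) s (S i s - 1)
  rw [sub_add_cancel] at e0
  have e1 : wt q₁ q₂ (u i) (s + 1) (S i s) * (wt q₁ q₂ (u i) s (S i s - 1))⁻¹ =
      qThree q₁ q₂ * q₁ := by
    rw [← q₃_mul_wt h.q₁_ne h.q₂_ne, ← e0, ← mul_assoc, mul_inv_cancel_right₀ h0]
  have e2 : wt q₁ q₂ (u i) (s - 1) (S i s - 1) * (wt q₁ q₂ (u i) s (S i s - 1))⁻¹ = q₂ * q₁ := by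
    rw [← q₂_mul_wt h.q₁_ne h.q₂_ne, ← e0, ← mul_assoc, mul_inv_cancel_right₀ h0]
  have e3 : poleWt q₁ q₂ (u i) (S i) N (s.castSucc, !false) * (wt q₁ q₂ (u i) s (S i s - 1))⁻¹ =
      q₁ := by
    rw [mul_inv_eq_iff_eq_mul₀ h0, e0]
    simp [poleWt]
  rw [e1, e2, e3, gOne, qThree]
  field_simp
  ring

/-- An empty row has no last box, and the spurious pole in column -1 is cancelled by a zero of the
next row, which is empty as well. -/
theorem residue_false_eq_zero (S : RowTuple n) (hS : IsPartTuple S)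
    (hw : ∀ i s a, wt q₁ q₂ (u i) s a ≠ 0) (N : ℕ)
    (i : Fin n) (s : Fin N) (h0 : S i s = 0) (D : Fin n × (Fin (N + 1) × Bool) → ℂ) :
    ∏ c : Fin n × (Fin (N + 1) × Bool),
        (1 - zeroWt q₁ q₂ (u c.1) (S c.1) N c.2 *
          (poleWt q₁ q₂ (u i) (S i) N (s.castSucc, false))⁻¹) / D c = 0 := by
  refine Finset.prod_eq_zero (Finset.mem_univ (i, (s.succ, true))) ?_
  have h1 : S i (s + 1) = 0 := Nat.eq_zero_of_le_zero (h0 ▸ hS i s)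
  have e : zeroWt q₁ q₂ (u i) (S i) N (s.succ, true) = wt q₁ q₂ (u i) s (-1) := by
    simp [zeroWt, h1]
  have e' : poleWt q₁ q₂ (u i) (S i) N (s.castSucc, false) = wt q₁ q₂ (u i) s (-1) := by
    simp [poleWt, h0]
  dsimp only
  rw [e, e', mul_inv_cancel₀ (hw _ _ _), sub_self, zero_div]

/-- The row bound is N + 1 rather than N so that row N is empty and its zero wt(N+1, 0) cancels the
vacuum pole; the other pole of the last index is the dummy one. -/
theorem residue_last_eq_zero (S : RowTuple n) (hw : ∀ i s a, wt q₁ q₂ (u i) s a ≠ 0) (N : ℕ)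
    (hN : ∀ i j, N ≤ j → S i j = 0)
    (i : Fin n) (b : Bool) (D : Fin n × (Fin (N + 1 + 1) × Bool) → ℂ) :
    ∏ c : Fin n × (Fin (N + 1 + 1) × Bool),
        (1 - zeroWt q₁ q₂ (u c.1) (S c.1) (N + 1) c.2 *
          (poleWt q₁ q₂ (u i) (S i) (N + 1) (Fin.last _, b))⁻¹) / D c = 0 := by
  have h1 := hN i N le_rfl
  have h2 := hN i (N + 1) (Nat.le_succ N)
  cases b
  · refine Finset.prod_eq_zero (Finset.mem_univ (i, (Fin.last (N + 1), false))) ?_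
    have e : zeroWt q₁ q₂ (u i) (S i) (N + 1) (Fin.last _, false) =
        poleWt q₁ q₂ (u i) (S i) (N + 1) (Fin.last _, false) := by
      simp [zeroWt, poleWt]
    have : poleWt q₁ q₂ (u i) (S i) (N + 1) (Fin.last _, false) ≠ 0 := hw _ _ _
    dsimp only
    rw [e, mul_inv_cancel₀ this, sub_self, zero_div]
  · refine Finset.prod_eq_zero (Finset.mem_univ (i, ((Fin.last N).castSucc, false))) ?_
    have e : zeroWt q₁ q₂ (u i) (S i) (N + 1) ((Fin.last N).castSucc, false) =
        poleWt q₁ q₂ (u i) (S i) (N + 1) (Fin.last _, true) := by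
      simp [zeroWt, poleWt, h1, h2]
    have : poleWt q₁ q₂ (u i) (S i) (N + 1) (Fin.last _, true) ≠ 0 := hw _ _ _
    dsimp only
    rw [e, mul_inv_cancel₀ this, sub_self, zero_div]

/-- The vanishing of forbidden amplitudes removes the partition conditions, leaving only the
condition on the column. -/
theorem GenericWt.up_mul_down_self (h : GenericWt q₁ q₂ u) {S : RowTuple n} (hS : IsPartTuple S)
    (b : (Fin n × ℕ) × ℕ) : upCoeff q₁ q₂ u S b * downCoeff q₁ q₂ u (S + unitRow b.1) b =
      if S b.1.1 b.1.2 = b.2 then tupleE q₁ q₂ u S b.1 * tupleF q₁ q₂ u S b.1 else 0 := by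
  have e : (S + unitRow b.1) b.1.1 b.1.2 = S b.1.1 b.1.2 + 1 := by
    rw [add_unitRow_apply, if_pos ⟨rfl, rfl⟩]
  rw [upCoeff, downCoeff, add_sub_unitRow, e]
  by_cases h1 : IsPartTuple (S + unitRow b.1)
  · simp only [hS, h1, true_and, Nat.add_right_cancel_iff]
    split_ifs <;> simp
  · simp [h1, h.tupleE_eq_zero hS h1]

theorem GenericWt.down_mul_up_self (h : GenericWt q₁ q₂ u) {S : RowTuple n} (hS : IsPartTuple S)
    (b : (Fin n × ℕ) × ℕ) : downCoeff q₁ q₂ u S b * upCoeff q₁ q₂ u (S - unitRow b.1) b =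
      if S b.1.1 b.1.2 = b.2 + 1 then
        tupleE q₁ q₂ u (S - unitRow b.1) b.1 * tupleF q₁ q₂ u (S - unitRow b.1) b.1 else 0 := by
  by_cases hb : S b.1.1 b.1.2 = b.2 + 1
  · have e : S - unitRow b.1 + unitRow b.1 = S :=
      sub_add_unitRow (by rw [hb]; exact Nat.succ_ne_zero _)
    have e' : (S - unitRow b.1) b.1.1 b.1.2 = b.2 := by
      rw [sub_unitRow_apply, if_pos ⟨rfl, rfl⟩, hb, Nat.add_sub_cancel]
    rw [if_pos hb, upCoeff, downCoeff, e]
    by_cases h1 : IsPartTuple (S - unitRow b.1)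
    · rw [if_pos ⟨hS, h1, hb⟩, if_pos ⟨h1, hS, e'⟩, mul_comm]
    · rw [if_neg (fun hh => h1 hh.2.1), zero_mul, h.tupleF_eq_zero h1 (by rwa [e]), mul_zero]
  · rw [if_neg hb, downCoeff, if_neg (fun hh => hb hh.2.2), zero_mul]

/-- The sum over boxes is the sum of the residues. -/
theorem GenericWt.gOne_mul_sum_boxCover (h : GenericWt q₁ q₂ u) {S : RowTuple n}
    (hS : IsPartTuple S) {N : ℕ} (hN : ∀ i j, N ≤ j → S i j = 0) (k : ℤ) :
    gOne q₁ q₂ * ∑ b ∈ boxCover S N,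
        (downCoeff q₁ q₂ u S b * upCoeff q₁ q₂ u (S - unitRow b.1) b -
          upCoeff q₁ q₂ u S b * downCoeff q₁ q₂ u (S + unitRow b.1) b) * boxWt q₁ q₂ u b ^ k =
      ∑ c : Fin n × (Fin (N + 1 + 1) × Bool),
        (∏ c' : Fin n × (Fin (N + 1 + 1) × Bool),
          (1 - zeroWt q₁ q₂ (u c'.1) (S c'.1) (N + 1) c'.2 *
            (poleWt q₁ q₂ (u c.1) (S c.1) (N + 1) c.2)⁻¹) /
            (if c' = c then 1 else 1 - poleWt q₁ q₂ (u c'.1) (S c'.1) (N + 1) c'.2 *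
              (poleWt q₁ q₂ (u c.1) (S c.1) (N + 1) c.2)⁻¹)) *
          poleWt q₁ q₂ (u c.1) (S c.1) (N + 1) c.2 ^ k := by
  have hw : ∀ i s a, wt q₁ q₂ (u i) s a ≠ 0 := fun i => wt_ne h.q₁_ne h.q₂_ne (h.u_ne i)
  have hN' : ∀ i j, N + 1 ≤ j → S i j = 0 := fun i j hj => hN i j (by omega)
  simp only [h.up_mul_down_self hS, h.down_mul_up_self hS]
  rw [boxCover, Finset.sum_product, Finset.sum_product, Fintype.sum_prod_type, Finset.mul_sum]
  refine Finset.sum_congr rfl fun i _ => ?_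
  rw [Fintype.sum_prod_type, Fin.sum_univ_castSucc]
  simp only [Fintype.sum_bool]
  -- The last index carries no residue, so poles remain only for the rows 0, …, N, the same rows
  -- that occur in `boxCover S N`.
  rw [residue_last_eq_zero S hw N hN, residue_last_eq_zero S hw N hN, zero_mul, zero_mul, add_zero,
    add_zero, Finset.sum_range, Finset.mul_sum]
  refine Finset.sum_congr rfl fun s _ => ?_
  have hlt := hS.le_sum i s
  rw [h.residue_true S (N + 1) hN' i s]
  have e1 : ∑ a ∈ Finset.range (∑ i, S i 0 + 1), (if S i s = a then
      tupleE q₁ q₂ u S (i, (s : ℕ)) * tupleF q₁ q₂ u S (i, (s : ℕ)) else 0) *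
        boxWt q₁ q₂ u ((i, (s : ℕ)), a) ^ k =
      tupleE q₁ q₂ u S (i, (s : ℕ)) * tupleF q₁ q₂ u S (i, (s : ℕ)) *
        poleWt q₁ q₂ (u i) (S i) (N + 1) (s.castSucc, true) ^ k := by
    simp only [ite_mul, zero_mul]
    rw [Finset.sum_ite_eq, if_pos (Finset.mem_range.mpr (by omega))]
    simp [boxWt, poleWt]
  have e2 : gOne q₁ q₂ * ∑ a ∈ Finset.range (∑ i, S i 0 + 1), (if S i s = a + 1 then
      tupleE q₁ q₂ u (S - unitRow (i, (s : ℕ))) (i, (s : ℕ)) *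
        tupleF q₁ q₂ u (S - unitRow (i, (s : ℕ))) (i, (s : ℕ)) else 0) *
        boxWt q₁ q₂ u ((i, (s : ℕ)), a) ^ k =
      (∏ c' : Fin n × (Fin (N + 1 + 1) × Bool),
          (1 - zeroWt q₁ q₂ (u c'.1) (S c'.1) (N + 1) c'.2 *
            (poleWt q₁ q₂ (u i) (S i) (N + 1) (s.castSucc, false))⁻¹) /
            (if c' = (i, (s.castSucc, false)) then 1 else
              1 - poleWt q₁ q₂ (u c'.1) (S c'.1) (N + 1) c'.2 *
              (poleWt q₁ q₂ (u i) (S i) (N + 1) (s.castSucc, false))⁻¹)) *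
        poleWt q₁ q₂ (u i) (S i) (N + 1) (s.castSucc, false) ^ k := by
    by_cases h0 : S i s = 0
    · rw [residue_false_eq_zero S hS hw (N + 1) i s h0, zero_mul, Finset.sum_eq_zero, mul_zero]
      intro a _
      rw [if_neg (by omega), zero_mul]
    · obtain ⟨m, hm⟩ := Nat.exists_eq_succ_of_ne_zero h0
      rw [h.residue_false S (N + 1) hN' i s h0, Finset.sum_eq_single_of_mem m
        (Finset.mem_range.mpr (by omega)) (fun a _ ha => by rw [if_neg (by omega), zero_mul]),
        if_pos hm, show boxWt q₁ q₂ u ((i, (s : ℕ)), m) =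
          poleWt q₁ q₂ (u i) (S i) (N + 1) (s.castSucc, false) by simp [boxWt, poleWt, hm]]
      ring
  rw [← e2]
  simp only [sub_mul, Finset.sum_sub_distrib]
  rw [e1]
  ring

theorem GenericWt.intCoeff_sub_intCoeff (h : GenericWt q₁ q₂ u) (l : Fin n → FinPartition) {N : ℕ}
    (hN : ∀ i j, N ≤ j → toTuple l i j = 0) (k : ℤ) :
    intCoeff (plusSeries q₁ q₂ u l) k - intCoeff (minusSeries q₁ q₂ u l) (-k) =
      gOne q₁ q₂ * ∑ b ∈ boxCover (toTuple l) N,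
        (downCoeff q₁ q₂ u (toTuple l) b * upCoeff q₁ q₂ u (toTuple l - unitRow b.1) b -
          upCoeff q₁ q₂ u (toTuple l) b * downCoeff q₁ q₂ u (toTuple l + unitRow b.1) b) *
            boxWt q₁ q₂ u b ^ k := by
  have hN' : ∀ i j, N + 1 ≤ j → (l i).1 j = 0 := fun i j hj => hN i j (by omega)
  have hw : ∀ i s a, wt q₁ q₂ (u i) s a ≠ 0 := fun i => wt_ne h.q₁_ne h.q₂_ne (h.u_ne i)
  rw [h.gOne_mul_sum_boxCover (isPartTuple_toTuple l) hN k,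
    ← coeff_sub_coeff_eq_sum_residue
      (fun c : Fin n × (Fin (N + 1 + 1) × Bool) =>
        zeroWt q₁ q₂ (u c.1) (toTuple l c.1) (N + 1) c.2)
      (fun c => poleWt q₁ q₂ (u c.1) (toTuple l c.1) (N + 1) c.2) ?_ (fun c => hw _ _ _) ?_ _
      (fun c => rfl) (plusSeries q₁ q₂ u l) (minusSeries q₁ q₂ u l) ?_ ?_ k]
  · rw [intCoeff, intCoeff]
    simp only [Left.nonneg_neg_iff]
  · intro c
    simp only [zeroWt]
    split_ifs <;> exact hw _ _ _
  -- All poles are simple: they are weights of distinct positions, the two poles of a row lying in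
  -- adjacent columns.
  · rintro ⟨i, j, b⟩ ⟨i', j', b'⟩ hc
    obtain ⟨h1, h2, h3⟩ := h.inj _ _ _ _ _ _ hc
    dsimp only at h1 h2 h3
    subst h1
    obtain rfl : j = j' := Fin.ext (by exact_mod_cast h2)
    cases b <;> cases b' <;> (simp at h3 ⊢; try omega)
  · rw [plusSeries, Fintype.prod_prod_type, Fintype.prod_prod_type, ← Finset.prod_mul_distrib]
    exact Finset.prod_congr rfl fun i _ =>
      fockPsiPlus_X_mul_poles h.q₁_ne h.q₂_ne (u i) (l i) (N + 1) (hN' i)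
  · rw [minusSeries, Fintype.prod_prod_type, Fintype.prod_prod_type, Fintype.prod_prod_type,
      ← Finset.prod_mul_distrib, ← Finset.prod_smul]
    refine Finset.prod_congr rfl fun i _ => ?_
    have e := fockPsiMinus_X_mul_poles h.q₁_ne h.q₂_ne (u i) (l i) (N + 1) (hN' i)
    have e' := prod_zeroWt_div_poleWt h.q₁_ne h.q₂_ne (h.u_ne i) (toTuple l i) (N + 1)
    dsimp only
    rw [e']
    exact e

theorem GenericWt.gOne_ne (h : GenericWt q₁ q₂ u) (i : Fin n) : gOne q₁ q₂ ≠ 0 := by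
  have h0 := h.u_ne i
  have key : ∀ q s a, q * wt q₁ q₂ (u i) 0 0 = wt q₁ q₂ (u i) s a → ¬(s = 0 ∧ a = 0) → 1 - q ≠ 0 :=
    fun q s a hq hsa h1 => hsa (by
      rw [← sub_eq_zero.mp h1, one_mul] at hq
      obtain ⟨-, h2, h3⟩ := h.inj _ _ _ _ _ _ hq
      exact ⟨h2.symm, h3.symm⟩)
  exact mul_ne_zero (mul_ne_zero (key _ _ _ (q₁_mul_wt h.q₁_ne q₂ _ 0 0) (by omega))
    (key _ _ _ (q₂_mul_wt h.q₁_ne h.q₂_ne _ 0 0) (by omega)))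
    (key _ _ _ (q₃_mul_wt h.q₁_ne h.q₂_ne _ 0 0) (by omega))

theorem GenericWt.eOp_mul_fOp_sub (h : GenericWt q₁ q₂ u) (i j : ℤ) :
    eOp q₁ q₂ u i * fOp q₁ q₂ u j - fOp q₁ q₂ u j * eOp q₁ q₂ u i =
      (gOne q₁ q₂)⁻¹ • ((diagOp fun l => intCoeff (plusSeries q₁ q₂ u l) (i + j)) -
        diagOp fun l => intCoeff (minusSeries q₁ q₂ u l) (-(i + j))) := by
  refine end_ext fun S => ?_
  by_cases hS : IsPartTuple S
  swap
  · rw [tupleVec_of_not hS, map_zero, map_zero]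
  obtain ⟨l, rfl⟩ : ∃ l, S = toTuple l := ⟨ofTuple S hS, rfl⟩
  obtain ⟨N, hN⟩ := exists_row_bound (toTuple l)
  rw [h.isBoxFamily_eOp.commutator_apply h.isBoxFamily_fOp (h.down_mul_up) ?_
    (fun S b _ => add_sub_unitRow S b.1) ?_ i j _ (boxCover (toTuple l) N) (upCoeff_eq_zero hN)
    (downCoeff_eq_zero hN)]
  · rw [LinearMap.smul_apply, LinearMap.sub_apply, tupleVec_toTuple, diagOp_single, diagOp_single,
      ← sub_smul, h.intCoeff_sub_intCoeff l hN, smul_smul]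
    -- Without components `GenericWt` does not give g(1,1) ≠ 0, but then there are no boxes and both
    -- sides vanish.
    rcases Nat.eq_zero_or_pos n with rfl | hn
    · simp [boxCover]
    · rw [inv_mul_cancel_left₀ (h.gOne_ne ⟨0, hn⟩)]
  · intro S b b' hne hb
    have h1 := (upCoeff_ne (left_ne_zero_of_mul hb)).2.2
    have h2 := (downCoeff_ne (right_ne_zero_of_mul hb)).2.2
    have hd : b'.1 ≠ b.1 := fun hd => hne (Prod.ext hd.symm (by
      rw [hd, add_unitRow_apply, if_pos ⟨rfl, rfl⟩] at h2
      omega))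
    rw [add_unitRow_apply_of_ne S hd] at h2
    obtain ⟨S, rfl⟩ : ∃ S₀, S = S₀ + unitRow b'.1 :=
      ⟨S - unitRow b'.1, (sub_add_unitRow (by rw [h2]; exact Nat.succ_ne_zero _)).symm⟩
    rw [add_sub_unitRow, add_right_comm, add_sub_unitRow]
  · intro S b hb
    exact sub_add_unitRow (by rw [(downCoeff_ne hb).2.2]; exact Nat.succ_ne_zero _)

end Residues

/-! ### The action of the algebra on the tensor product. -/

section Action

variable {n : ℕ} {q₁ q₂ : ℂ} {u : Fin n → ℂ}

theorem constantCoeff_fockPsiPlus (h₁ : q₁ ≠ 0) (h₂ : q₂ ≠ 0) (u : ℂ) (l : FinPartition) :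
    PowerSeries.constantCoeff (fockPsiPlus q₁ q₂ u l (PowerSeries.X : PowerSeries ℂ)) = 1 := by
  have := congrArg PowerSeries.constantCoeff
    (fockPsiPlus_X_mul_poles h₁ h₂ u l (l.1.support.sup id + 1) fun j hj => by
      by_contra hne
      have : j ≤ l.1.support.sup id :=
        Finset.le_sup (f := id) (Finsupp.mem_support_iff.mpr hne)
      omega)
  simpa [PowerSeries.smul_eq_C_mul] using this

theorem intCoeff_plusSeries_zero (h₁ : q₁ ≠ 0) (h₂ : q₂ ≠ 0) (u : Fin n → ℂ)
    (l : Fin n → FinPartition) : intCoeff (plusSeries q₁ q₂ u l) 0 = 1 := by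
  rw [intCoeff, if_pos le_rfl, Int.toNat_zero, PowerSeries.coeff_zero_eq_constantCoeff_apply,
    plusSeries, map_prod]
  exact Finset.prod_eq_one fun i _ => constantCoeff_fockPsiPlus h₁ h₂ _ _

/-- ψ⁻₀ acts by the nonzero scalar q₂ⁿ, and ψ⁺₀ by 1, so the inverses in the presentation act as
required. -/
theorem intCoeff_minusSeries_zero (h₁ : q₁ ≠ 0) (h₂ : q₂ ≠ 0) (u : Fin n → ℂ)
    (l : Fin n → FinPartition) : intCoeff (minusSeries q₁ q₂ u l) 0 = q₂ ^ n := by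
  have := intCoeff_plusSeries_zero (inv_ne_zero h₁) (inv_ne_zero h₂) (fun i => (u i)⁻¹) l
  rw [intCoeff, if_pos le_rfl] at this ⊢
  rw [minusSeries_eq, PowerSeries.coeff_smul, this, smul_eq_mul, mul_one]

variable (q₁ q₂ u) in
/-- The operator by which a generator acts. -/
def genOp : EGen → Module.End ℂ ((Fin n → FinPartition) →₀ ℂ)
  | .e i => eOp q₁ q₂ u i
  | .f i => fOp q₁ q₂ u i
  | .psiPlus k => diagOp fun l => intCoeff (plusSeries q₁ q₂ u l) k
  | .psiMinus k => diagOp fun l => intCoeff (minusSeries q₁ q₂ u l) k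
  | .psiPlusInv => diagOp fun l => (intCoeff (plusSeries q₁ q₂ u l) 0)⁻¹
  | .psiMinusInv => diagOp fun l => (intCoeff (minusSeries q₁ q₂ u l) 0)⁻¹

variable (q₁ q₂ u) in
/-- The action of the free algebra. -/
def freeAction : FreeAlgebra ℂ EGen →ₐ[ℂ] Module.End ℂ ((Fin n → FinPartition) →₀ ℂ) :=
  FreeAlgebra.lift ℂ (genOp q₁ q₂ u)

theorem freeAction_ι (x : EGen) :
    freeAction q₁ q₂ u (FreeAlgebra.ι ℂ x) = genOp q₁ q₂ u x := FreeAlgebra.lift_ι_apply _ _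

theorem freeAction_eSer (i : ℤ) : freeAction q₁ q₂ u (EGen.eSer i) = eOp q₁ q₂ u i :=
  freeAction_ι _

theorem freeAction_fSer (i : ℤ) : freeAction q₁ q₂ u (EGen.fSer i) = fOp q₁ q₂ u i :=
  freeAction_ι _

theorem freeAction_psiPlusSer (i : ℤ) : freeAction q₁ q₂ u (EGen.psiPlusSer i) =
    diagOp fun l => intCoeff (plusSeries q₁ q₂ u l) i := by
  rw [EGen.psiPlusSer]
  split_ifs with hi
  · rw [freeAction_ι, genOp, Int.toNat_of_nonneg hi]
  · rw [map_zero, ← diagOp_zero]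
    simp only [intCoeff, if_neg hi]

theorem freeAction_psiMinusSer (i : ℤ) : freeAction q₁ q₂ u (EGen.psiMinusSer i) =
    diagOp fun l => intCoeff (minusSeries q₁ q₂ u l) (-i) := by
  rw [EGen.psiMinusSer]
  split_ifs with hi
  · rw [freeAction_ι, genOp, Int.toNat_of_nonneg (by omega)]
  · rw [map_zero, ← diagOp_zero]
    simp only [intCoeff, Left.nonneg_neg_iff, if_neg hi]

theorem freeAction_gMul (A B : ℤ → FreeAlgebra ℂ EGen) (i j : ℤ) :
    freeAction q₁ q₂ u (gMul q₁ q₂ A B i j) =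
      gMul q₁ q₂ (fun a => freeAction q₁ q₂ u (A a)) (fun a => freeAction q₁ q₂ u (B a)) i j := by
  simp only [gMul, map_sum, map_smul, map_mul]

theorem freeAction_gMulSwap (A B : ℤ → FreeAlgebra ℂ EGen) (i j : ℤ) :
    freeAction q₁ q₂ u (gMulSwap q₁ q₂ A B i j) =
      gMulSwap q₁ q₂ (fun a => freeAction q₁ q₂ u (A a)) (fun a => freeAction q₁ q₂ u (B a))
        i j := by
  simp only [gMulSwap, map_sum, map_smul, map_mul]

theorem GenericWt.freeAction_eq (h : GenericWt q₁ q₂ u) {x y : FreeAlgebra ℂ EGen}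
    (hxy : ERel q₁ q₂ x y) : freeAction q₁ q₂ u x = freeAction q₁ q₂ u y := by
  have hcomm : ∀ d d' : (Fin n → FinPartition) → ℂ,
      diagOp d * diagOp d' = diagOp d' * diagOp d := fun d d' => by
    rw [diagOp_mul, diagOp_mul]
    simp only [mul_comm]
  have hinv : ∀ d d' : (Fin n → FinPartition) → ℂ, (∀ l, d l * d' l = 1) →
      diagOp d * diagOp d' = 1 := fun d d' hd => by
    rw [diagOp_mul, ← diagOp_one]
    simp only [hd]
  have hp := intCoeff_plusSeries_zero h.q₁_ne h.q₂_ne u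
  have hm := intCoeff_minusSeries_zero h.q₁_ne h.q₂_ne u
  have hq := pow_ne_zero n h.q₂_ne
  cases hxy <;> simp only [map_neg, freeAction_gMul, freeAction_gMulSwap, map_sub, map_mul, map_smul, map_one,
    map_zero, freeAction_eSer, freeAction_fSer, freeAction_psiPlusSer, freeAction_psiMinusSer,
    freeAction_ι, genOp]
  case ee i j => exact h.gMul_eOp_eOp i j
  case ff i j => exact h.gMulSwap_fOp_fOp i j
  case psiPlus_e i j =>
    exact h.gMul_diagOp_eOp _ (fun l m c hm => boxRel_plusSeries h.q₁_ne h.q₂_ne hm) i j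
  case psiMinus_e i j => exact h.gMul_diagOp_eOp _ (fun l m c hm => h.boxRel_minusSeries hm) i j
  case psiPlus_f i j =>
    exact h.gMulSwap_diagOp_fOp _ (fun l m c hm => boxRel_plusSeries h.q₁_ne h.q₂_ne hm) i j
  case psiMinus_f i j =>
    exact h.gMulSwap_diagOp_fOp _ (fun l m c hm => h.boxRel_minusSeries hm) i j
  case ef i j => exact h.eOp_mul_fOp_sub i j
  case psiPlus_comm i j => exact hcomm _ _
  case psiMinus_comm i j => exact hcomm _ _
  case psiPlus_psiMinus_comm i j => exact hcomm _ _
  case psiPlus_mul_inv => exact hinv _ _ fun l => by rw [hp]; simp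
  case psiPlus_inv_mul => exact hinv _ _ fun l => by rw [hp]; simp
  case psiMinus_mul_inv => exact hinv _ _ fun l => by rw [neg_zero, hm, mul_inv_cancel₀ hq]
  case psiMinus_inv_mul => exact hinv _ _ fun l => by rw [neg_zero, hm, inv_mul_cancel₀ hq]
  case serre_e => exact h.serre_eOp
  case serre_f => exact h.serre_fOp

/-- The action of `ℰ` in the basis of tuples of partitions. -/
def GenericWt.action (h : GenericWt q₁ q₂ u) :
    EAlg q₁ q₂ →ₐ[ℂ] Module.End ℂ ((Fin n → FinPartition) →₀ ℂ) :=
  RingQuot.liftAlgHom ℂ ⟨freeAction q₁ q₂ u, fun _ _ hxy => h.freeAction_eq hxy⟩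

theorem GenericWt.action_gen (h : GenericWt q₁ q₂ u) (x : EGen) :
    h.action (EAlg.gen q₁ q₂ x) = genOp q₁ q₂ u x := by
  rw [GenericWt.action, EAlg.gen, RingQuot.liftAlgHom_mkAlgHom_apply, freeAction_ι]

/-- The action of `ℰ` on the tensor product of Fock modules. -/
def GenericWt.tensorAction (h : GenericWt q₁ q₂ u) :
    EAlg q₁ q₂ →ₐ[ℂ] Module.End ℂ (FockTensor u) :=
  ((ketBasis u).repr.symm.conjAlgEquiv ℂ).toAlgHom.comp h.action

theorem GenericWt.tensorAction_gen_ket (h : GenericWt q₁ q₂ u) (x : EGen)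
    (l : Fin n → FinPartition) : h.tensorAction (EAlg.gen q₁ q₂ x) (ket u l) =
      (ketBasis u).repr.symm (genOp q₁ q₂ u x (tupleVec (toTuple l))) := by
  rw [tupleVec_toTuple, ← (ketBasis u).repr_self l, ketBasis_apply, ← h.action_gen]
  rfl

/-! ### Matrix coefficients -/

theorem tupleVec_apply_self {S : RowTuple n} {m : Fin n → FinPartition} (hm : S = toTuple m) :
    tupleVec S m = 1 := by
  rw [hm, tupleVec_toTuple, Finsupp.single_eq_same]

theorem tupleVec_apply_of_ne {S : RowTuple n} {m : Fin n → FinPartition} (hm : S ≠ toTuple m) :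
    tupleVec S m = 0 := by
  by_cases hS : IsPartTuple S
  · obtain ⟨l, rfl⟩ : ∃ l, S = toTuple l := ⟨ofTuple S hS, rfl⟩
    rw [tupleVec_toTuple, Finsupp.single_eq_of_ne]
    rintro rfl
    exact hm rfl
  · rw [tupleVec_of_not hS, Finsupp.zero_apply]

theorem unitRow_injective : Function.Injective (unitRow (n := n)) := by
  intro d d' hd
  have := congrArg (fun S : RowTuple n => S d.1 d.2) hd
  simp only [unitRow_apply, and_self, if_true] at this
  by_contra hne
  rw [if_neg (fun hh => hne (Prod.ext hh.1 hh.2))] at this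
  omega

theorem isAddBox_iff (l m : Fin n → FinPartition) (i : Fin n) (s : ℕ) :
    IsAddBox l m i s ↔ toTuple m = toTuple l + unitRow (i, s) := by
  constructor
  · rintro ⟨h1, h2⟩
    funext k
    by_cases hk : k = i
    · subst hk
      exact h1.trans (add_unitRow_self (toTuple l) (k, s)).symm
    · exact (congrArg Subtype.val (h2 k hk)).trans
        (add_unitRow_of_ne (toTuple l) (i, s) hk).symm
  · intro hm
    refine ⟨(congrFun hm i).trans (add_unitRow_self (toTuple l) (i, s)), fun k hk => ?_⟩
    exact Subtype.ext ((congrFun hm k).trans (add_unitRow_of_ne (toTuple l) (i, s) hk))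

theorem boxPoint_eq (q₁ q₂ u : ℂ) (l : FinPartition) (s : ℕ) :
    boxPoint q₁ q₂ u l s = wt q₁ q₂ u s (l.1 s) := by
  rw [boxPoint, wt, zpow_natCast, zpow_natCast]
  rfl

theorem GenericWt.fockE_eq (h : GenericWt q₁ q₂ u) (i : Fin n) (l : FinPartition) (s : ℕ) :
    fockE q₁ q₂ (u i) l s = eAmp q₁ q₂ (u i) l.1 s := by
  rw [fockE, eAmp, boxPoint_eq]
  congr 1
  exact Finset.prod_congr rfl fun j _ => rowPsiPlus_eq_rowVal h.q₁_ne h.q₂_ne l j _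

theorem GenericWt.fockF_eq (h : GenericWt q₁ q₂ u) (i : Fin n) (l : FinPartition) (s : ℕ) :
    fockF q₁ q₂ (u i) l s = fAmp q₁ q₂ (u i) l.1 s := by
  rw [fockF, fAmp, boxPoint_eq, vacPsiPlus_eq_vacVal h.q₁_ne h.q₂_ne]
  simp only [rowPsiPlus_eq_rowVal h.q₁_ne h.q₂_ne]
  have e : ∀ j, s < j → rowVal q₁ q₂ (u i) j (FinPartition.empty.part j)
      (wt q₁ q₂ (u i) s (l.1 s))⁻¹ ≠ 0 := fun j hj => h.rowVal_zero_ne i hj _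
  rw [finprod_cond_eq_prod_of_cond_iff (t := l.1.support.filter (s < ·))]
  · push_cast
    simp only [div_eq_mul_inv]
    rfl
  · intro j hj
    simp only [Finset.mem_filter, Finsupp.mem_support_iff]
    refine ⟨fun hs => ⟨fun h0 => hj ?_, hs⟩, And.right⟩
    rw [show l.part j = FinPartition.empty.part j from h0, mul_inv_cancel₀ (e j hs)]

theorem GenericWt.tensorE_eq (h : GenericWt q₁ q₂ u) (l : Fin n → FinPartition) (i : Fin n)
    (s : ℕ) : tensorE q₁ q₂ u l i s = tupleE q₁ q₂ u (toTuple l) (i, s) := by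
  rw [tensorE, tupleE, h.fockE_eq, boxPoint_eq]
  congr 1
  exact Finset.prod_congr rfl fun k hk => h.fockPsiMinus_eq (Finset.mem_Iio.mp hk).ne _ _ _

theorem GenericWt.tensorF_eq (h : GenericWt q₁ q₂ u) (l : Fin n → FinPartition) (i : Fin n)
    (s : ℕ) : tensorF q₁ q₂ u l i s = tupleF q₁ q₂ u (toTuple l) (i, s) := by
  rw [tensorF, tupleF, h.fockF_eq, boxPoint_eq]
  congr 1
  exact Finset.prod_congr rfl fun k hk => h.fockPsiPlus_eq (Finset.mem_Ioi.mp hk).ne' _ _ _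

theorem GenericWt.matCoeff_tensorAction (h : GenericWt q₁ q₂ u) (x : EGen)
    (l m : Fin n → FinPartition) : matCoeff u (h.tensorAction (EAlg.gen q₁ q₂ x)) m l =
      genOp q₁ q₂ u x (tupleVec (toTuple l)) m := by
  rw [matCoeff, h.tensorAction_gen_ket, LinearEquiv.apply_symm_apply]

theorem GenericWt.isFockTensorAction (h : GenericWt q₁ q₂ u) :
    IsFockTensorAction q₁ q₂ u h.tensorAction where
  e_box a l m i s hm := by
    rw [isAddBox_iff] at hm
    obtain ⟨U, hU⟩ := h.isBoxFamily_eOp.finite (toTuple l)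
    -- Only one box of the cover leads from l to m with a possibly nonzero coefficient: its position
    -- is determined by m - l, and its column by the current length of that row.
    rw [h.matCoeff_tensorAction, genOp, h.isBoxFamily_eOp.apply a _ U hU, Finsupp.finsetSum_apply,
      Finset.sum_eq_single ((i, s), toTuple l i s), Finsupp.smul_apply,
      tupleVec_apply_self hm.symm, upCoeff, if_pos ⟨isPartTuple_toTuple l,
        hm ▸ isPartTuple_toTuple m, rfl⟩, h.tensorE_eq, boxPoint_eq, smul_eq_mul, mul_one]
    · rfl
    · intro b _ hb
      by_cases hc : upCoeff q₁ q₂ u (toTuple l) b = 0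
      · rw [hc, zero_mul, zero_smul, Finsupp.zero_apply]
      · rw [Finsupp.smul_apply, tupleVec_apply_of_ne, smul_zero]
        intro hh
        have e := unitRow_injective (add_left_cancel (hh.trans hm))
        refine hb (Prod.ext e ?_)
        rw [← (upCoeff_ne hc).2.2, e]
    · intro hb
      rw [hU _ hb, zero_mul, zero_smul, Finsupp.zero_apply]
  e_zero a l m hm := by
    obtain ⟨U, hU⟩ := h.isBoxFamily_eOp.finite (toTuple l)
    rw [h.matCoeff_tensorAction, genOp, h.isBoxFamily_eOp.apply a _ U hU, Finsupp.finsetSum_apply]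
    refine Finset.sum_eq_zero fun b _ => ?_
    rw [Finsupp.smul_apply, tupleVec_apply_of_ne, smul_zero]
    exact fun hh => hm b.1.1 b.1.2 ((isAddBox_iff _ _ _ _).mpr hh.symm)
  f_box a l m i s hm := by
    rw [isAddBox_iff] at hm
    obtain ⟨U, hU⟩ := h.isBoxFamily_fOp.finite (toTuple m)
    have hs : toTuple m - unitRow (i, s) = toTuple l := by rw [hm, add_sub_unitRow]
    have hv : toTuple m i s = toTuple l i s + 1 := by
      rw [hm, add_unitRow_apply, if_pos ⟨rfl, rfl⟩]
    rw [h.matCoeff_tensorAction, genOp, h.isBoxFamily_fOp.apply a _ U hU, Finsupp.finsetSum_apply,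
      Finset.sum_eq_single ((i, s), toTuple l i s), Finsupp.smul_apply,
      tupleVec_apply_self hs, downCoeff, if_pos ⟨isPartTuple_toTuple m,
        hs ▸ isPartTuple_toTuple l, hv⟩, h.tensorF_eq, boxPoint_eq, smul_eq_mul, mul_one]
    · simp only [hs]
      rfl
    · intro b _ hb
      by_cases hc : downCoeff q₁ q₂ u (toTuple m) b = 0
      · rw [hc, zero_mul, zero_smul, Finsupp.zero_apply]
      · rw [Finsupp.smul_apply, tupleVec_apply_of_ne, smul_zero]
        intro hh
        have h3 := (downCoeff_ne hc).2.2
        have e : b.1 = (i, s) := unitRow_injective (add_left_cancel (a := toTuple l) (by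
          rw [← hm, ← hh, sub_add_unitRow (by rw [h3]; exact Nat.succ_ne_zero _)]))
        refine hb (Prod.ext e ?_)
        rw [e] at h3
        dsimp only at h3 ⊢
        omega
    · intro hb
      rw [hU _ hb, zero_mul, zero_smul, Finsupp.zero_apply]
  f_zero a l m hm := by
    obtain ⟨U, hU⟩ := h.isBoxFamily_fOp.finite (toTuple m)
    rw [h.matCoeff_tensorAction, genOp, h.isBoxFamily_fOp.apply a _ U hU, Finsupp.finsetSum_apply]
    refine Finset.sum_eq_zero fun b _ => ?_
    by_cases hc : downCoeff q₁ q₂ u (toTuple m) b = 0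
    · rw [hc, zero_mul, zero_smul, Finsupp.zero_apply]
    · rw [Finsupp.smul_apply, tupleVec_apply_of_ne, smul_zero]
      intro hh
      refine hm b.1.1 b.1.2 ((isAddBox_iff _ _ _ _).mpr ?_)
      rw [← hh, sub_add_unitRow (by rw [(downCoeff_ne hc).2.2]; exact Nat.succ_ne_zero _)]
  psiPlus k l := by
    rw [h.tensorAction_gen_ket, genOp, tupleVec_toTuple, diagOp_single, map_smul,
      Module.Basis.repr_symm_single_one, ketBasis_apply, intCoeff, if_pos (Int.natCast_nonneg k)]
    rfl
  psiMinus k l := by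
    rw [h.tensorAction_gen_ket, genOp, tupleVec_toTuple, diagOp_single, map_smul,
      Module.Basis.repr_symm_single_one, ketBasis_apply, intCoeff, if_pos (Int.natCast_nonneg k)]
    rfl

end Action

/-! ### The constants b and the comparison of amplitudes. -/

section Intertwiner

variable {n : ℕ} {q₁ q₂ : ℂ} {u : Fin n → ℂ}

theorem GenericWt.psiBox_ne (h : GenericWt q₁ q₂ u) {i k : Fin n} (hik : k ≠ i) (S : ℕ →₀ ℕ)
    (s a : ℤ) : psiBox q₁ q₂ (u k) S (wt q₁ q₂ (u i) s a)⁻¹ ≠ 0 := by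
  have hx := fun t b => h.one_sub_wt_ne i k s a t b fun hh => hik hh.1
  exact mul_ne_zero (div_ne_zero (hx _ _) (hx _ _)) (boxProd_ne_zero S fun j t =>
    div_ne_zero (boxNum_ne hx _ _) (boxDen_ne hx _ _))

/-- The two factors are -g(p,p')/g(p',p) and -g(p',p)/g(p,p'). -/
theorem GenericWt.boxNum_div_boxDen_mul (h : GenericWt q₁ q₂ u) {i k : Fin n} (hik : k ≠ i)
    (s a t b : ℤ) :
    boxNum q₁ q₂ (u k) s a (wt q₁ q₂ (u i) t b)⁻¹ / boxDen q₁ q₂ (u k) s a (wt q₁ q₂ (u i) t b)⁻¹ *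
      (boxNum q₁ q₂ (u i) t b (wt q₁ q₂ (u k) s a)⁻¹ /
        boxDen q₁ q₂ (u i) t b (wt q₁ q₂ (u k) s a)⁻¹) = 1 := by
  have d1 := boxDen_ne (K := ℂ) (fun t' b' => h.one_sub_wt_ne i k t b t' b' fun hh => hik hh.1) s a
  have d2 := boxDen_ne (K := ℂ)
    (fun t' b' => h.one_sub_wt_ne k i s a t' b' fun hh => hik hh.1.symm) t b
  have hp := wt_ne h.q₁_ne h.q₂_ne (h.u_ne k) s a
  have hp' := wt_ne h.q₁_ne h.q₂_ne (h.u_ne i) t b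
  have e1 := gPoly_wt (u := u k) h.q₁_ne h.q₂_ne hp' s a
  have e2 := gPoly_wt' (u := u k) h.q₁_ne h.q₂_ne hp' s a
  have e3 := gPoly_wt (u := u i) h.q₁_ne h.q₂_ne hp t b
  have e4 := gPoly_wt' (u := u i) h.q₁_ne h.q₂_ne hp t b
  rw [div_mul_div_comm, div_eq_one_iff_eq (mul_ne_zero d1 d2)]
  refine mul_left_cancel₀ (mul_ne_zero (pow_ne_zero 3 hp) (pow_ne_zero 3 hp')) ?_
  set p := wt q₁ q₂ (u k) s a
  set p' := wt q₁ q₂ (u i) t b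
  linear_combination e2 * (p ^ 3 * boxNum q₁ q₂ (u i) t b p⁻¹) - gPoly q₁ q₂ p p' * e4 +
    gPoly q₁ q₂ p p' * e1 + (p' ^ 3 * boxDen q₁ q₂ (u k) s a p'⁻¹) * e3

variable (q₁ q₂ u) in
/-- The product of the eigenvalues of the component `k` at the boxes of the component `i`, divided
by the vacuum eigenvalues of the component `i` at the boxes of the component `k`. -/
def pairFactor (S : RowTuple n) (k i : Fin n) : ℂ :=
  boxProd (S i) (fun j t => psiBox q₁ q₂ (u k) (S k) (wt q₁ q₂ (u i) j t)⁻¹) /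
    boxProd (S k) fun j t => vacVal q₁ q₂ (u i) 0 (wt q₁ q₂ (u k) j t)⁻¹

theorem GenericWt.pairFactor_ne (h : GenericWt q₁ q₂ u) (S : RowTuple n) {k i : Fin n}
    (hik : k ≠ i) : pairFactor q₁ q₂ u S k i ≠ 0 := by
  refine div_ne_zero (boxProd_ne_zero _ fun j t => h.psiBox_ne hik _ _ _)
    (boxProd_ne_zero _ fun j t => ?_)
  have hx := fun t' b' => h.one_sub_wt_ne k i j t t' b' fun hh => hik hh.1.symm
  exact div_ne_zero (hx _ _) (hx _ _)

theorem pairFactor_add_right (S : RowTuple n) (d : Fin n × ℕ) {k : Fin n} (hk : k ≠ d.1) :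
    pairFactor q₁ q₂ u (S + unitRow d) k d.1 =
      pairFactor q₁ q₂ u S k d.1 * psiBox q₁ q₂ (u k) (S k) (posWt q₁ q₂ u S d)⁻¹ := by
  rw [pairFactor, pairFactor, add_unitRow_self, add_unitRow_of_ne S d hk, boxProd_add,
    mul_div_right_comm]
  rfl

/-- The new box multiplies the numerator by its factors at all boxes of component i. By reciprocity
these are inverse to the box part of Ψᵢ at the new weight; the denominator of `pairFactor` supplies
the missing vacuum part. -/
theorem GenericWt.pairFactor_add_left (h : GenericWt q₁ q₂ u) (S : RowTuple n) (d : Fin n × ℕ)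
    {i : Fin n} (hi : i ≠ d.1) : pairFactor q₁ q₂ u (S + unitRow d) d.1 i =
      pairFactor q₁ q₂ u S d.1 i * (psiBox q₁ q₂ (u i) (S i) (posWt q₁ q₂ u S d)⁻¹)⁻¹ := by
  have e : psiBox q₁ q₂ (u i) (S i) (posWt q₁ q₂ u S d)⁻¹ =
      vacVal q₁ q₂ (u i) 0 (posWt q₁ q₂ u S d)⁻¹ * boxProd (S i) fun j t =>
        boxNum q₁ q₂ (u i) j t (posWt q₁ q₂ u S d)⁻¹ /
          boxDen q₁ q₂ (u i) j t (posWt q₁ q₂ u S d)⁻¹ := rfl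
  have key : (boxProd (S i) fun j t =>
      boxNum q₁ q₂ (u d.1) d.2 (S d.1 d.2) (wt q₁ q₂ (u i) j t)⁻¹ /
        boxDen q₁ q₂ (u d.1) d.2 (S d.1 d.2) (wt q₁ q₂ (u i) j t)⁻¹) *
      (boxProd (S i) fun j t => boxNum q₁ q₂ (u i) j t (posWt q₁ q₂ u S d)⁻¹ /
          boxDen q₁ q₂ (u i) j t (posWt q₁ q₂ u S d)⁻¹) = 1 := by
    rw [← boxProd_mul]
    exact boxProd_eq_one _ fun j t => h.boxNum_div_boxDen_mul hi.symm _ _ _ _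
  rw [pairFactor, pairFactor, add_unitRow_self, add_unitRow_of_ne S d hi, boxProd_add]
  simp only [psiBox_add]
  rw [boxProd_mul, eq_inv_of_mul_eq_one_left key, e]
  simp only [div_eq_mul_inv, mul_inv, posWt]
  ring

theorem pairFactor_add_of_ne (S : RowTuple n) (d : Fin n × ℕ) {k i : Fin n} (hk : k ≠ d.1)
    (hi : i ≠ d.1) : pairFactor q₁ q₂ u (S + unitRow d) k i = pairFactor q₁ q₂ u S k i := by
  rw [pairFactor, pairFactor, add_unitRow_of_ne S d hk, add_unitRow_of_ne S d hi]

variable (q₁ q₂ u) in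
/-- The coefficients of the intertwiner: a product over the inversions of the permutation. -/
def interCoeff (σ : Equiv.Perm (Fin n)) (S : RowTuple n) : ℂ :=
  ∏ k, ∏ i, if k < i ∧ σ.symm i < σ.symm k then (pairFactor q₁ q₂ u S k i)⁻¹ else 1

theorem GenericWt.interCoeff_ne (h : GenericWt q₁ q₂ u) (σ : Equiv.Perm (Fin n))
    (S : RowTuple n) : interCoeff q₁ q₂ u σ S ≠ 0 := by
  refine Finset.prod_ne_zero_iff.mpr fun k _ => Finset.prod_ne_zero_iff.mpr fun i _ => ?_
  split_ifs with hki
  · exact inv_ne_zero (h.pairFactor_ne S hki.1.ne)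
  · exact one_ne_zero

/-- Only the inversions involving the component d.1 change: as the later member of the pair it
contributes Ψ_k⁻¹, as the earlier one Ψ_k. -/
theorem GenericWt.interCoeff_add (h : GenericWt q₁ q₂ u) (σ : Equiv.Perm (Fin n))
    (S : RowTuple n) (d : Fin n × ℕ) : interCoeff q₁ q₂ u σ (S + unitRow d) =
      interCoeff q₁ q₂ u σ S *
        ((∏ k, if k < d.1 ∧ σ.symm d.1 < σ.symm k then
            (psiBox q₁ q₂ (u k) (S k) (posWt q₁ q₂ u S d)⁻¹)⁻¹ else 1) *
          ∏ k, if d.1 < k ∧ σ.symm k < σ.symm d.1 then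
            psiBox q₁ q₂ (u k) (S k) (posWt q₁ q₂ u S d)⁻¹ else 1) := by
  set Ψ : Fin n → ℂ := fun k => psiBox q₁ q₂ (u k) (S k) (posWt q₁ q₂ u S d)⁻¹ with hΨ
  have e : ∀ k i, (if k < i ∧ σ.symm i < σ.symm k then
      (pairFactor q₁ q₂ u (S + unitRow d) k i)⁻¹ else 1) =
      (if k < i ∧ σ.symm i < σ.symm k then (pairFactor q₁ q₂ u S k i)⁻¹ else 1) *
        ((if i = d.1 then (if k < d.1 ∧ σ.symm d.1 < σ.symm k then (Ψ k)⁻¹ else 1) else 1) *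
          (if k = d.1 then (if d.1 < i ∧ σ.symm i < σ.symm d.1 then Ψ i else 1) else 1)) := by
    intro k i
    by_cases hi : i = d.1
    · subst hi
      by_cases hk : k = d.1
      · subst hk
        simp
      · rw [if_pos rfl, if_neg hk, mul_one, pairFactor_add_right S d hk]
        split_ifs
        · rw [mul_inv]
        · rw [mul_one]
    · by_cases hk : k = d.1
      · subst hk
        rw [if_pos rfl, if_neg hi, one_mul, h.pairFactor_add_left S d hi]
        split_ifs
        · rw [mul_inv, inv_inv]
        · rw [mul_one]
      · rw [if_neg hi, if_neg hk, mul_one, mul_one, pairFactor_add_of_ne S d hk hi]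
  simp only [interCoeff, e, Finset.prod_mul_distrib]
  congr 2
  · simp only [Finset.prod_ite_eq', Finset.mem_univ, if_true]
    rfl
  · rw [Finset.prod_comm]
    simp only [Finset.prod_ite_eq', Finset.mem_univ, if_true]
    rfl

theorem tupleE_eq_prod_ite (S : RowTuple n) (d : Fin n × ℕ) : tupleE q₁ q₂ u S d =
    (∏ k, if k < d.1 then psiBox q₁ q₂ (u k) (S k) (posWt q₁ q₂ u S d)⁻¹ else 1) *
      eAmp q₁ q₂ (u d.1) (S d.1) d.2 := by
  rw [tupleE, ← Finset.prod_filter, show Finset.univ.filter (· < d.1) = Finset.Iio d.1 by ext; simp]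

theorem tupleF_eq_prod_ite (S : RowTuple n) (d : Fin n × ℕ) : tupleF q₁ q₂ u S d =
    fAmp q₁ q₂ (u d.1) (S d.1) d.2 *
      ∏ k, if d.1 < k then psiBox q₁ q₂ (u k) (S k) (posWt q₁ q₂ u S d)⁻¹ else 1 := by
  rw [tupleF, ← Finset.prod_filter, show Finset.univ.filter (d.1 < ·) = Finset.Ioi d.1 by ext; simp]

theorem tupleE_perm (σ : Equiv.Perm (Fin n)) (S : RowTuple n) (i : Fin n) (s : ℕ) :
    tupleE q₁ q₂ (fun k => u (σ k)) (fun k => S (σ k)) (i, s) =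
      (∏ k, if σ.symm k < i then psiBox q₁ q₂ (u k) (S k) (posWt q₁ q₂ u S (σ i, s))⁻¹ else 1) *
        eAmp q₁ q₂ (u (σ i)) (S (σ i)) s := by
  rw [tupleE_eq_prod_ite, ← Equiv.prod_comp σ fun k => if σ.symm k < i then _ else _]
  simp only [Equiv.symm_apply_apply]
  rfl

theorem tupleF_perm (σ : Equiv.Perm (Fin n)) (S : RowTuple n) (i : Fin n) (s : ℕ) :
    tupleF q₁ q₂ (fun k => u (σ k)) (fun k => S (σ k)) (i, s) =
      fAmp q₁ q₂ (u (σ i)) (S (σ i)) s *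
      ∏ k, if i < σ.symm k then psiBox q₁ q₂ (u k) (S k) (posWt q₁ q₂ u S (σ i, s))⁻¹ else 1 := by
  rw [tupleF_eq_prod_ite, ← Equiv.prod_comp σ fun k => if i < σ.symm k then _ else _]
  simp only [Equiv.symm_apply_apply]
  rfl

/-- Position by position, the inversions delete Ψ_k for components that no longer precede σ i after
reordering and insert it for those that now do. -/
theorem prod_inversions {i : Fin n} (σ : Equiv.Perm (Fin n)) (Ψ : Fin n → ℂ)
    (hΨ : ∀ k, k ≠ σ i → Ψ k ≠ 0) :
    ((∏ k, if k < σ i ∧ σ.symm (σ i) < σ.symm k then (Ψ k)⁻¹ else 1) *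
        ∏ k, if σ i < k ∧ σ.symm k < σ.symm (σ i) then Ψ k else 1) *
      ∏ k, (if k < σ i then Ψ k else 1) = ∏ k, if σ.symm k < i then Ψ k else 1 := by
  rw [← Finset.prod_mul_distrib, ← Finset.prod_mul_distrib]
  refine Finset.prod_congr rfl fun k _ => ?_
  rw [Equiv.symm_apply_apply]
  by_cases hk : k = σ i
  · simp [hk]
  have hk' : σ.symm k ≠ i := fun hh => hk (by rw [← hh, Equiv.apply_symm_apply])
  have hne := hΨ k hk
  rcases lt_or_gt_of_ne hk with h1 | h1 <;> rcases lt_or_gt_of_ne hk' with h2 | h2 <;>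
    simp [h1, h2, h1.not_gt, h2.not_gt, hne]

theorem prod_inversions' {i : Fin n} (σ : Equiv.Perm (Fin n)) (Ψ : Fin n → ℂ)
    (hΨ : ∀ k, k ≠ σ i → Ψ k ≠ 0) :
    ((∏ k, if k < σ i ∧ σ.symm (σ i) < σ.symm k then (Ψ k)⁻¹ else 1) *
        ∏ k, if σ i < k ∧ σ.symm k < σ.symm (σ i) then Ψ k else 1) *
      ∏ k, (if i < σ.symm k then Ψ k else 1) = ∏ k, if σ i < k then Ψ k else 1 := by
  rw [← Finset.prod_mul_distrib, ← Finset.prod_mul_distrib]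
  refine Finset.prod_congr rfl fun k _ => ?_
  rw [Equiv.symm_apply_apply]
  by_cases hk : k = σ i
  · simp [hk]
  have hk' : σ.symm k ≠ i := fun hh => hk (by rw [← hh, Equiv.apply_symm_apply])
  have hne := hΨ k hk
  rcases lt_or_gt_of_ne hk with h1 | h1 <;> rcases lt_or_gt_of_ne hk' with h2 | h2 <;>
    simp [h1, h2, h1.not_gt, h2.not_gt, hne]

/-- The factor `eAmp` of the component itself does not see the order of the tensor factors, so only
the eigenvalues of the preceding components have to be compared. -/
theorem GenericWt.interCoeff_mul_tupleE (h : GenericWt q₁ q₂ u) (σ : Equiv.Perm (Fin n))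
    (S : RowTuple n) (i : Fin n) (s : ℕ) :
    interCoeff q₁ q₂ u σ (S + unitRow (σ i, s)) * tupleE q₁ q₂ u S (σ i, s) =
      interCoeff q₁ q₂ u σ S * tupleE q₁ q₂ (fun k => u (σ k)) (fun k => S (σ k)) (i, s) := by
  have key := prod_inversions σ
    (fun k => psiBox q₁ q₂ (u k) (S k) (posWt q₁ q₂ u S (σ i, s))⁻¹)
    fun k hk => h.psiBox_ne (i := σ i) hk (S k) s (S (σ i) s)
  rw [tupleE_perm, h.interCoeff_add, tupleE_eq_prod_ite]
  linear_combination interCoeff q₁ q₂ u σ S * eAmp q₁ q₂ (u (σ i)) (S (σ i)) s * key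

theorem GenericWt.interCoeff_mul_tupleF (h : GenericWt q₁ q₂ u) (σ : Equiv.Perm (Fin n))
    (S : RowTuple n) (i : Fin n) (s : ℕ) :
    interCoeff q₁ q₂ u σ (S + unitRow (σ i, s)) *
        tupleF q₁ q₂ (fun k => u (σ k)) (fun k => S (σ k)) (i, s) =
      interCoeff q₁ q₂ u σ S * tupleF q₁ q₂ u S (σ i, s) := by
  have key := prod_inversions' σ
    (fun k => psiBox q₁ q₂ (u k) (S k) (posWt q₁ q₂ u S (σ i, s))⁻¹)
    fun k hk => h.psiBox_ne (i := σ i) hk (S k) s (S (σ i) s)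
  rw [tupleF_perm, h.interCoeff_add, tupleF_eq_prod_ite]
  linear_combination interCoeff q₁ q₂ u σ S * fAmp q₁ q₂ (u (σ i)) (S (σ i)) s * key

/-! ### Transport of the action along a weighted permutation of factors. -/

/-- The isomorphism `|l⟩ ↦ b l • |l ∘ σ⟩`. -/
def permEquiv (u : Fin n → ℂ) (σ : Equiv.Perm (Fin n)) {b : (Fin n → FinPartition) → ℂ}
    (hb : ∀ l, b l ≠ 0) : FockTensor u ≃ₗ[ℂ] FockTensor fun i => u (σ i) :=
  (ketBasis u).equiv (((ketBasis fun i => u (σ i)).reindex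
    (Equiv.arrowCongr σ (Equiv.refl FinPartition))).isUnitSMul fun l => (hb l).isUnit)
    (Equiv.refl _)

theorem permEquiv_ket (u : Fin n → ℂ) (σ : Equiv.Perm (Fin n)) {b : (Fin n → FinPartition) → ℂ}
    (hb : ∀ l, b l ≠ 0) (l : Fin n → FinPartition) :
    permEquiv u σ hb (ket u l) = b l • ket (fun i => u (σ i)) fun i => l (σ i) := by
  rw [← ketBasis_apply, permEquiv, Module.Basis.equiv_apply, Module.Basis.isUnitSMul_apply,
    Module.Basis.reindex_apply, ketBasis_apply]
  rfl

theorem comp_perm_injective (σ : Equiv.Perm (Fin n)) :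
    Function.Injective fun (l : Fin n → FinPartition) i => l (σ i) := fun l m hlm =>
  funext fun i => by simpa using congrFun hlm (σ.symm i)

theorem repr_permEquiv (u : Fin n → ℂ) (σ : Equiv.Perm (Fin n)) {b : (Fin n → FinPartition) → ℂ}
    (hb : ∀ l, b l ≠ 0) (m : Fin n → FinPartition) (v : FockTensor u) :
    (ketBasis fun i => u (σ i)).repr (permEquiv u σ hb v) (fun i => m (σ i)) =
      b m * (ketBasis u).repr v m := by
  have key : (Finsupp.lapply fun i => m (σ i)) ∘ₗ
      (ketBasis fun i => u (σ i)).repr.toLinearMap ∘ₗ (permEquiv u σ hb).toLinearMap =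
      b m • (Finsupp.lapply m ∘ₗ (ketBasis u).repr.toLinearMap) := by
    refine (ketBasis u).ext fun l => ?_
    simp only [LinearMap.comp_apply, LinearEquiv.coe_coe, LinearMap.smul_apply,
      Finsupp.lapply_apply, Module.Basis.repr_self]
    rw [ketBasis_apply, permEquiv_ket, map_smul, ← ketBasis_apply, Module.Basis.repr_self,
      Finsupp.smul_apply, smul_eq_mul, smul_eq_mul]
    by_cases hl : l = m
    · rw [hl, Finsupp.single_eq_same, Finsupp.single_eq_same]
    · rw [Finsupp.single_eq_of_ne (Ne.symm hl),
        Finsupp.single_eq_of_ne fun hh => hl (comp_perm_injective σ hh.symm), mul_zero, mul_zero]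
  exact LinearMap.congr_fun key v

/-- The action transported along the isomorphism. -/
def permAction {q₁ q₂ : ℂ} {u : Fin n → ℂ} (σ : Equiv.Perm (Fin n))
    {b : (Fin n → FinPartition) → ℂ} (hb : ∀ l, b l ≠ 0)
    (ρ : EAlg q₁ q₂ →ₐ[ℂ] Module.End ℂ (FockTensor u)) :
    EAlg q₁ q₂ →ₐ[ℂ] Module.End ℂ (FockTensor fun i => u (σ i)) :=
  ((permEquiv u σ hb).conjAlgEquiv ℂ).toAlgHom.comp ρ

theorem permEquiv_action {q₁ q₂ : ℂ} {u : Fin n → ℂ} (σ : Equiv.Perm (Fin n))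
    {b : (Fin n → FinPartition) → ℂ} (hb : ∀ l, b l ≠ 0)
    (ρ : EAlg q₁ q₂ →ₐ[ℂ] Module.End ℂ (FockTensor u)) (a : EAlg q₁ q₂) (v : FockTensor u) :
    permEquiv u σ hb (ρ a v) = permAction σ hb ρ a (permEquiv u σ hb v) :=
  congrArg (fun w => permEquiv u σ hb (ρ a w)) ((permEquiv u σ hb).symm_apply_apply v).symm

theorem permAction_ket {q₁ q₂ : ℂ} {u : Fin n → ℂ} (σ : Equiv.Perm (Fin n))
    {b : (Fin n → FinPartition) → ℂ} (hb : ∀ l, b l ≠ 0)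
    (ρ : EAlg q₁ q₂ →ₐ[ℂ] Module.End ℂ (FockTensor u)) (a : EAlg q₁ q₂)
    (l : Fin n → FinPartition) :
    permAction σ hb ρ a (ket (fun i => u (σ i)) fun i => l (σ i)) =
      (b l)⁻¹ • permEquiv u σ hb (ρ a (ket u l)) := by
  rw [permEquiv_action, permEquiv_ket, map_smul, inv_smul_smul₀ (hb l)]

theorem matCoeff_permAction {q₁ q₂ : ℂ} {u : Fin n → ℂ} (σ : Equiv.Perm (Fin n))
    {b : (Fin n → FinPartition) → ℂ} (hb : ∀ l, b l ≠ 0)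
    (ρ : EAlg q₁ q₂ →ₐ[ℂ] Module.End ℂ (FockTensor u)) (a : EAlg q₁ q₂)
    (l m : Fin n → FinPartition) :
    matCoeff (fun i => u (σ i)) (permAction σ hb ρ a) (fun i => m (σ i)) (fun i => l (σ i)) =
      (b l)⁻¹ * (b m * matCoeff u (ρ a) m l) := by
  rw [matCoeff, permAction_ket, map_smul, Finsupp.smul_apply, repr_permEquiv, smul_eq_mul, matCoeff]

theorem exists_comp_perm (σ : Equiv.Perm (Fin n)) (l : Fin n → FinPartition) :
    ∃ m : Fin n → FinPartition, l = fun i => m (σ i) :=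
  ⟨fun i => l (σ.symm i), funext fun i => congrArg l (σ.symm_apply_apply i).symm⟩

theorem isAddBox_comp_perm (σ : Equiv.Perm (Fin n)) (l m : Fin n → FinPartition) (i : Fin n)
    (s : ℕ) : IsAddBox (fun i => l (σ i)) (fun i => m (σ i)) i s ↔ IsAddBox l m (σ i) s := by
  refine and_congr Iff.rfl ⟨fun hh k hk => ?_, fun hh k hk => hh _ fun e => hk (σ.injective e)⟩
  have := hh (σ.symm k) fun e => hk (by rw [← e, Equiv.apply_symm_apply])
  dsimp only at this
  rwa [Equiv.apply_symm_apply] at this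

/-- Conjugation multiplies the coefficient from l to m by b m / b l, which is what `interCoeff`
corrects, for e and f alike. The eigenvalues of ψ are products over all components and do not depend
on their order. -/
theorem GenericWt.isFockTensorAction_permAction (h : GenericWt q₁ q₂ u) (σ : Equiv.Perm (Fin n))
    {b : (Fin n → FinPartition) → ℂ} (hb : ∀ l, b l ≠ 0)
    (hb' : ∀ l, b l = interCoeff q₁ q₂ u σ (toTuple l))
    {ρ : EAlg q₁ q₂ →ₐ[ℂ] Module.End ℂ (FockTensor u)} (hρ : IsFockTensorAction q₁ q₂ u ρ) :
    IsFockTensorAction q₁ q₂ (fun i => u (σ i)) (permAction σ hb ρ) where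
  e_box a l m i s hm := by
    obtain ⟨l, rfl⟩ := exists_comp_perm σ l
    obtain ⟨m, rfl⟩ := exists_comp_perm σ m
    rw [isAddBox_comp_perm] at hm
    have key := h.interCoeff_mul_tupleE σ (toTuple l) i s
    rw [← (isAddBox_iff _ _ _ _).mp hm, ← hb', ← hb', ← h.tensorE_eq] at key
    have key' : b m * _ = b l * tensorE q₁ q₂ (fun i => u (σ i)) (fun i => l (σ i)) i s :=
      key.trans (congrArg _ ((h.comp σ σ.injective).tensorE_eq _ i s).symm)
    rw [matCoeff_permAction, hρ.e_box a l m _ s hm, ← mul_assoc (b m), key', mul_assoc,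
      inv_mul_cancel_left₀ (hb l)]
  e_zero a l m hm := by
    obtain ⟨l, rfl⟩ := exists_comp_perm σ l
    obtain ⟨m, rfl⟩ := exists_comp_perm σ m
    rw [matCoeff_permAction, hρ.e_zero a l m, mul_zero, mul_zero]
    intro i s hh
    obtain ⟨i, rfl⟩ := σ.surjective i
    exact hm i s ((isAddBox_comp_perm σ l m i s).mpr hh)
  f_box a l m i s hm := by
    obtain ⟨l, rfl⟩ := exists_comp_perm σ l
    obtain ⟨m, rfl⟩ := exists_comp_perm σ m
    rw [isAddBox_comp_perm] at hm
    have key := h.interCoeff_mul_tupleF σ (toTuple l) i s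
    rw [← (isAddBox_iff _ _ _ _).mp hm, ← hb', ← hb', ← h.tensorF_eq] at key
    have key' : b l * _ = b m * tensorF q₁ q₂ (fun i => u (σ i)) (fun i => l (σ i)) i s :=
      key.symm.trans (congrArg _ ((h.comp σ σ.injective).tensorF_eq _ i s).symm)
    rw [matCoeff_permAction, hρ.f_box a l m _ s hm, ← mul_assoc (b l), key', mul_assoc,
      inv_mul_cancel_left₀ (hb m)]
  f_zero a l m hm := by
    obtain ⟨l, rfl⟩ := exists_comp_perm σ l
    obtain ⟨m, rfl⟩ := exists_comp_perm σ m
    rw [matCoeff_permAction, hρ.f_zero a l m, mul_zero, mul_zero]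
    intro i s hh
    obtain ⟨i, rfl⟩ := σ.surjective i
    exact hm i s ((isAddBox_comp_perm σ l m i s).mpr hh)
  psiPlus k l := by
    obtain ⟨l, rfl⟩ := exists_comp_perm σ l
    rw [permAction_ket, hρ.psiPlus, map_smul, permEquiv_ket, smul_comm, inv_smul_smul₀ (hb l),
      ← Equiv.prod_comp σ]
  psiMinus k l := by
    obtain ⟨l, rfl⟩ := exists_comp_perm σ l
    rw [permAction_ket, hρ.psiMinus, map_smul, permEquiv_ket, smul_comm, inv_smul_smul₀ (hb l),
      ← Equiv.prod_comp σ]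

end Intertwiner

end

theorem mainTheorem8 {n : ℕ} (q₁ q₂ : ℂ) (u : Fin n → ℂ)
    (hgen : IsGeneric (Sum.elim ![q₁, q₂] u)) (σ : Equiv.Perm (Fin n)) :
    ∃ (ρ : EAlg q₁ q₂ →ₐ[ℂ] Module.End ℂ (FockTensor u))
      (ρ' : EAlg q₁ q₂ →ₐ[ℂ] Module.End ℂ (FockTensor fun i => u (σ i))),
      IsFockTensorAction q₁ q₂ u ρ ∧
      IsFockTensorAction q₁ q₂ (fun i => u (σ i)) ρ' ∧
      ∃ b : (Fin n → FinPartition) → ℂ, (∀ l, b l ≠ 0) ∧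
        ∃ φ : FockTensor u ≃ₗ[ℂ] FockTensor (fun i => u (σ i)),
          (∀ l : Fin n → FinPartition,
            φ (ket u l) = b l • ket (fun i => u (σ i)) (fun i => l (σ i))) ∧
          ∀ (a : EAlg q₁ q₂) (v : FockTensor u), φ (ρ a v) = ρ' a (φ v) := by
  have h := hgen.genericWt
  have hb : ∀ l, interCoeff q₁ q₂ u σ (toTuple l) ≠ 0 := fun l => h.interCoeff_ne σ (toTuple l)
  -- The second action is the first one transported along φ, so φ intertwines them by construction;
  -- the content lies in its having the prescribed matrix coefficients.
  exact ⟨h.tensorAction, permAction σ hb h.tensorAction, h.isFockTensorAction,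
    h.isFockTensorAction_permAction σ hb (fun _ => rfl) h.isFockTensorAction, _, hb,
    permEquiv u σ hb, permEquiv_ket u σ hb, permEquiv_action σ hb h.tensorAction⟩
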